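/- **Setting.** For a finite simple graph $G=(V,E)$ with $n=|V|$ vertices, a positive integer $q$ and a real $\lambda>1$, let $\Omega=[q]^V$ be the set of all (not necessarily proper) $q$-colourings of $V$, let $\mu(\sigma)$ be the number of monochromatic edges of $\sigma\in\Omega$, and let $\pi(\sigma)=\lambda^{\mu(\sigma)}/\sum_{\sigma'\in\Omega}\lambda^{\mu(\sigma')}$ be the Gibbs distribution of the $q$-state Potts model at activity $\lambda$. The Glauber dynamics is the Markov chain on $\Omega$ that in each step chooses a uniformly random vertex $v$ and gives it a new colour $c$ with probability proportional to $\lambda^{n(X,v,c)}$, where $X$ is the current colouring and $n(X,v,c)$ is the number of neighbours of $v$ of colour $c$ in $X$. Its mixing time is $\tau(G,\lambda,q,\varepsilon)=\max_{x\in\Omega}\min\{t:\|P^t(x,\cdot)-\pi\|_{TV}\le\varepsilon\}$, where $P$ is the transition matrix. For fixed $\lambda,q$, the dynamics *mixes rapidly* for a class of graphs if there are constants $C\ge 0$ and $k\in\mathbb N$ with $\tau(G,\lambda,q,\varepsilon)\le C\,n^k\,(1+\log\varepsilon^{-1})$ for all $G$ in the class ($n$ being its number of vertices) and all $\varepsilon\in(0,1)$.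 It *mixes slowly for almost all 4-regular graphs* if there is $a>0$ such that the probability that a uniformly random 4-regular graph $G$ on $n$ labelled vertices satisfies $\tau(G,\lambda,q,\varepsilon)\ge e^{an}$ for all $\varepsilon\in(0,\tfrac1{2e}]$ tends to $1$ as $n\to\infty$. The toroidal $L\times L$ grid has vertex set $(\mathbb Z/L\mathbb Z)^2$, two distinct vertices being adjacent if and only if they agree in one coordinate and differ by $\pm1$ in the other. **Theorem.** (A) For every $\eta\in(0,1)$ there are constants $c_3,c_4,c_5>0$, depending only on $\eta$, such that for every positive integer $q$ and every real $\lambda>1$: (i) if $q>c_3\lambda^{3+\eta}$, then the Glauber dynamics of the $q$-state Potts model at activity $\lambda$ mixes rapidly for the class of connected graphs of maximum degree at most $4$; (ii) if $q>c_4\lambda^{2+\eta}$, then it mixes rapidly for the class of toroidal $L\times L$ grids, $L\ge1$; (iii) if $q\ge2$ and $q<c_5\lambda^{8/3-\eta}$, then it mixes slowly for almost all 4-regular graphs. (B) In particular, for every sufficiently large $\lambda$ there is a positive integer $q$ such that the Glauber dynamics of the $q$-state Potts model at activity $\lambda$ mixes rapidly for the toroidal grids, but slowly for almost all 4-regular graphs.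 (C) (Detailed form of (ii).) Let $G$ be the toroidal $L\times L$ grid, $n=L^2$, let $\lambda>1$, and let $r\le L-2$ be a positive integer. If $q$ is an integer with $q\ge 2^{r^2+8r+3}\,r^{2r^2+4r+1}\,\lambda^{2+2/r}$, then for all $\varepsilon\in(0,1]$ $$\tau(G,\lambda,q,\varepsilon)\le 4\,(4\lambda^8)^{r^2+1}\,n^2\,\log(2en)\,\bigl(n\log(4\lambda^6)+\log(\varepsilon^{-1})\bigr).$$ -/

import Mathlib

open Filter Topology

noncomputable section

/-! ## Mixing times of finite Markov chains -/

/-- Total variation distance between two distributions on a finite set. -/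
def tvDist {Ω : Type*} [Fintype Ω] (φ ψ : Ω → ℝ) : ℝ :=
  (1 / 2) * ∑ x, |φ x - ψ x|

/-- `τ_x(ε)`: the least `t` such that the law after `t` steps from `x` is within `ε` of the
stationary distribution `π` (and `⊤` if there is no such `t`). -/
def mixingTimeFrom {Ω : Type*} [Fintype Ω] [DecidableEq Ω]
    (P : Matrix Ω Ω ℝ) (π : Ω → ℝ) (x : Ω) (ε : ℝ) : ℕ∞ :=
  ⨅ t ∈ {t : ℕ | tvDist ((P ^ t) x) π ≤ ε}, (t : ℕ∞)

/-- `τ(ε) = max_x τ_x(ε)`. -/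
def mixingTime {Ω : Type*} [Fintype Ω] [DecidableEq Ω]
    (P : Matrix Ω Ω ℝ) (π : Ω → ℝ) (ε : ℝ) : ℕ∞ :=
  ⨆ x, mixingTimeFrom P π x ε

/-! ## The Potts model and its Glauber dynamics -/

namespace Potts

/-- The number of monochromatic edges of `G` in the configuration `σ`. -/
def monoEdges {V : Type*} (G : SimpleGraph V) {q : ℕ} (σ : V → Fin q) : ℕ :=
  {e ∈ G.edgeSet | (e.map σ).IsDiag}.ncard

open Classical in
/-- The partition function. -/
def partitionFunction {V : Type*} [Fintype V] (G : SimpleGraph V) (lam : ℝ) (q : ℕ) : ℝ :=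
  ∑ σ : V → Fin q, lam ^ monoEdges G σ

/-- The Gibbs distribution. -/
def gibbs {V : Type*} [Fintype V] (G : SimpleGraph V) (lam : ℝ) (q : ℕ) (σ : V → Fin q) : ℝ :=
  lam ^ monoEdges G σ / partitionFunction G lam q

/-- The number of neighbours of `v` that have colour `c` in `X`. -/
def colourCount {V : Type*} (G : SimpleGraph V) {q : ℕ} (X : V → Fin q) (v : V) (c : Fin q) : ℕ :=
  {u | G.Adj v u ∧ X u = c}.ncard

/-- The distribution of the new colour of `v` when `v` is updated in the configuration `X`. -/
def localGibbs {V : Type*} (G : SimpleGraph V) (lam : ℝ) {q : ℕ} (X : V → Fin q) (v : V)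
    (c : Fin q) : ℝ :=
  lam ^ colourCount G X v c / ∑ d : Fin q, lam ^ colourCount G X v d

open Classical in
/-- The transition matrix of the Glauber dynamics: a uniformly random vertex `v` gets a new
colour drawn from `localGibbs G lam X v`, and every other vertex keeps its colour. -/
def glauber {V : Type*} [Fintype V] (G : SimpleGraph V) (lam : ℝ) (q : ℕ) :
    Matrix (V → Fin q) (V → Fin q) ℝ :=
  fun X Y => ∑ v : V, (1 / (Fintype.card V : ℝ)) *
    ∑ c : Fin q, localGibbs G lam X v c * (if Y = Function.update X v c then 1 else 0)

open Classical in
/-- The mixing time `τ(ε)` of the Glauber dynamics of the `q`-state Potts model on `G` at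
activity `lam`. -/
def glauberMixingTime {V : Type*} [Fintype V] (G : SimpleGraph V) (lam : ℝ) (q : ℕ) (ε : ℝ) :
    ℕ∞ :=
  mixingTime (glauber G lam q) (gibbs G lam q) ε

/-! ## Classes of graphs, rapid and slow mixing -/

/-- A finite simple graph. -/
structure FinGraph where
  /-- the vertex set -/
  V : Type
  [fintype : Fintype V]
  /-- the graph itself -/
  graph : SimpleGraph V

attribute [instance] FinGraph.fintype

/-- The Glauber dynamics mixes rapidly for a class of graphs: its mixing time is bounded by a
polynomial in the number of vertices (and in `log ε⁻¹`), the same for all graphs in the class. -/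
def MixesRapidly (𝒢 : Set FinGraph) (lam : ℝ) (q : ℕ) : Prop :=
  ∃ (C : ℝ) (k : ℕ), 0 ≤ C ∧ ∀ G ∈ 𝒢, ∀ ε : ℝ, 0 < ε → ε < 1 →
    (glauberMixingTime G.graph lam q ε : ENNReal) ≤
      ENNReal.ofReal (C * (Fintype.card G.V : ℝ) ^ k * (1 + Real.log ε⁻¹))

open Classical in
/-- The class of connected graphs of maximum degree (at most) 4. -/
def connectedMaxDegreeFour : Set FinGraph :=
  {G | G.graph.Connected ∧ ∀ v, G.graph.degree v ≤ 4}

/-- The toroidal `L × L` grid, on the vertex set `(ℤ/Lℤ)²`. -/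
def torusGraph (L : ℕ) : SimpleGraph (ZMod L × ZMod L) where
  Adj x y := x ≠ y ∧
    (((x.1 - y.1 = 1 ∨ x.1 - y.1 = -1) ∧ x.2 - y.2 = 0) ∨
      ((x.2 - y.2 = 1 ∨ x.2 - y.2 = -1) ∧ x.1 - y.1 = 0))
  symm := ⟨by
    rintro ⟨a, b⟩ ⟨c, d⟩ ⟨hne, h⟩
    refine ⟨hne.symm, ?_⟩
    have key : ∀ s t : ZMod L, (s - t = 1 ∨ s - t = -1) → (t - s = 1 ∨ t - s = -1) := by
      intro s t hst
      rw [← neg_sub s t]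
      rcases hst with hst | hst
      · exact Or.inr (by rw [hst])
      · exact Or.inl (by rw [hst, neg_neg])
    have key0 : ∀ s t : ZMod L, s - t = 0 → t - s = 0 := by
      intro s t hst
      rw [← neg_sub s t, hst, neg_zero]
    rcases h with ⟨h1, h2⟩ | ⟨h1, h2⟩
    · exact Or.inl ⟨key _ _ h1, key0 _ _ h2⟩
    · exact Or.inr ⟨key _ _ h1, key0 _ _ h2⟩⟩
  loopless := ⟨fun _ h => h.1 rfl⟩

/-- The class of all toroidal grids. -/
def toroidalGrids : Set FinGraph :=
  {G | ∃ (L : ℕ) (_ : NeZero L), G = { V := ZMod L × ZMod L, graph := torusGraph L }}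

open Classical in
/-- The 4-regular graphs on the vertex set `Fin n`. -/
def fourRegularGraphs (n : ℕ) : Set (SimpleGraph (Fin n)) :=
  {G | G.IsRegularOfDegree 4}

/-- The property `A` holds for almost all 4-regular graphs: a uniformly random 4-regular graph on
`n` labelled vertices has it with probability tending to 1 as `n → ∞`. -/
def AlmostAllFourRegular (A : ∀ n : ℕ, SimpleGraph (Fin n) → Prop) : Prop :=
  Tendsto (fun n : ℕ =>
      ({G ∈ fourRegularGraphs n | A n G}.ncard : ℝ) / ((fourRegularGraphs n).ncard : ℝ))
    atTop (𝓝 1)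

/-- The Glauber dynamics mixes slowly for almost all 4-regular graphs: for some rate `a > 0`,
`τ(ε) ≥ exp (a n)` for every `ε ≤ 1/(2e)` holds for almost all 4-regular graphs. -/
def MixesSlowlyAlmostAllFourRegular (lam : ℝ) (q : ℕ) : Prop :=
  ∃ a : ℝ, 0 < a ∧ AlmostAllFourRegular (fun n G =>
    ∀ ε : ℝ, 0 < ε → ε ≤ 1 / (2 * Real.exp 1) →
      ENNReal.ofReal (Real.exp (a * n)) ≤ (glauberMixingTime G lam q ε : ENNReal))

end Potts

end

/-! Rapid mixing. Resample a random block of vertices from its conditional distribution. This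
operator is an average of orthogonal projections in L² of the Gibbs weight. If q ≥ K λ^κ, where
every edge set F meeting a block B can be monochromatic in at most q^k colourings of B with |F| ≤
κ(|B| - k), then expanding over the set of monochromatic edges shows that the conditional law on B
is nearly uniform, for every boundary condition. Hence a discrepancy at a vertex v disappears in the
blocks that contain v, while a block that v touches from outside barely amplifies it. The block
dynamics therefore contracts the Lipschitz seminorm (`GoodBlocks.lip`). Contraction bounds the L²
norm because the operator is self-adjoint and norms of its iterates are log-convex
(`GoodBlocks.sum_mul_blockAvg_le`). This gives a Poincaré inequality for blocks. Inside one block of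
bounded size the weight is comparable with a product measure, whose variance tensorizes
(`dirichlet_le_mul_sum`), so a single-site Poincaré inequality follows with a constant independent
of n (`poincare_of_blocks`), and with it polynomial mixing.

The exponents are edge densities. In maximum degree 4, a set C of vertices meets at most 4|C| edges,
and a connected block of r vertices saves about one edge per vertex, so κ = 3 + 1/r
(`Linked.sparse`). An r × r block of the torus meets at most 2r² + 2r edges, and the same density
bounds its parts, so κ = 2 + 2/r (`torus_sparse`).

Slow mixing. In a random 4-regular graph, sets of s = ⌊βn⌋ vertices span at most (1 + δ)s edges with
high probability. This is a union bound resting on a switching estimate: f prescribed edges are all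
present with probability at most (8/n)^f (`card_containing_le`). Consider colourings in which
exactly s vertices avoid a colour c₀. Compared with the constant colouring, about 4s - (1 + δ)s
edges meet the minority. A minority with |F| monochromatic edges has at most q^(s - |F|/4)
colourings and regains |F| edges, so the worst case is |F| ≈ s. There the total exponent of λ is at
most 2n - 2s + (3/4)s·log_λ q up to errors of order δs, below 2n by a multiple of s when q < λ^(8/3
- η). The layer is thus exponentially light and separates the colourings dominated by c₀ from at
least half of the measure, a bottleneck (`half_sub_le_of_sparse`).

The separation for large λ holds because 2 < 8/3: for small η the range between λ^(2 + η) and λ^(8/3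
- η) contains an integer q. -/

set_option linter.unusedSectionVars false

/-! ## Conditional expectations of finite spin systems -/

namespace SpinSystem

open Classical

variable {V S : Type*} [Fintype V] [Fintype S]

/-- The configurations that agree with `σ` outside `B`. -/
noncomputable def cls (B : Finset V) (σ : V → S) : Finset (V → S) :=
  {τ | ∀ v, v ∉ B → τ v = σ v}

theorem mem_cls {B : Finset V} {σ τ : V → S} : τ ∈ cls B σ ↔ ∀ v, v ∉ B → τ v = σ v := by
  simp [cls]

theorem self_mem_cls (B : Finset V) (σ : V → S) : σ ∈ cls B σ := mem_cls.2 fun _ _ => rfl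

theorem cls_nonempty (B : Finset V) (σ : V → S) : (cls B σ).Nonempty := ⟨σ, self_mem_cls B σ⟩

theorem mem_cls_comm {B : Finset V} {σ τ : V → S} : τ ∈ cls B σ ↔ σ ∈ cls B τ := by
  simp only [mem_cls, eq_comm]

theorem cls_eq_of_mem {B : Finset V} {σ τ : V → S} (h : τ ∈ cls B σ) : cls B τ = cls B σ := by
  ext ρ
  rw [mem_cls] at h
  simp only [mem_cls]
  constructor
  · intro h' v hv; rw [h' v hv, h v hv]
  · intro h' v hv; rw [h' v hv, h v hv]

theorem cls_mono {B C : Finset V} (h : B ⊆ C) (σ : V → S) : cls B σ ⊆ cls C σ := by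
  intro τ hτ
  rw [mem_cls] at *
  exact fun v hv => hτ v fun hB => hv (h hB)

theorem cls_univ (σ : V → S) : cls Finset.univ σ = Finset.univ := by
  ext; simp [mem_cls]

theorem update_mem_cls {B : Finset V} {v : V} (hv : v ∈ B) (σ : V → S) (c : S) :
    Function.update σ v c ∈ cls B σ := by
  rw [mem_cls]
  intro u hu
  rw [Function.update_of_ne]
  rintro rfl
  exact hu hv

theorem update_mem_cls_update {B : Finset V} {σ τ : V → S} (h : τ ∈ cls B σ) (v : V) (c : S) :
    Function.update τ v c ∈ cls B (Function.update σ v c) := by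
  rw [mem_cls] at *
  intro u hu
  by_cases huv : u = v
  · subst huv; simp
  · simp [huv, h u hu]

/-- The configurations that agree with `σ` except possibly at `v`. -/
theorem sum_cls_singleton (v : V) (σ : V → S) (f : (V → S) → ℝ) :
    ∑ τ ∈ cls {v} σ, f τ = ∑ c, f (Function.update σ v c) := by
  symm
  refine Finset.sum_bij (fun c _ => Function.update σ v c) ?_ ?_ ?_ ?_
  · intro c _; exact update_mem_cls (by simp) σ c
  · intro c _ d _ h; simpa using congrFun h v
  · intro τ hτ
    refine ⟨τ v, Finset.mem_univ _, ?_⟩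
    ext u
    by_cases huv : u = v
    · subst huv; simp
    · simp [huv, mem_cls.1 hτ u (by simpa using huv)]
  · intros; rfl

theorem card_cls (B : Finset V) (σ : V → S) : (cls B σ).card = Fintype.card S ^ B.card := by
  have : (cls B σ).card = Fintype.card (B → S) := by
    rw [← Finset.card_univ]
    refine Finset.card_bij (fun τ _ => fun v : B => τ v) (by simp) ?_ ?_
    · intro τ hτ ρ hρ h
      ext v
      by_cases hv : v ∈ B
      · exact congrFun h ⟨v, hv⟩
      · rw [mem_cls.1 hτ v hv, mem_cls.1 hρ v hv]
    · intro g _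
      refine ⟨fun v => if h : v ∈ B then g ⟨v, h⟩ else σ v, ?_, ?_⟩
      · rw [mem_cls]; intro v hv; simp [hv]
      · ext v; simp
  rw [this]; simp

/-- A change at a vertex outside `B` identifies two classes. -/
theorem sum_cls_update {B : Finset V} {v : V} (hv : v ∉ B) (σ : V → S) (c : S)
    (f : (V → S) → ℝ) :
    ∑ τ ∈ cls B (Function.update σ v c), f τ = ∑ τ ∈ cls B σ, f (Function.update τ v c) := by
  symm
  refine Finset.sum_bij (fun τ _ => Function.update τ v c) ?_ ?_ ?_ ?_
  · intro τ hτ; exact update_mem_cls_update hτ v c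
  · intro τ hτ ρ hρ h
    ext u
    by_cases huv : u = v
    · subst huv; rw [mem_cls.1 hτ u hv, mem_cls.1 hρ u hv]
    · simpa [huv] using congrFun h u
  · intro τ hτ
    refine ⟨Function.update τ v (σ v), ?_, ?_⟩
    · rw [mem_cls] at *
      intro u hu
      by_cases huv : u = v
      · subst huv; simp
      · simp [huv, hτ u hu]
    · have := mem_cls.1 hτ v hv
      simp only [Function.update_self] at this
      simp [← this]
  · intros; rfl

/-- The expectation of `f` given the configuration outside `B`, for the weight `w`. -/
noncomputable def condExp (w : (V → S) → ℝ) (B : Finset V) (f : (V → S) → ℝ) (σ : V → S) : ℝ :=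
  (∑ τ ∈ cls B σ, w τ * f τ) / ∑ τ ∈ cls B σ, w τ

/-- The (unnormalized) expectation of the variance of `f` given the configuration outside `B`. -/
noncomputable def dirichlet (w : (V → S) → ℝ) (B : Finset V) (f : (V → S) → ℝ) : ℝ :=
  ∑ σ, w σ * (f σ - condExp w B f σ) ^ 2

/-- `g` depends only on the configuration outside `B`. -/
def Indep (B : Finset V) (g : (V → S) → ℝ) : Prop := ∀ σ, ∀ τ ∈ cls B σ, g τ = g σ

/-! ### Conditional expectations as orthogonal projections in weighted L². -/

variable {w : (V → S) → ℝ}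

theorem sum_cls_pos (hw : ∀ σ, 0 < w σ) (B : Finset V) (σ : V → S) : 0 < ∑ τ ∈ cls B σ, w τ :=
  Finset.sum_pos (fun τ _ => hw τ) (cls_nonempty B σ)

theorem indep_condExp (w : (V → S) → ℝ) (B : Finset V) (f : (V → S) → ℝ) :
    Indep B (condExp w B f) := by
  intro σ τ hτ
  simp only [condExp, cls_eq_of_mem hτ]

theorem condExp_eq_of_indep (hw : ∀ σ, 0 < w σ) {B : Finset V} {g : (V → S) → ℝ}
    (hg : Indep B g) : condExp w B g = g := by
  ext σ
  rw [condExp, div_eq_iff (sum_cls_pos hw B σ).ne', Finset.mul_sum]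
  refine Finset.sum_congr rfl fun τ hτ => ?_
  rw [hg σ τ hτ, mul_comm]

/-- The kernel w(σ)w(τ) / w(class of σ), supported on pairs in one class, is symmetric. Hence
conditional expectation is self-adjoint. -/
theorem sum_condExp_mul (w : (V → S) → ℝ) (B : Finset V) (f g : (V → S) → ℝ) :
    ∑ σ, w σ * (condExp w B f σ * g σ) = ∑ σ, w σ * (f σ * condExp w B g σ) := by
  have key : ∀ f g : (V → S) → ℝ, ∑ σ, w σ * (condExp w B f σ * g σ) =
      ∑ σ, ∑ τ, if τ ∈ cls B σ then w σ * w τ * f τ * g σ / ∑ ρ ∈ cls B σ, w ρ else 0 := by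
    intro f g
    refine Finset.sum_congr rfl fun σ _ => ?_
    rw [← Finset.sum_filter, Finset.filter_mem_eq_inter, Finset.univ_inter, condExp,
      Finset.sum_div, Finset.sum_mul, Finset.mul_sum]
    refine Finset.sum_congr rfl fun τ _ => ?_
    ring
  rw [key f g, Finset.sum_comm]
  have h2 : ∑ σ, w σ * (f σ * condExp w B g σ) = ∑ σ, w σ * (condExp w B g σ * f σ) :=
    Finset.sum_congr rfl fun σ _ => by ring
  rw [h2, key g f]
  refine Finset.sum_congr rfl fun σ _ => Finset.sum_congr rfl fun τ _ => ?_
  by_cases h : τ ∈ cls B σ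
  · rw [if_pos h, if_pos (mem_cls_comm.1 h), cls_eq_of_mem h]; ring
  · rw [if_neg h, if_neg fun h' => h (mem_cls_comm.1 h')]

theorem sum_sub_condExp_mul (hw : ∀ σ, 0 < w σ) {B : Finset V} (f : (V → S) → ℝ)
    {g : (V → S) → ℝ} (hg : Indep B g) :
    ∑ σ, w σ * ((f σ - condExp w B f σ) * g σ) = 0 := by
  have h := sum_condExp_mul w B f g
  rw [condExp_eq_of_indep hw hg] at h
  simp only [sub_mul, mul_sub, Finset.sum_sub_distrib, h, sub_self]

theorem Indep.sub {B : Finset V} {f g : (V → S) → ℝ} (hf : Indep B f) (hg : Indep B g) :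
    Indep B fun σ => f σ - g σ := by
  intro σ τ hτ
  simp only [hf σ τ hτ, hg σ τ hτ]

/-- Pythagoras: f minus its projection is orthogonal to every function of the configuration outside
B. -/
theorem dirichlet_add (hw : ∀ σ, 0 < w σ) {B : Finset V} (f : (V → S) → ℝ)
    {g : (V → S) → ℝ} (hg : Indep B g) :
    ∑ σ, w σ * (f σ - g σ) ^ 2 =
      dirichlet w B f + ∑ σ, w σ * (condExp w B f σ - g σ) ^ 2 := by
  have h := sum_sub_condExp_mul hw f ((indep_condExp w B f).sub hg)
  have : ∑ σ, w σ * (f σ - g σ) ^ 2 = dirichlet w B f +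
      ∑ σ, w σ * (condExp w B f σ - g σ) ^ 2 +
      2 * ∑ σ, w σ * ((f σ - condExp w B f σ) * (condExp w B f σ - g σ)) := by
    rw [dirichlet, Finset.mul_sum, ← Finset.sum_add_distrib, ← Finset.sum_add_distrib]
    exact Finset.sum_congr rfl fun σ _ => by ring
  rw [this, h]; ring

theorem dirichlet_le (hw : ∀ σ, 0 < w σ) {B : Finset V} (f : (V → S) → ℝ)
    {g : (V → S) → ℝ} (hg : Indep B g) :
    dirichlet w B f ≤ ∑ σ, w σ * (f σ - g σ) ^ 2 := by
  rw [dirichlet_add hw f hg]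
  have : 0 ≤ ∑ σ, w σ * (condExp w B f σ - g σ) ^ 2 :=
    Finset.sum_nonneg fun σ _ => mul_nonneg (hw σ).le (sq_nonneg _)
  linarith

theorem dirichlet_nonneg (hw : ∀ σ, 0 < w σ) (B : Finset V) (f : (V → S) → ℝ) :
    0 ≤ dirichlet w B f :=
  Finset.sum_nonneg fun σ _ => mul_nonneg (hw σ).le (sq_nonneg _)

theorem dirichlet_eq (hw : ∀ σ, 0 < w σ) (B : Finset V) (f : (V → S) → ℝ) :
    dirichlet w B f = ∑ σ, w σ * f σ ^ 2 - ∑ σ, w σ * (f σ * condExp w B f σ) := by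
  have h := sum_sub_condExp_mul hw f (indep_condExp w B f)
  have : dirichlet w B f = ∑ σ, w σ * f σ ^ 2 - ∑ σ, w σ * (f σ * condExp w B f σ) -
      ∑ σ, w σ * ((f σ - condExp w B f σ) * condExp w B f σ) := by
    rw [dirichlet, ← Finset.sum_sub_distrib, ← Finset.sum_sub_distrib]
    exact Finset.sum_congr rfl fun σ _ => by ring
  rw [this, h, sub_zero]

theorem sum_condExp_sq (hw : ∀ σ, 0 < w σ) (B : Finset V) (f : (V → S) → ℝ) :
    ∑ σ, w σ * condExp w B f σ ^ 2 = ∑ σ, w σ * (f σ * condExp w B f σ) := by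
  have h := sum_condExp_mul w B f (condExp w B f)
  rw [condExp_eq_of_indep hw (indep_condExp w B f)] at h
  rw [← h]
  exact Finset.sum_congr rfl fun σ _ => by ring

theorem sum_condExp_sq_le (hw : ∀ σ, 0 < w σ) (B : Finset V) (f : (V → S) → ℝ) :
    ∑ σ, w σ * condExp w B f σ ^ 2 ≤ ∑ σ, w σ * f σ ^ 2 := by
  have := dirichlet_nonneg hw B f
  rw [dirichlet_eq hw] at this
  rw [sum_condExp_sq hw]; linarith

/-! ### Tensorization of the variance and comparison with a product measure. -/

theorem Indep.mono {B C : Finset V} (h : B ⊆ C) {g : (V → S) → ℝ} (hg : Indep C g) : Indep B g :=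
  fun σ _ hτ => hg σ _ (cls_mono h σ hτ)

theorem indep_insert {B : Finset V} {v : V} {g : (V → S) → ℝ} (hB : Indep B g)
    (hv : Indep {v} g) : Indep (insert v B) g := by
  intro σ τ hτ
  have h1 : Function.update τ v (σ v) ∈ cls B σ := by
    rw [mem_cls] at *
    intro u hu
    by_cases huv : u = v
    · subst huv; simp
    · simp [huv, hτ u (by simp [huv, hu])]
  rw [← hB σ _ h1]
  exact (hv τ _ (update_mem_cls (by simp) τ (σ v))).symm

theorem condExp_singleton_of_indep [Nonempty S] (hw : ∀ σ, 0 < w σ) {v : V} (hv : Indep {v} w)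
    (f : (V → S) → ℝ) (σ : V → S) :
    condExp w {v} f σ = (∑ c, f (Function.update σ v c)) / Fintype.card S := by
  rw [condExp, sum_cls_singleton, sum_cls_singleton]
  have : ∀ c, w (Function.update σ v c) = w σ := fun c => hv σ _ (update_mem_cls (by simp) σ c)
  simp only [this, ← Finset.mul_sum, Finset.sum_const, Finset.card_univ, nsmul_eq_mul]
  have := (hw σ).ne'
  field_simp

/-- Efron–Stein for a weight that is uniform on each class. Average the approximant over one more
vertex v: Pythagoras splits the new error into the variance of f at v and the projection of the old
error, which has not grown. Uniformity is what lets averaging at v preserve independence of the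
other vertices. -/
theorem exists_indep_sum_le [Nonempty S] (hw : ∀ σ, 0 < w σ) (f : (V → S) → ℝ) (B : Finset V)
    (hB : Indep B w) :
    ∃ g, Indep B g ∧ ∑ σ, w σ * (f σ - g σ) ^ 2 ≤ ∑ v ∈ B, dirichlet w {v} f := by
  induction B using Finset.induction_on with
  | empty =>
    refine ⟨f, ?_, by simp⟩
    intro σ τ hτ
    rw [show τ = σ from funext fun v => mem_cls.1 hτ v (by simp)]
  | insert v B hv ih =>
    obtain ⟨g, hg, hle⟩ := ih (hB.mono (Finset.subset_insert v B))
    have hwv : Indep {v} w := hB.mono (by simp)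
    refine ⟨condExp w {v} g, indep_insert ?_ (indep_condExp w {v} g), ?_⟩
    · intro σ τ hτ
      rw [condExp_singleton_of_indep hw hwv, condExp_singleton_of_indep hw hwv]
      congr 1
      exact Finset.sum_congr rfl fun c _ => hg _ _ (update_mem_cls_update hτ v c)
    · rw [dirichlet_add hw f (indep_condExp w {v} g), Finset.sum_insert hv]
      have h1 : ∀ σ, condExp w {v} f σ - condExp w {v} g σ =
          condExp w {v} (fun σ => f σ - g σ) σ := by
        intro σ
        simp only [condExp, mul_sub, Finset.sum_sub_distrib, sub_div]
      simp only [h1]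
      have := sum_condExp_sq_le hw {v} (fun σ => f σ - g σ)
      linarith

/-- The Poincaré inequality of a block, by comparison with the product measure. -/
theorem dirichlet_le_mul_sum [Nonempty S] (hw : ∀ σ, 0 < w σ) (B : Finset V) {R : ℝ}
    (hR : ∀ σ, ∀ τ ∈ cls B σ, w τ ≤ R * w σ) (f : (V → S) → ℝ) :
    dirichlet w B f ≤ R * ∑ v ∈ B, dirichlet w {v} f := by
  -- The comparison weight is the minimum of w on the class. It is constant on classes and satisfies
  -- m ≤ w ≤ R m, so the loss is a single factor R.
  set m : (V → S) → ℝ := fun σ => (cls B σ).inf' (cls_nonempty B σ) w with hm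
  have hmw : ∀ σ, m σ ≤ w σ := fun σ => Finset.inf'_le _ (self_mem_cls B σ)
  have hmin : ∀ σ, ∃ τ ∈ cls B σ, m σ = w τ := fun σ =>
    Finset.exists_mem_eq_inf' (cls_nonempty B σ) w
  have hm0 : ∀ σ, 0 < m σ := by
    intro σ
    obtain ⟨τ, -, h⟩ := hmin σ
    rw [h]; exact hw τ
  have hwm : ∀ σ, w σ ≤ R * m σ := by
    intro σ
    obtain ⟨τ, hτ, h⟩ := hmin σ
    rw [h]; exact hR τ σ (mem_cls_comm.1 hτ)
  have hmi : Indep B m := by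
    intro σ τ hτ
    simp only [hm, cls_eq_of_mem hτ]
  have hR0 : 0 ≤ R := by
    have σ : V → S := fun _ => Classical.arbitrary S
    have := hR σ σ (self_mem_cls B σ)
    nlinarith [hw σ]
  obtain ⟨g, hg, hle⟩ := exists_indep_sum_le hm0 f B hmi
  calc dirichlet w B f ≤ ∑ σ, w σ * (f σ - g σ) ^ 2 := dirichlet_le hw f hg
    _ ≤ R * ∑ σ, m σ * (f σ - g σ) ^ 2 := by
        rw [Finset.mul_sum]
        refine Finset.sum_le_sum fun σ _ => ?_
        rw [← mul_assoc]
        exact mul_le_mul_of_nonneg_right (hwm σ) (sq_nonneg _)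
    _ ≤ R * ∑ v ∈ B, dirichlet w {v} f := by
        refine mul_le_mul_of_nonneg_left (hle.trans (Finset.sum_le_sum fun v _ => ?_)) hR0
        refine (dirichlet_le hm0 f (indep_condExp w {v} f)).trans ?_
        exact Finset.sum_le_sum fun σ _ => mul_le_mul_of_nonneg_right (hmw σ) (sq_nonneg _)

end SpinSystem

/-! ## Contraction of block dynamics -/

/-- A self-adjoint operator whose iterates decay at rate `ρ` has norm at most `ρ`: the version
for a log-convex sequence. -/
theorem logConvex_decay {b : ℕ → ℝ} {C ρ : ℝ} (hb : ∀ t, 0 ≤ b t)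
    (hconv : ∀ t, b (t + 1) ^ 2 ≤ b t * b (t + 2)) (hρ : 0 ≤ ρ) (hdecay : ∀ t, b t ≤ C * ρ ^ t) :
    b 1 ≤ ρ * b 0 := by
  by_contra! hlt
  have h1 : 0 < b 1 := lt_of_le_of_lt (mul_nonneg hρ (hb 0)) hlt
  have h0 : 0 < b 0 := by
    refine lt_of_le_of_ne (hb 0) fun h => ?_
    have := hconv 0
    rw [← h, zero_mul] at this
    nlinarith
  -- Log-convexity makes successive ratios nondecreasing, so growth is at least geometric with ratio
  -- b 1 / b 0; a ratio above ρ would eventually beat C ρ^t.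
  have hstep : ∀ t, 0 < b t ∧ 0 < b (t + 1) ∧ b 1 * b t ≤ b 0 * b (t + 1) := by
    intro t
    induction t with
    | zero => exact ⟨h0, h1, by rw [mul_comm]⟩
    | succ t ih =>
      obtain ⟨ht, ht1, hle⟩ := ih
      have hc := hconv t
      have h2 : 0 < b (t + 2) := by
        refine lt_of_le_of_ne (hb _) fun h => ?_
        rw [← h, mul_zero] at hc
        nlinarith
      refine ⟨ht1, h2, ?_⟩
      have : b t * (b 1 * b (t + 1)) ≤ b t * (b 0 * b (t + 2)) := by
        nlinarith [mul_le_mul_of_nonneg_right hle ht1.le, mul_le_mul_of_nonneg_left hc h0.le]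
      exact le_of_mul_le_mul_left this ht
  have hgrow : ∀ t, b 0 * (b 1 / b 0) ^ t ≤ b t := by
    intro t
    induction t with
    | zero => simp
    | succ t ih =>
      have := (hstep t).2.2
      calc b 0 * (b 1 / b 0) ^ (t + 1) = (b 0 * (b 1 / b 0) ^ t) * (b 1 / b 0) := by ring
        _ ≤ b t * (b 1 / b 0) := by gcongr
        _ ≤ b (t + 1) := by
          rw [mul_div_assoc', div_le_iff₀ h0]; linarith
  have hρs : ρ < b 1 / b 0 := by rwa [lt_div_iff₀ h0]
  rcases hρ.eq_or_lt with rfl | hρ0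
  · have := hdecay 1
    simp at this; linarith
  · have hr : 1 < b 1 / b 0 / ρ := by rwa [lt_div_iff₀ hρ0, one_mul]
    obtain ⟨t, ht⟩ := pow_unbounded_of_one_lt (C / b 0) hr
    have h3 := (hgrow t).trans (hdecay t)
    rw [div_pow, div_lt_div_iff₀ h0 (pow_pos hρ0 t)] at ht
    linarith

/-! ### Contraction of the Lipschitz seminorm. -/

namespace SpinSystem

open Classical

variable {V S : Type*} [Fintype V] [Fintype S] {w : (V → S) → ℝ}

/-- A change of `σ` at one vertex changes `f` by at most `D`. -/
def Lip (f : (V → S) → ℝ) (D : ℝ) : Prop := ∀ σ v c, |f (Function.update σ v c) - f σ| ≤ D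

/-- Two configurations of a class are joined by changing the vertices of B one at a time. -/
theorem Lip.osc {f : (V → S) → ℝ} {D : ℝ} (hf : Lip f D) (B : Finset V) :
    ∀ σ, ∀ τ ∈ cls B σ, |f τ - f σ| ≤ B.card * D := by
  induction B using Finset.induction_on with
  | empty =>
    intro σ τ hτ
    rw [show τ = σ from funext fun v => mem_cls.1 hτ v (by simp)]
    simp
  | insert v B hv ih =>
    intro σ τ hτ
    have h1 : Function.update τ v (σ v) ∈ cls B σ := by
      rw [mem_cls] at *
      intro u hu
      by_cases huv : u = v
      · subst huv; simp
      · simp [huv, hτ u (by simp [huv, hu])]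
    have h2 := ih σ _ h1
    have h3 := hf τ v (σ v)
    rw [Finset.card_insert_of_notMem hv]
    push_cast
    rw [abs_le] at *
    constructor <;> nlinarith

theorem exists_lip [Nonempty S] (f : (V → S) → ℝ) : ∃ D, 0 ≤ D ∧ Lip f D := by
  refine ⟨∑ σ, |f σ| + ∑ σ, |f σ|, by positivity, fun σ v c => ?_⟩
  have h : ∀ σ, |f σ| ≤ ∑ σ, |f σ| := fun σ =>
    Finset.single_le_sum (f := fun σ => |f σ|) (fun _ _ => abs_nonneg _) (Finset.mem_univ σ)
  exact (abs_sub _ _).trans (add_le_add (h _) (h _))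

/-- Split w into its uniform part h and an excess, which carries at most a proportion δ of the total
weight. The excess enters twice, in the numerator and in the normalization, whence the factor 2. -/
theorem abs_weighted_sub_average_le {α : Type*} {s : Finset α} (hs : s.Nonempty) {w g : α → ℝ}
    {h δ M : ℝ} (hh : 0 < h) (hw : ∀ x ∈ s, h ≤ w x) (hδ : ∑ x ∈ s, w x ≤ (1 + δ) * h * s.card)
    (hg : ∀ x ∈ s, |g x| ≤ M) :
    |(∑ x ∈ s, w x * g x) / ∑ x ∈ s, w x - (∑ x ∈ s, g x) / s.card| ≤ 2 * δ * M := by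
  set W := ∑ x ∈ s, w x with hW
  have hN : (0 : ℝ) < s.card := by exact_mod_cast hs.card_pos
  have hM : 0 ≤ M := by
    obtain ⟨x, hx⟩ := hs
    exact (abs_nonneg _).trans (hg x hx)
  have hWN : h * s.card ≤ W := by
    rw [hW, mul_comm, ← nsmul_eq_mul]
    exact Finset.card_nsmul_le_sum _ _ _ hw
  have hW0 : 0 < W := lt_of_lt_of_le (by positivity) hWN
  have h1 : |∑ x ∈ s, (w x - h) * g x| ≤ M * (W - h * s.card) := by
    refine (Finset.abs_sum_le_sum_abs _ _).trans ?_
    calc ∑ x ∈ s, |(w x - h) * g x| ≤ ∑ x ∈ s, (w x - h) * M := by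
          refine Finset.sum_le_sum fun x hx => ?_
          rw [abs_mul, abs_of_nonneg (sub_nonneg.2 (hw x hx))]
          exact mul_le_mul_of_nonneg_left (hg x hx) (sub_nonneg.2 (hw x hx))
      _ = M * (W - h * s.card) := by
          rw [← Finset.sum_mul, Finset.sum_sub_distrib, Finset.sum_const, nsmul_eq_mul]; ring
  have h2 : |∑ x ∈ s, g x| ≤ s.card * M := by
    refine (Finset.abs_sum_le_sum_abs _ _).trans ?_
    rw [← nsmul_eq_mul]
    exact Finset.sum_le_card_nsmul _ _ _ hg
  have h3 : (∑ x ∈ s, w x * g x) / W - (∑ x ∈ s, g x) / s.card =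
      (∑ x ∈ s, (w x - h) * g x) / W - (∑ x ∈ s, g x) * ((W - h * s.card) / (W * s.card)) := by
    simp only [sub_mul, Finset.sum_sub_distrib, ← Finset.mul_sum]
    field_simp
    ring
  have h4 : 0 ≤ W - h * s.card := sub_nonneg.2 hWN
  have h5 : (W - h * s.card) / W ≤ δ := by
    rw [div_le_iff₀ hW0]
    have hδ0 : 0 ≤ δ := by
      by_contra! hneg
      have : 0 < h * s.card := by positivity
      nlinarith
    nlinarith
  rw [h3]
  refine (abs_sub _ _).trans ?_
  rw [abs_div, abs_mul, abs_of_pos hW0, abs_of_nonneg (by positivity : 0 ≤ (W - h * s.card) / (W * s.card))]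
  calc _ ≤ M * (W - h * s.card) / W + s.card * M * ((W - h * s.card) / (W * s.card)) := by
        gcongr
    _ = 2 * ((W - h * s.card) / W) * M := by field_simp; ring
    _ ≤ 2 * δ * M := by gcongr

theorem condExp_sub_const (hw : ∀ σ, 0 < w σ) (B : Finset V) (f : (V → S) → ℝ) (σ : V → S)
    (a : ℝ) : condExp w B f σ - a = (∑ τ ∈ cls B σ, w τ * (f τ - a)) / ∑ τ ∈ cls B σ, w τ := by
  have := (sum_cls_pos hw B σ).ne'
  rw [condExp]
  simp only [mul_sub, Finset.sum_sub_distrib, ← Finset.sum_mul]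
  field_simp

/-- The effect of a change at `v` on the conditional expectation in a block that contains `v`. -/
theorem condExp_update_of_mem {B : Finset V} {v : V} (hv : v ∈ B) (f : (V → S) → ℝ)
    (σ : V → S) (c : S) : condExp w B f (Function.update σ v c) = condExp w B f σ :=
  indep_condExp w B f σ _ (update_mem_cls hv σ c)

/-- The effect of a change at `v` on the conditional expectation in a block that does not
interact with `v`. -/
theorem abs_condExp_update_sub_le (hw : ∀ σ, 0 < w σ) {B : Finset V} {v : V} (hv : v ∉ B)
    {f : (V → S) → ℝ} {D : ℝ} (hf : Lip f D) (σ : V → S) (c : S)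
    (hloc : ∀ τ ∈ cls B σ, w (Function.update τ v c) * w σ = w τ * w (Function.update σ v c)) :
    |condExp w B f (Function.update σ v c) - condExp w B f σ| ≤ D := by
  -- By `hloc` the change at v multiplies all weights of the class by this same ratio. The
  -- conditional law on B is unchanged, and only f itself sees the change.
  set r := w (Function.update σ v c) / w σ with hr
  have hr0 : 0 < r := div_pos (hw _) (hw _)
  have hwr : ∀ τ ∈ cls B σ, w (Function.update τ v c) = r * w τ := by
    intro τ hτ
    have := (hw σ).ne'
    rw [hr, div_mul_eq_mul_div, eq_div_iff this, hloc τ hτ]; ring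
  have hW := sum_cls_pos hw B σ
  have h1 : condExp w B f (Function.update σ v c) =
      (∑ τ ∈ cls B σ, w τ * f (Function.update τ v c)) / ∑ τ ∈ cls B σ, w τ := by
    rw [condExp, sum_cls_update hv, sum_cls_update hv, Finset.sum_congr rfl hwr,
      Finset.sum_congr rfl fun τ hτ => by rw [hwr τ hτ, mul_assoc], ← Finset.mul_sum,
      ← Finset.mul_sum, mul_div_mul_left _ _ hr0.ne']
  rw [h1, condExp, ← sub_div, ← Finset.sum_sub_distrib, abs_div, abs_of_pos hW, div_le_iff₀ hW,
    Finset.mul_sum]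
  refine (Finset.abs_sum_le_sum_abs _ _).trans (Finset.sum_le_sum fun τ _ => ?_)
  rw [← mul_sub, abs_mul, abs_of_pos (hw τ), mul_comm]
  exact mul_le_mul_of_nonneg_right (hf τ v c) (hw τ).le

/-- In the class of every configuration, `w` is nearly uniform on the block `B`. -/
def NearlyUniform (w : (V → S) → ℝ) (B : Finset V) (δ : ℝ) : Prop :=
  ∀ σ, ∃ h, 0 < h ∧ (∀ τ ∈ cls B σ, h ≤ w τ) ∧
    ∑ τ ∈ cls B σ, w τ ≤ (1 + δ) * h * (cls B σ).card

/-- Both conditional expectations are close to the uniform averages over their classes, and those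
averages differ by at most D. The two comparison errors are each 2δ times the oscillation of f on
the block. -/
theorem abs_condExp_update_sub_le_of_nearlyUniform (hw : ∀ σ, 0 < w σ) {B : Finset V} {v : V}
    (hv : v ∉ B) {f : (V → S) → ℝ} {D δ : ℝ} (hf : Lip f D) (hδ : NearlyUniform w B δ)
    (σ : V → S) (c : S) :
    |condExp w B f (Function.update σ v c) - condExp w B f σ| ≤ D + 4 * δ * (B.card * D) := by
  have key : ∀ σ, |condExp w B f σ - (∑ τ ∈ cls B σ, f τ) / (cls B σ).card| ≤
      2 * δ * (B.card * D) := by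
    intro σ
    obtain ⟨h, h0, h1, h2⟩ := hδ σ
    have h3 := abs_weighted_sub_average_le (g := fun τ => f τ - f σ) (cls_nonempty B σ) h0 h1 h2
      (hf.osc B σ)
    rw [← condExp_sub_const hw] at h3
    have hN : ((cls B σ).card : ℝ) ≠ 0 := by exact_mod_cast (cls_nonempty B σ).card_pos.ne'
    have h4 : (∑ τ ∈ cls B σ, (f τ - f σ)) / ((cls B σ).card : ℝ) =
        (∑ τ ∈ cls B σ, f τ) / (cls B σ).card - f σ := by
      rw [Finset.sum_sub_distrib, Finset.sum_const, nsmul_eq_mul]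
      field_simp
    rw [h4] at h3
    simpa using h3
  have h5 := key (Function.update σ v c)
  have h6 := key σ
  rw [sum_cls_update hv, card_cls] at h5
  rw [card_cls] at h6
  have h7 : |(∑ τ ∈ cls B σ, f (Function.update τ v c)) / ((Fintype.card S ^ B.card : ℕ) : ℝ) -
      (∑ τ ∈ cls B σ, f τ) / ((Fintype.card S ^ B.card : ℕ) : ℝ)| ≤ D := by
    rw [← card_cls B σ]
    have hN : (0 : ℝ) < ((cls B σ).card : ℝ) := by exact_mod_cast (cls_nonempty B σ).card_pos
    rw [← sub_div, ← Finset.sum_sub_distrib, abs_div, abs_of_pos hN, div_le_iff₀ hN]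
    refine (Finset.abs_sum_le_sum_abs _ _).trans ?_
    rw [mul_comm, ← nsmul_eq_mul]
    exact Finset.sum_le_card_nsmul _ _ _ fun τ _ => hf τ v c
  rw [abs_le] at *
  constructor <;> linarith

variable {ι : Type*} [Fintype ι]

/-- The block dynamics as an operator on functions: a uniformly random block is resampled. -/
noncomputable def blockAvg (w : (V → S) → ℝ) (B : ι → Finset V) (f : (V → S) → ℝ) (σ : V → S) :
    ℝ :=
  (∑ j, condExp w (B j) f σ) / Fintype.card ι

/-- The data of a contracting block dynamics: every vertex is in at least `a` blocks, and
interacts from outside with at most `N` blocks, each of at most `m` vertices. -/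
structure GoodBlocks (w : (V → S) → ℝ) (B : ι → Finset V) (a N m : ℕ) (δ : ℝ) where
  /-- the relation of interacting with a block from outside -/
  touch : ι → V → Prop
  local_of_not_touch : ∀ j v, v ∉ B j → ¬ touch j v → ∀ σ c, ∀ τ ∈ cls (B j) σ,
    w (Function.update τ v c) * w σ = w τ * w (Function.update σ v c)
  le_card_mem : ∀ v, a ≤ (Finset.univ.filter fun j => v ∈ B j).card
  card_touch_le : ∀ v, (Finset.univ.filter fun j => touch j v).card ≤ N
  card_block_le : ∀ j, (B j).card ≤ m
  nearlyUniform : ∀ j, NearlyUniform w (B j) δ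
  nonneg : 0 ≤ δ
  small : 4 * δ * m * N ≤ a / 2

/-- Blocks containing v forget the change there, a gain of at least a·D. Blocks that v touches add
at most 4δmD each, and `small` says that together they spend at most half of that gain. -/
theorem GoodBlocks.lip [Nonempty ι] (hw : ∀ σ, 0 < w σ) {B : ι → Finset V} {a N m : ℕ} {δ : ℝ}
    (hB : GoodBlocks w B a N m δ) {f : (V → S) → ℝ} {D : ℝ} (hD : 0 ≤ D) (hf : Lip f D) :
    Lip (blockAvg w B f) ((1 - a / (2 * Fintype.card ι)) * D) := by
  intro σ v c
  have hι : (0 : ℝ) < Fintype.card ι := by exact_mod_cast Fintype.card_pos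
  have hone : ∀ j, |condExp w (B j) f (Function.update σ v c) - condExp w (B j) f σ| ≤
      D * (1 - (if v ∈ B j then 1 else 0)) +
        4 * δ * (m * D) * (if hB.touch j v then 1 else 0) := by
    intro j
    have hpos : 0 ≤ 4 * δ * (m * D) := by have := hB.nonneg; positivity
    by_cases hv : v ∈ B j
    · rw [condExp_update_of_mem hv]
      simp only [hv, if_true, sub_self, abs_zero, mul_zero, zero_add]
      split_ifs <;> simp [hpos]
    · by_cases ht : hB.touch j v
      · refine (abs_condExp_update_sub_le_of_nearlyUniform hw hv hf (hB.nearlyUniform j) σ c).trans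
          ?_
        simp only [hv, ht, if_true, if_false, sub_zero, mul_one]
        have := hB.nonneg
        have : ((B j).card : ℝ) ≤ m := by exact_mod_cast hB.card_block_le j
        gcongr
      · refine (abs_condExp_update_sub_le hw hv hf σ c
          (hB.local_of_not_touch j v hv ht σ c)).trans ?_
        simp [hv, ht]
  rw [blockAvg, blockAvg, ← sub_div, ← Finset.sum_sub_distrib, abs_div, abs_of_pos hι,
    div_le_iff₀ hι]
  refine (Finset.abs_sum_le_sum_abs _ _).trans ((Finset.sum_le_sum fun j _ => hone j).trans ?_)
  rw [Finset.sum_add_distrib, ← Finset.mul_sum, ← Finset.mul_sum, Finset.sum_sub_distrib,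
    Finset.sum_boole, Finset.sum_boole, Finset.sum_const, Finset.card_univ, nsmul_eq_mul, mul_one]
  have h1 : (a : ℝ) ≤ (Finset.univ.filter fun j => v ∈ B j).card := by
    exact_mod_cast hB.le_card_mem v
  have h2 : ((Finset.univ.filter fun j => hB.touch j v).card : ℝ) ≤ N := by
    exact_mod_cast hB.card_touch_le v
  have h3 := hB.small
  have h4 : 4 * δ * (m * D) * ((Finset.univ.filter fun j => hB.touch j v).card : ℝ) ≤
      a / 2 * D := by
    have := hB.nonneg
    calc _ ≤ 4 * δ * (m * D) * N := by gcongr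
      _ = (4 * δ * m * N) * D := by ring
      _ ≤ a / 2 * D := by gcongr
  have h5 : (1 - (a : ℝ) / (2 * Fintype.card ι)) * D * Fintype.card ι =
      D * (Fintype.card ι - a) + a / 2 * D := by
    field_simp; ring
  rw [h5]
  have h6 := mul_le_mul_of_nonneg_left (sub_le_sub_left h1 (Fintype.card ι : ℝ)) hD
  linarith

theorem GoodBlocks.rate_nonneg [Nonempty ι] [Nonempty V] {B : ι → Finset V} {a N m : ℕ} {δ : ℝ}
    (hB : GoodBlocks w B a N m δ) : (0 : ℝ) ≤ 1 - a / (2 * Fintype.card ι) := by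
  have hι : (0 : ℝ) < Fintype.card ι := by exact_mod_cast Fintype.card_pos
  have h := (hB.le_card_mem (Classical.arbitrary V)).trans (Finset.card_le_univ _)
  have h' : (a : ℝ) ≤ Fintype.card ι := by exact_mod_cast h
  rw [sub_nonneg, div_le_one (by positivity)]
  linarith

theorem GoodBlocks.lip_iterate [Nonempty ι] [Nonempty V] (hw : ∀ σ, 0 < w σ) {B : ι → Finset V}
    {a N m : ℕ} {δ : ℝ} (hB : GoodBlocks w B a N m δ) {f : (V → S) → ℝ} {D : ℝ} (hD : 0 ≤ D)
    (hf : Lip f D) (t : ℕ) :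
    Lip ((blockAvg w B)^[t] f) ((1 - a / (2 * Fintype.card ι)) ^ t * D) := by
  induction t with
  | zero => simpa using hf
  | succ t ih =>
    rw [Function.iterate_succ_apply', pow_succ', mul_assoc]
    exact hB.lip hw (mul_nonneg (pow_nonneg hB.rate_nonneg t) hD) ih

/-! ### From contraction to a spectral gap. -/

theorem sum_blockAvg_mul (w : (V → S) → ℝ) (B : ι → Finset V) (f g : (V → S) → ℝ) :
    ∑ σ, w σ * (blockAvg w B f σ * g σ) = ∑ σ, w σ * (f σ * blockAvg w B g σ) := by
  have h : ∀ f g : (V → S) → ℝ, ∑ σ, w σ * (blockAvg w B f σ * g σ) =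
      (∑ j, ∑ σ, w σ * (condExp w (B j) f σ * g σ)) / Fintype.card ι := by
    intro f g
    rw [Finset.sum_comm, Finset.sum_div]
    refine Finset.sum_congr rfl fun σ _ => ?_
    rw [blockAvg, ← Finset.mul_sum, ← Finset.sum_mul]; ring
  have h' : ∑ σ, w σ * (f σ * blockAvg w B g σ) = ∑ σ, w σ * (blockAvg w B g σ * f σ) :=
    Finset.sum_congr rfl fun σ _ => by ring
  rw [h', h, h]
  congr 1
  refine Finset.sum_congr rfl fun j _ => ?_
  rw [sum_condExp_mul]
  exact Finset.sum_congr rfl fun σ _ => by ring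

theorem blockAvg_const [Nonempty ι] (hw : ∀ σ, 0 < w σ) (B : ι → Finset V) (a : ℝ) :
    blockAvg w B (fun _ => a) = fun _ => a := by
  ext σ
  have hι : (Fintype.card ι : ℝ) ≠ 0 := by exact_mod_cast Fintype.card_ne_zero
  have : ∀ j, condExp w (B j) (fun _ => a) σ = a := fun j =>
    congrFun (condExp_eq_of_indep hw (fun _ _ _ => rfl)) σ
  simp only [blockAvg, this, Finset.sum_const, Finset.card_univ, nsmul_eq_mul]
  field_simp

theorem blockAvg_sub (B : ι → Finset V) (f g : (V → S) → ℝ) :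
    blockAvg w B (fun σ => f σ - g σ) = fun σ => blockAvg w B f σ - blockAvg w B g σ := by
  ext σ
  simp only [blockAvg, condExp, mul_sub, Finset.sum_sub_distrib, sub_div]

theorem sum_blockAvg [Nonempty ι] (hw : ∀ σ, 0 < w σ) (B : ι → Finset V) (f : (V → S) → ℝ) :
    ∑ σ, w σ * blockAvg w B f σ = ∑ σ, w σ * f σ := by
  have := sum_blockAvg_mul w B f (fun _ => 1)
  rw [blockAvg_const hw] at this
  simpa using this

theorem sum_blockAvg_iterate [Nonempty ι] (hw : ∀ σ, 0 < w σ) (B : ι → Finset V)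
    (f : (V → S) → ℝ) (t : ℕ) :
    ∑ σ, w σ * (blockAvg w B)^[t] f σ = ∑ σ, w σ * f σ := by
  induction t with
  | zero => rfl
  | succ t ih => rw [Function.iterate_succ_apply', sum_blockAvg hw, ih]

/-- A function with mean zero is bounded by its oscillation. -/
theorem abs_le_of_sum_eq_zero (hw : ∀ σ, 0 < w σ) {f : (V → S) → ℝ} {M : ℝ}
    (h0 : ∑ σ, w σ * f σ = 0) (hf : ∀ σ τ, |f τ - f σ| ≤ M) (σ : V → S) : |f σ| ≤ M := by
  have hW : 0 < ∑ τ, w τ := Finset.sum_pos (fun τ _ => hw τ) ⟨σ, Finset.mem_univ σ⟩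
  have h1 : (∑ τ, w τ) * f σ = ∑ τ, w τ * (f σ - f τ) := by
    simp only [mul_sub, Finset.sum_sub_distrib, h0, Finset.sum_mul, sub_zero]
  have h2 : |(∑ τ, w τ) * f σ| ≤ (∑ τ, w τ) * M := by
    rw [h1, Finset.sum_mul]
    refine (Finset.abs_sum_le_sum_abs _ _).trans (Finset.sum_le_sum fun τ _ => ?_)
    rw [abs_mul, abs_of_pos (hw τ)]
    exact mul_le_mul_of_nonneg_left (hf τ σ) (hw τ).le
  rw [abs_mul, abs_of_pos hW] at h2
  exact le_of_mul_le_mul_left h2 hW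

theorem weighted_cauchy (hw : ∀ σ, 0 < w σ) (f g : (V → S) → ℝ) :
    (∑ σ, w σ * (f σ * g σ)) ^ 2 ≤ (∑ σ, w σ * f σ ^ 2) * ∑ σ, w σ * g σ ^ 2 := by
  have h := Finset.sum_mul_sq_le_sq_mul_sq Finset.univ (fun σ => √(w σ) * f σ)
    (fun σ => √(w σ) * g σ)
  have e1 : ∀ σ, √(w σ) * f σ * (√(w σ) * g σ) = w σ * (f σ * g σ) := fun σ => by
    rw [show √(w σ) * f σ * (√(w σ) * g σ) = √(w σ) * √(w σ) * (f σ * g σ) by ring,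
      Real.mul_self_sqrt (hw σ).le]
  have e2 : ∀ (f : (V → S) → ℝ) σ, (√(w σ) * f σ) ^ 2 = w σ * f σ ^ 2 := fun f σ => by
    rw [mul_pow, Real.sq_sqrt (hw σ).le]
  simpa only [e1, e2] using h

/-- The spectral bound that follows from contraction in the Lipschitz seminorm. -/
theorem GoodBlocks.sum_mul_blockAvg_le [Nonempty ι] [Nonempty V] [Nonempty S]
    (hw : ∀ σ, 0 < w σ) {B : ι → Finset V} {a N m : ℕ} {δ : ℝ} (hB : GoodBlocks w B a N m δ)
    {f : (V → S) → ℝ} (h0 : ∑ σ, w σ * f σ = 0) :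
    ∑ σ, w σ * (f σ * blockAvg w B f σ) ≤
      (1 - a / (2 * Fintype.card ι)) * ∑ σ, w σ * f σ ^ 2 := by
  set ρ : ℝ := 1 - a / (2 * Fintype.card ι) with hρ
  have hρ0 : 0 ≤ ρ := hB.rate_nonneg
  set T := blockAvg w B with hT
  obtain ⟨D, hD0, hD⟩ := exists_lip f
  set b : ℕ → ℝ := fun t => ∑ σ, w σ * (T^[t] f σ) ^ 2 with hb
  have hbound : ∀ t σ, |T^[t] f σ| ≤ Fintype.card V * (ρ ^ t * D) := by
    intro t
    refine abs_le_of_sum_eq_zero hw ?_ fun σ τ => ?_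
    · rw [hT, sum_blockAvg_iterate hw, h0]
    · exact (hB.lip_iterate hw hD0 hD t).osc Finset.univ σ τ (by simp [cls_univ])
  -- A function of mean zero is bounded by its oscillation, which is at most |V| times the Lipschitz
  -- constant. The prefactor depends badly on V but does not affect the rate.
  have hdecay : ∀ t, b t ≤ ((∑ σ, w σ) * (Fintype.card V * D) ^ 2) * (ρ ^ 2) ^ t := by
    intro t
    rw [hb, Finset.sum_mul, Finset.sum_mul]
    refine Finset.sum_le_sum fun σ _ => ?_
    have h1 : (T^[t] f σ) ^ 2 ≤ (Fintype.card V * (ρ ^ t * D)) ^ 2 := by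
      rw [← sq_abs]
      exact pow_le_pow_left₀ (abs_nonneg _) (hbound t σ) 2
    calc w σ * (T^[t] f σ) ^ 2 ≤ w σ * (Fintype.card V * (ρ ^ t * D)) ^ 2 :=
          mul_le_mul_of_nonneg_left h1 (hw σ).le
      _ = _ := by rw [← pow_mul, mul_comm 2 t, pow_mul]; ring
  -- By self-adjointness ‖T^(t+1) f‖² = ⟨T^t f, T^(t+2) f⟩, and Cauchy–Schwarz applies.
  have hconv : ∀ t, b (t + 1) ^ 2 ≤ b t * b (t + 2) := by
    intro t
    have h1 : b (t + 1) = ∑ σ, w σ * (T^[t] f σ * T^[t + 2] f σ) := by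
      have := sum_blockAvg_mul w B (T^[t] f) (T^[t + 1] f)
      rw [← hT] at this
      rw [hb, Function.iterate_succ_apply' T (t + 1), ← this]
      refine Finset.sum_congr rfl fun σ _ => ?_
      rw [Function.iterate_succ_apply' T t, sq]
    rw [h1]
    exact weighted_cauchy hw _ _
  have hbnn : ∀ t, 0 ≤ b t := fun t =>
    Finset.sum_nonneg fun σ _ => mul_nonneg (hw σ).le (sq_nonneg _)
  have h1 := logConvex_decay hbnn hconv (sq_nonneg ρ) hdecay
  have h2 := weighted_cauchy hw f (T f)
  have h3 : (∑ σ, w σ * (f σ * T f σ)) ^ 2 ≤ (ρ * b 0) ^ 2 := by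
    refine h2.trans ?_
    calc b 0 * b 1 ≤ b 0 * (ρ ^ 2 * b 0) := mul_le_mul_of_nonneg_left h1 (hbnn 0)
      _ = _ := by ring
  exact abs_le_of_sq_le_sq' h3 (mul_nonneg hρ0 (hbnn 0)) |>.2

/-- The Poincaré inequality for the block dynamics. -/
theorem GoodBlocks.poincare [Nonempty ι] [Nonempty V] [Nonempty S]
    (hw : ∀ σ, 0 < w σ) {B : ι → Finset V} {a N m : ℕ} {δ : ℝ} (hB : GoodBlocks w B a N m δ)
    (ha : 0 < a) (f : (V → S) → ℝ) :
    dirichlet w Finset.univ f ≤ 2 / a * ∑ j, dirichlet w (B j) f := by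
  have hι : (0 : ℝ) < Fintype.card ι := by exact_mod_cast Fintype.card_pos
  have ha' : (0 : ℝ) < a := by exact_mod_cast ha
  set e : ℝ := condExp w Finset.univ f (fun _ => Classical.arbitrary S) with he
  have hconst : ∀ σ, condExp w Finset.univ f σ = e := fun σ => by
    rw [he, condExp, condExp, cls_univ, cls_univ]
  set g : (V → S) → ℝ := fun σ => f σ - e with hg
  have hg0 : ∑ σ, w σ * g σ = 0 := by
    have := sum_sub_condExp_mul hw f (B := Finset.univ) (g := fun _ => 1) (fun _ _ _ => rfl)
    simpa [hconst] using this
  have hdir : ∀ C, dirichlet w C g = dirichlet w C f := by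
    intro C
    refine Finset.sum_congr rfl fun σ _ => ?_
    have : condExp w C g σ = condExp w C f σ - e := (condExp_sub_const hw C f σ e).symm
    rw [this, hg]; ring
  have h1 : dirichlet w Finset.univ f = ∑ σ, w σ * g σ ^ 2 := by
    simp [dirichlet, hconst, hg]
  have h2 := hB.sum_mul_blockAvg_le hw hg0
  -- For projections, ‖g‖² - ⟨g, E g⟩ is the squared distance to the projection. The spectral bound
  -- is therefore the block Poincaré inequality, with |ι| cancelling.
  have h3 : ∑ σ, w σ * (g σ * blockAvg w B g σ) =
      ∑ σ, w σ * g σ ^ 2 - (∑ j, dirichlet w (B j) f) / Fintype.card ι := by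
    simp only [← hdir, dirichlet_eq hw]
    rw [Finset.sum_sub_distrib, Finset.sum_const, Finset.card_univ, nsmul_eq_mul, sub_div,
      mul_div_cancel_left₀ _ hι.ne', sub_sub_cancel, Finset.sum_comm, Finset.sum_div]
    refine Finset.sum_congr rfl fun σ _ => ?_
    rw [blockAvg, ← Finset.mul_sum, ← Finset.mul_sum]; ring
  rw [h3, ← h1] at h2
  have h4 : a / (2 * Fintype.card ι) * dirichlet w Finset.univ f ≤
      (∑ j, dirichlet w (B j) f) / Fintype.card ι := by linarith
  rw [div_mul_eq_mul_div, div_le_div_iff₀ (by positivity) hι] at h4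
  rw [div_mul_eq_mul_div, le_div_iff₀ ha']
  have h5 : (Fintype.card ι : ℝ) * (dirichlet w Finset.univ f * a) ≤
      Fintype.card ι * (2 * ∑ j, dirichlet w (B j) f) := by linarith
  exact le_of_mul_le_mul_left h5 hι

/-- Single-site Poincaré inequality from the block dynamics and the Poincaré inequalities of
the blocks. -/
theorem GoodBlocks.poincare_single [Nonempty ι] [Nonempty V] [Nonempty S]
    (hw : ∀ σ, 0 < w σ) {B : ι → Finset V} {a N m : ℕ} {δ : ℝ} (hB : GoodBlocks w B a N m δ)
    (ha : 0 < a) {b : ℕ} (hb : ∀ v, (Finset.univ.filter fun j => v ∈ B j).card ≤ b) {R : ℝ}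
    (hR0 : 0 ≤ R) (hR : ∀ j σ, ∀ τ ∈ cls (B j) σ, w τ ≤ R * w σ) (f : (V → S) → ℝ) :
    dirichlet w Finset.univ f ≤ 2 * R * b / a * ∑ v, dirichlet w {v} f := by
  have ha' : (0 : ℝ) < a := by exact_mod_cast ha
  refine (hB.poincare hw ha f).trans ?_
  have h1 : ∑ j, dirichlet w (B j) f ≤ R * (b * ∑ v, dirichlet w {v} f) := by
    calc ∑ j, dirichlet w (B j) f ≤ ∑ j, R * ∑ v ∈ B j, dirichlet w {v} f :=
          Finset.sum_le_sum fun j _ => dirichlet_le_mul_sum hw (B j) (hR j) f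
      _ = R * ∑ v, (Finset.univ.filter fun j => v ∈ B j).card * dirichlet w {v} f := by
          rw [← Finset.mul_sum]
          congr 1
          have : ∀ j, ∑ v ∈ B j, dirichlet w {v} f =
              ∑ v, if v ∈ B j then dirichlet w {v} f else 0 := fun j => by
            rw [← Finset.sum_filter, Finset.filter_mem_eq_inter, Finset.univ_inter]
          simp only [this]
          rw [Finset.sum_comm]
          refine Finset.sum_congr rfl fun v _ => ?_
          rw [← Finset.sum_filter, Finset.sum_const, nsmul_eq_mul]
      _ ≤ R * (b * ∑ v, dirichlet w {v} f) := by
          refine mul_le_mul_of_nonneg_left ?_ hR0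
          rw [Finset.mul_sum]
          refine Finset.sum_le_sum fun v _ => ?_
          have : ((Finset.univ.filter fun j => v ∈ B j).card : ℝ) ≤ b := by exact_mod_cast hb v
          exact mul_le_mul_of_nonneg_right this (dirichlet_nonneg hw _ _)
  calc 2 / a * ∑ j, dirichlet w (B j) f ≤ 2 / a * (R * (b * ∑ v, dirichlet w {v} f)) := by gcongr
    _ = _ := by ring

end SpinSystem

/-! ## The Potts model as a spin system -/

namespace Potts

open Classical SpinSystem

/-- The edges of `G`, as a finset. -/
noncomputable def edges {V : Type*} [Fintype V] (G : SimpleGraph V) : Finset (Sym2 V) :=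
  {e | e ∈ G.edgeSet}

/-- The edges in `F` with an end in `B`. -/
noncomputable def touching {V : Type*} (F : Finset (Sym2 V)) (B : Finset V) : Finset (Sym2 V) :=
  {e ∈ F | ∃ v ∈ B, v ∈ e}

/-- The edges in `F` with both ends in `B`. -/
noncomputable def inside {V : Type*} (F : Finset (Sym2 V)) (B : Finset V) : Finset (Sym2 V) :=
  {e ∈ F | ∀ v ∈ e, v ∈ B}

/-- The edges in `F` that have an end in `C` but none in `B \ C`. -/
noncomputable def isolating {V : Type*} (F : Finset (Sym2 V)) (B C : Finset V) :
    Finset (Sym2 V) :=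
  {e ∈ F | (∃ v ∈ C, v ∈ e) ∧ ∀ v ∈ e, v ∈ B → v ∈ C}

/-- The edges of `F` that are monochromatic in `σ`. -/
noncomputable def mono {V S : Type*} (F : Finset (Sym2 V)) (σ : V → S) : Finset (Sym2 V) :=
  {e ∈ F | (e.map σ).IsDiag}

/-- Every edge set inside the block `B`, or between `B` and the outside, has at most `κ` edges
for each colour that it determines. -/
structure Sparse {V : Type*} (F : Finset (Sym2 V)) (B : Finset V) (κ : ℝ) : Prop where
  inside_le : ∀ C ⊆ B, C.Nonempty → ((inside F C).card : ℝ) ≤ κ * (C.card - 1)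
  isolating_le : ∀ C ⊆ B, ((isolating F B C).card : ℝ) ≤ κ * C.card

/-! ### Counting colourings by their monochromatic edges. -/

section

variable {V S : Type*} [Fintype V] [Fintype S]

theorem mem_touching {F : Finset (Sym2 V)} {B : Finset V} {e : Sym2 V} :
    e ∈ touching F B ↔ e ∈ F ∧ ∃ v ∈ B, v ∈ e := by
  simp [touching]

theorem mem_inside {F : Finset (Sym2 V)} {B : Finset V} {e : Sym2 V} :
    e ∈ inside F B ↔ e ∈ F ∧ ∀ v ∈ e, v ∈ B := by
  simp [inside]

theorem mem_isolating {F : Finset (Sym2 V)} {B C : Finset V} {e : Sym2 V} :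
    e ∈ isolating F B C ↔ e ∈ F ∧ (∃ v ∈ C, v ∈ e) ∧ ∀ v ∈ e, v ∈ B → v ∈ C := by
  simp [isolating]

theorem mem_mono {F : Finset (Sym2 V)} {σ : V → S} {e : Sym2 V} :
    e ∈ mono F σ ↔ e ∈ F ∧ (e.map σ).IsDiag := by
  simp [mono]

theorem mono_subset (F : Finset (Sym2 V)) (σ : V → S) : mono F σ ⊆ F := fun _ h =>
  (mem_mono.1 h).1

theorem map_isDiag_congr {σ τ : V → S} {e : Sym2 V} (h : ∀ v ∈ e, τ v = σ v) :
    (e.map τ).IsDiag ↔ (e.map σ).IsDiag := by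
  induction e using Sym2.ind with
  | _ x y => simp [h x (by simp), h y (by simp)]

theorem mono_congr {F : Finset (Sym2 V)} {σ τ : V → S} (h : ∀ e ∈ F, ∀ v ∈ e, τ v = σ v) :
    mono F τ = mono F σ := by
  ext e
  rw [mem_mono, mem_mono]
  exact and_congr_right fun he => map_isDiag_congr (h e he)

theorem mem_edges {G : SimpleGraph V} {e : Sym2 V} : e ∈ edges G ↔ e ∈ G.edgeSet := by
  simp [edges]

theorem Sparse.mono {F F' : Finset (Sym2 V)} (h : F' ⊆ F) {B : Finset V} {κ : ℝ}
    (hF : Sparse F B κ) : Sparse F' B κ := by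
  constructor
  · intro C hC hne
    refine le_trans ?_ (hF.inside_le C hC hne)
    have : inside F' C ⊆ inside F C := fun e he =>
      mem_inside.2 ⟨h (mem_inside.1 he).1, (mem_inside.1 he).2⟩
    exact_mod_cast Finset.card_le_card this
  · intro C hC
    refine le_trans ?_ (hF.isolating_le C hC)
    have : isolating F' B C ⊆ isolating F B C := fun e he =>
      mem_isolating.2 ⟨h (mem_isolating.1 he).1, (mem_isolating.1 he).2⟩
    exact_mod_cast Finset.card_le_card this

/-- The number of configurations in a class for which all edges in `F` are monochromatic. -/
theorem exists_card_mono_le {F : Finset (Sym2 V)} {B : Finset V} {κ : ℝ} (hF : Sparse F B κ)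
    (hB : ∀ e ∈ F, ∃ v ∈ B, v ∈ e) (σ : V → S) :
    ∃ k ≤ B.card, (F.card : ℝ) ≤ κ * (B.card - k) ∧
      ((cls B σ).filter fun τ => ∀ e ∈ F, (e.map τ).IsDiag).card ≤ Fintype.card S ^ k := by
  set H : SimpleGraph V := SimpleGraph.fromEdgeSet F with hH
  set comp : V → H.ConnectedComponent := H.connectedComponentMk with hcomp
  -- A colouring that makes F monochromatic is constant on the components of (V, F). Components
  -- inside B are free and give the exponent k; every other component has its colour dictated by σ
  -- outside B.
  set I : Finset H.ConnectedComponent := {c | ∀ v, comp v = c → v ∈ B} with hI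
  have hcompF : ∀ x y, s(x, y) ∈ F → comp x = comp y := by
    intro x y hxy
    by_cases h : x = y
    · rw [h]
    · exact SimpleGraph.ConnectedComponent.sound (SimpleGraph.Adj.reachable
        ((SimpleGraph.fromEdgeSet_adj _).2 ⟨hxy, h⟩))
  have hconst : ∀ τ : V → S, (∀ e ∈ F, (e.map τ).IsDiag) → ∀ x y, comp x = comp y →
      τ x = τ y := by
    intro τ hτ x y hxy
    obtain ⟨p⟩ := SimpleGraph.ConnectedComponent.exact hxy
    induction p with
    | nil => rfl
    | cons hadj p ih =>
      rename_i u v z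
      have h1 := hτ _ ((SimpleGraph.fromEdgeSet_adj _).1 hadj).1
      have h2 : τ u = τ v := by simpa using h1
      rw [h2]
      exact ih (SimpleGraph.ConnectedComponent.sound p.reachable)
  set C : H.ConnectedComponent → Finset V := fun c => B.filter fun v => comp v = c with hC
  set C₀ : Finset V := B.filter fun v => comp v ∉ I with hC₀
  have hCne : ∀ c ∈ I, (C c).Nonempty := by
    intro c hc
    obtain ⟨v, rfl⟩ := c.exists_rep
    exact ⟨v, Finset.mem_filter.2 ⟨(Finset.mem_filter.1 hc).2 v rfl, rfl⟩⟩
  have hsum : B.card = C₀.card + ∑ c ∈ I, (C c).card := by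
    have h1 : (B.filter fun v => comp v ∈ I).card = ∑ c ∈ I, (C c).card := by
      have hmaps : ∀ v ∈ B.filter fun v => comp v ∈ I, comp v ∈ I := fun v hv =>
        (Finset.mem_filter.1 hv).2
      rw [Finset.card_eq_sum_card_fiberwise hmaps]
      refine Finset.sum_congr rfl fun c hc => ?_
      congr 1
      ext v
      simp only [hC, Finset.mem_filter]
      constructor
      · rintro ⟨⟨h, -⟩, h'⟩; exact ⟨h, h'⟩
      · rintro ⟨h, h'⟩; exact ⟨⟨h, h' ▸ hc⟩, h'⟩
    rw [← h1, add_comm, Finset.card_filter_add_card_filter_not]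
  have hk : I.card ≤ B.card := by
    have : I.card ≤ ∑ c ∈ I, (C c).card := by
      rw [Finset.card_eq_sum_ones]
      exact Finset.sum_le_sum fun c hc => (hCne c hc).card_pos
    omega
  refine ⟨I.card, hk, ?_, ?_⟩
  · have hcover : F ⊆ isolating F B C₀ ∪ I.biUnion fun c => inside F (C c) := by
      intro e he
      obtain ⟨v, hvB, hve⟩ := hB e he
      have hsame : ∀ u ∈ e, comp u = comp v := by
        intro u hu
        induction e using Sym2.ind with
        | _ x y =>
          have := hcompF x y he
          rcases Sym2.mem_iff.1 hu with rfl | rfl <;> rcases Sym2.mem_iff.1 hve with rfl | rfl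
          exacts [rfl, this, this.symm, rfl]
      by_cases hvI : comp v ∈ I
      · refine Finset.mem_union_right _ (Finset.mem_biUnion.2 ⟨comp v, hvI, ?_⟩)
        refine mem_inside.2 ⟨he, fun u hu => Finset.mem_filter.2 ⟨?_, hsame u hu⟩⟩
        exact (Finset.mem_filter.1 hvI).2 u (hsame u hu)
      · refine Finset.mem_union_left _ (mem_isolating.2 ⟨he, ⟨v, ?_, hve⟩, ?_⟩)
        · exact Finset.mem_filter.2 ⟨hvB, hvI⟩
        · intro u hu huB
          exact Finset.mem_filter.2 ⟨huB, by rwa [hsame u hu]⟩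
    have h1 : (F.card : ℝ) ≤ (isolating F B C₀).card + ∑ c ∈ I, ((inside F (C c)).card : ℝ) := by
      have := (Finset.card_le_card hcover).trans ((Finset.card_union_le _ _).trans
        (Nat.add_le_add_left Finset.card_biUnion_le _))
      exact_mod_cast this
    have h2 : ∑ c ∈ I, ((inside F (C c)).card : ℝ) ≤ ∑ c ∈ I, κ * ((C c).card - 1) :=
      Finset.sum_le_sum fun c hc => hF.inside_le _ (Finset.filter_subset _ _) (hCne c hc)
    have h3 := hF.isolating_le C₀ (Finset.filter_subset _ _)
    rw [← Finset.mul_sum, Finset.sum_sub_distrib, Finset.sum_const, nsmul_eq_mul, mul_one] at h2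
    have h4 : (B.card : ℝ) = C₀.card + ∑ c ∈ I, ((C c).card : ℝ) := by exact_mod_cast hsum
    rw [h4]
    linarith
  · have h1 : Fintype.card S ^ I.card = (Finset.univ : Finset (I → S)).card := by simp
    rw [h1]
    refine Finset.card_le_card_of_injOn (fun τ c => τ c.1.out) (by simp) ?_
    intro τ hτ τ' hτ' heq
    simp only [Finset.coe_filter, Set.mem_ofPred_eq] at hτ hτ'
    ext v
    by_cases hv : comp v ∈ I
    · have h2 : comp (comp v).out = comp v := Quot.out_eq _
      have h3 := congrFun heq ⟨comp v, hv⟩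
      simp only at h3
      rw [← hconst τ hτ.2 _ _ h2, ← hconst τ' hτ'.2 _ _ h2, h3]
    · simp only [hI, Finset.mem_filter, Finset.mem_univ, true_and, not_forall] at hv
      obtain ⟨u, huv, hu⟩ := hv
      rw [← hconst τ hτ.2 _ _ huv, ← hconst τ' hτ'.2 _ _ huv, mem_cls.1 hτ.1 u hu,
        mem_cls.1 hτ'.1 u hu]

/-- The partition function of a block with a boundary condition is close to that of the
non-interacting system. -/
theorem sum_cls_pow_mono_le {F : Finset (Sym2 V)} {B : Finset V} {κ lam K : ℝ}
    (hF : Sparse F B κ) (hlam : 1 ≤ lam) (hK : 1 ≤ K)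
    (hq : K * lam ^ κ ≤ (Fintype.card S : ℝ)) (σ : V → S) :
    ∑ τ ∈ cls B σ, lam ^ (mono (touching F B) τ).card ≤
      (1 + 2 ^ (touching F B).card / K) * (cls B σ).card := by
  set E := touching F B with hE
  set q : ℝ := (Fintype.card S : ℝ) with hqdef
  have hlam0 : 0 < lam := by linarith
  have hK0 : 0 < K := by linarith
  have hq0 : 0 < q := lt_of_lt_of_le (by positivity) hq
  have hEsp : Sparse E B κ := hF.mono (Finset.filter_subset _ _)
  have hcard : ((cls B σ).card : ℝ) = q ^ B.card := by rw [card_cls]; push_cast; rfl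
  -- Each nonempty set of monochromatic edges costs a factor K: the gain λ^|A| ≤ (λ^κ)^(|B|-k) is
  -- beaten by the q^(|B|-k) lost colourings.
  have hterm : ∀ A ∈ E.powerset, A ≠ ∅ →
      ∑ τ ∈ cls B σ with mono E τ = A, lam ^ (mono E τ).card ≤ q ^ B.card / K := by
    intro A hA hA0
    have hAE := Finset.mem_powerset.1 hA
    obtain ⟨k, hk, hAk, hcount⟩ := exists_card_mono_le (hEsp.mono hAE)
      (fun e he => (mem_touching.1 (hAE he)).2) σ
    have h1 : ∑ τ ∈ cls B σ with mono E τ = A, lam ^ (mono E τ).card ≤ lam ^ A.card * q ^ k := by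
      rw [Finset.sum_congr rfl (g := fun _ => lam ^ A.card)
        (fun τ hτ => by rw [(Finset.mem_filter.1 hτ).2]), Finset.sum_const, nsmul_eq_mul,
        mul_comm]
      refine mul_le_mul_of_nonneg_left ?_ (by positivity)
      have h2 : ((cls B σ).filter fun τ => mono E τ = A).card ≤ Fintype.card S ^ k := by
        refine le_trans (Finset.card_le_card ?_) hcount
        intro τ hτ
        obtain ⟨h3, h4⟩ := Finset.mem_filter.1 hτ
        refine Finset.mem_filter.2 ⟨h3, fun e he => ?_⟩
        rw [← h4] at he
        exact (mem_mono.1 he).2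
      rw [hqdef]; exact_mod_cast h2
    refine h1.trans ?_
    -- A nonempty A cannot leave all of B free, since |A| ≤ κ(|B| - k). This secures at least one
    -- factor of K.
    have hd : 1 ≤ B.card - k := by
      have hpos : (0 : ℝ) < A.card := by
        exact_mod_cast Finset.card_pos.2 (Finset.nonempty_iff_ne_empty.2 hA0)
      by_contra! hlt
      have : B.card = k := by omega
      rw [this, sub_self, mul_zero] at hAk
      linarith
    have h5 : lam ^ A.card ≤ (q / K) ^ (B.card - k) := by
      calc lam ^ A.card = lam ^ (A.card : ℝ) := (Real.rpow_natCast _ _).symm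
        _ ≤ lam ^ (κ * ((B.card - k : ℕ) : ℝ)) := by
            refine Real.rpow_le_rpow_of_exponent_le hlam ?_
            rw [Nat.cast_sub hk]; exact hAk
        _ = (lam ^ κ) ^ (B.card - k) := by
            rw [Real.rpow_mul hlam0.le, Real.rpow_natCast]
        _ ≤ (q / K) ^ (B.card - k) := by
            refine pow_le_pow_left₀ (by positivity) ?_ _
            rw [le_div_iff₀ hK0]; linarith
    calc lam ^ A.card * q ^ k ≤ (q / K) ^ (B.card - k) * q ^ k := by gcongr
      _ = q ^ B.card / K ^ (B.card - k) := by
          rw [div_pow, div_mul_eq_mul_div, ← pow_add, Nat.sub_add_cancel hk]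
      _ ≤ q ^ B.card / K := by
          refine div_le_div_of_nonneg_left (by positivity) hK0 ?_
          calc K = K ^ 1 := (pow_one K).symm
            _ ≤ _ := pow_le_pow_right₀ hK hd
  rw [← Finset.sum_fiberwise_of_maps_to (t := E.powerset) (g := fun τ => mono E τ)
    (fun τ _ => Finset.mem_powerset.2 (mono_subset _ _)),
    ← Finset.add_sum_erase _ _ (Finset.empty_mem_powerset E)]
  have h0 : ∑ τ ∈ cls B σ with mono E τ = ∅, lam ^ (mono E τ).card ≤ q ^ B.card := by
    rw [Finset.sum_congr rfl (g := fun _ => 1)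
        (fun τ hτ => by rw [(Finset.mem_filter.1 hτ).2]; simp), Finset.sum_const, nsmul_eq_mul,
        mul_one, ← hcard]
    exact_mod_cast Finset.card_filter_le _ _
  have h1 : ∑ A ∈ E.powerset.erase ∅, ∑ τ ∈ cls B σ with mono E τ = A, lam ^ (mono E τ).card ≤
      2 ^ E.card * (q ^ B.card / K) := by
    refine (Finset.sum_le_card_nsmul _ _ _ fun A hA =>
      hterm A (Finset.mem_of_mem_erase hA) (Finset.ne_of_mem_erase hA)).trans ?_
    rw [nsmul_eq_mul]
    refine mul_le_mul_of_nonneg_right ?_ (by positivity)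
    have : (E.powerset.erase ∅).card ≤ 2 ^ E.card := by
      rw [← Finset.card_powerset]; exact Finset.card_erase_le
    exact_mod_cast this
  rw [hcard]
  calc _ ≤ q ^ B.card + 2 ^ E.card * (q ^ B.card / K) := add_le_add h0 h1
    _ = _ := by ring

end

/-! ### Gibbs weights and the Glauber dynamics as a block dynamics. -/

section

variable {V : Type*} [Fintype V] {q : ℕ}

/-- The Gibbs weight. -/
noncomputable def weight (G : SimpleGraph V) (lam : ℝ) (q : ℕ) (σ : V → Fin q) : ℝ :=
  lam ^ monoEdges G σ

theorem monoEdges_eq_card (G : SimpleGraph V) (σ : V → Fin q) :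
    monoEdges G σ = (mono (edges G) σ).card := by
  rw [monoEdges, ← Set.ncard_coe_finset]
  congr 1
  ext e
  simp [mono, mem_edges]

/-- The monochromatic edges that do not meet `B`. -/
noncomputable def outer (G : SimpleGraph V) (B : Finset V) (σ : V → Fin q) : ℕ :=
  (mono ((edges G).filter fun e => ¬ ∃ v ∈ B, v ∈ e) σ).card

theorem monoEdges_eq_add (G : SimpleGraph V) (B : Finset V) (σ : V → Fin q) :
    monoEdges G σ = outer G B σ + (mono (touching (edges G) B) σ).card := by
  rw [monoEdges_eq_card, outer, ← Finset.card_filter_add_card_filter_not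
    (s := mono (edges G) σ) (fun e => ∃ v ∈ B, v ∈ e), add_comm]
  congr 2 <;> ext e <;> simp only [mem_mono, mem_touching, Finset.mem_filter] <;> tauto

theorem outer_congr (G : SimpleGraph V) {B : Finset V} {σ τ : V → Fin q} (h : τ ∈ cls B σ) :
    outer G B τ = outer G B σ := by
  rw [outer, outer, mono_congr]
  intro e he v hv
  exact mem_cls.1 h v fun hvB => (Finset.mem_filter.1 he).2 ⟨v, hvB, hv⟩

theorem mono_touching_update (G : SimpleGraph V) {B : Finset V} {v : V} (hv : v ∉ B)
    (h : ∀ u ∈ B, ¬ G.Adj v u) (σ : V → Fin q) (c : Fin q) :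
    mono (touching (edges G) B) (Function.update σ v c) = mono (touching (edges G) B) σ := by
  refine mono_congr fun e he u hu => ?_
  obtain ⟨he, x, hxB, hx⟩ := mem_touching.1 he
  rw [Function.update_of_ne]
  rintro rfl
  have hne : u ≠ x := by rintro rfl; exact hv hxB
  rw [(Sym2.mem_and_mem_iff hne).1 ⟨hu, hx⟩, mem_edges, SimpleGraph.mem_edgeSet] at he
  exact h x hxB he

theorem weight_pos {lam : ℝ} (hlam : 0 < lam) (G : SimpleGraph V) (σ : V → Fin q) :
    0 < weight G lam q σ := pow_pos hlam _

/-- The weight factors into edges that meet B, which do not see v, and edges away from B, which are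
the same throughout the class. -/
theorem weight_update_mul (G : SimpleGraph V) (lam : ℝ) {B : Finset V} {v : V} (hv : v ∉ B)
    (h : ∀ u ∈ B, ¬ G.Adj v u) (σ : V → Fin q) (c : Fin q) {τ : V → Fin q} (hτ : τ ∈ cls B σ) :
    weight G lam q (Function.update τ v c) * weight G lam q σ =
      weight G lam q τ * weight G lam q (Function.update σ v c) := by
  simp only [weight, ← pow_add]
  congr 1
  rw [monoEdges_eq_add G B, monoEdges_eq_add G B σ, monoEdges_eq_add G B τ,
    monoEdges_eq_add G B (Function.update σ v c), outer_congr G hτ,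
    outer_congr G (update_mem_cls_update hτ v c), mono_touching_update G hv h,
    mono_touching_update G hv h]
  ring

theorem weight_le_mul (G : SimpleGraph V) {lam : ℝ} (hlam : 1 ≤ lam) (B : Finset V)
    {σ τ : V → Fin q} (hτ : τ ∈ cls B σ) :
    weight G lam q τ ≤ lam ^ (touching (edges G) B).card * weight G lam q σ := by
  simp only [weight, ← pow_add]
  refine pow_le_pow_right₀ hlam ?_
  rw [monoEdges_eq_add G B, monoEdges_eq_add G B σ, outer_congr G hτ]
  have : (mono (touching (edges G) B) τ).card ≤ (touching (edges G) B).card :=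
    Finset.card_le_card (mono_subset _ _)
  omega

theorem nearlyUniform_weight {G : SimpleGraph V} {B : Finset V} {κ lam K : ℝ}
    (hG : Sparse (edges G) B κ) (hlam : 1 ≤ lam) (hK : 1 ≤ K)
    (hq : K * lam ^ κ ≤ q) :
    NearlyUniform (weight G lam q) B (2 ^ (touching (edges G) B).card / K) := by
  intro σ
  have hlam0 : 0 < lam := by linarith
  refine ⟨lam ^ outer G B σ, by positivity, fun τ hτ => ?_, ?_⟩
  · rw [weight]
    refine pow_le_pow_right₀ hlam ?_
    rw [monoEdges_eq_add G B, outer_congr G hτ]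
    omega
  · have h1 : ∀ τ ∈ cls B σ, weight G lam q τ =
        lam ^ outer G B σ * lam ^ (mono (touching (edges G) B) τ).card := by
      intro τ hτ
      rw [weight, monoEdges_eq_add G B, outer_congr G hτ, pow_add]
    rw [Finset.sum_congr rfl h1, ← Finset.mul_sum]
    have h2 := sum_cls_pow_mono_le (S := Fin q) hG hlam hK (by simpa using hq) σ
    calc _ ≤ lam ^ outer G B σ * _ := mul_le_mul_of_nonneg_left h2 (by positivity)
      _ = _ := by ring

theorem colourCount_eq (G : SimpleGraph V) (X : V → Fin q) (v : V) (c : Fin q) :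
    colourCount G X v c = (mono (touching (edges G) {v}) (Function.update X v c)).card := by
  rw [colourCount, ← Set.ncard_coe_finset]
  refine Set.ncard_congr (fun u _ => s(v, u)) ?_ ?_ ?_
  · rintro u ⟨hu, hc⟩
    have hne : u ≠ v := hu.ne'
    simp [mem_mono, mem_touching, mem_edges, hu, hne, hc]
  · rintro u u' ⟨hu, -⟩ _ h
    exact Sym2.congr_right.1 h
  · intro e he
    obtain ⟨htouch, hd⟩ := mem_mono.1 (Finset.mem_coe.1 he)
    obtain ⟨hedge, x, hx, hxe⟩ := mem_touching.1 htouch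
    rw [Finset.mem_singleton] at hx
    subst hx
    obtain ⟨u, rfl⟩ := hxe
    have hadj : G.Adj x u := mem_edges.1 hedge
    refine ⟨u, ⟨hadj, ?_⟩, rfl⟩
    simpa [hadj.ne'] using hd.symm

/-- Edges away from v contribute a common factor that cancels, so an update at v is the conditional
Gibbs law at v. -/
theorem localGibbs_eq (G : SimpleGraph V) {lam : ℝ} (hlam : 0 < lam) (X : V → Fin q) (v : V)
    (c : Fin q) :
    localGibbs G lam X v c = weight G lam q (Function.update X v c) /
      ∑ τ ∈ cls {v} X, weight G lam q τ := by
  have h : ∀ c, weight G lam q (Function.update X v c) =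
      lam ^ outer G {v} X * lam ^ colourCount G X v c := by
    intro c
    rw [weight, monoEdges_eq_add G {v}, outer_congr G (update_mem_cls (by simp) X c),
      colourCount_eq, pow_add]
  rw [sum_cls_singleton, localGibbs]
  simp only [h]
  rw [← Finset.mul_sum, mul_div_mul_left _ _ (pow_pos hlam _).ne']

theorem glauber_mulVec (G : SimpleGraph V) {lam : ℝ} (hlam : 0 < lam) (f : (V → Fin q) → ℝ) :
    (glauber G lam q).mulVec f = blockAvg (weight G lam q) (fun v : V => {v}) f := by
  ext X
  have h1 : (glauber G lam q).mulVec f X = ∑ v : V, (1 / (Fintype.card V : ℝ)) *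
      ∑ c : Fin q, localGibbs G lam X v c * f (Function.update X v c) := by
    simp only [Matrix.mulVec, dotProduct, glauber, Finset.sum_mul, Finset.mul_sum]
    rw [Finset.sum_comm]
    refine Finset.sum_congr rfl fun v _ => ?_
    rw [Finset.sum_comm]
    refine Finset.sum_congr rfl fun c _ => ?_
    simp [mul_assoc]
  rw [h1, blockAvg, ← Finset.mul_sum, one_div, inv_mul_eq_div]
  congr 1
  refine Finset.sum_congr rfl fun v _ => ?_
  rw [condExp, sum_cls_singleton, Finset.sum_div]
  refine Finset.sum_congr rfl fun c _ => ?_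
  rw [localGibbs_eq G hlam]; ring

theorem glauber_pow_mulVec [DecidableEq (V → Fin q)] (G : SimpleGraph V) {lam : ℝ}
    (hlam : 0 < lam) (f : (V → Fin q) → ℝ) (t : ℕ) :
    (glauber G lam q ^ t).mulVec f = (blockAvg (weight G lam q) fun v : V => {v})^[t] f := by
  induction t with
  | zero => simp
  | succ t ih =>
    rw [Function.iterate_succ_apply', pow_succ', ← Matrix.mulVec_mulVec, ih,
      glauber_mulVec G hlam]

end

end Potts

/-! ## Upper bounds for mixing times -/

theorem mixingTime_le {Ω : Type*} [Fintype Ω] [DecidableEq Ω] {P : Matrix Ω Ω ℝ} {π : Ω → ℝ}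
    {ε : ℝ} {t : ℕ} (h : ∀ x, tvDist ((P ^ t) x) π ≤ ε) : mixingTime P π ε ≤ t :=
  iSup_le fun x => iInf₂_le (f := fun (t : ℕ) (_ : t ∈ {t : ℕ | tvDist ((P ^ t) x) π ≤ ε}) =>
    (t : ℕ∞)) t (h x)

/-- The sign of φ - ψ is the extremal test function; the factor 2 undoes the normalization of total
variation. -/
theorem tvDist_le {Ω : Type*} [Fintype Ω] {φ ψ : Ω → ℝ} {ε : ℝ}
    (h : ∀ s : Ω → ℝ, (∀ x, |s x| ≤ 1) → ∑ x, φ x * s x - ∑ x, ψ x * s x ≤ 2 * ε) :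
    tvDist φ ψ ≤ ε := by
  have h1 := h (fun x => (SignType.sign (φ x - ψ x) : ℝ)) (fun x => by
    rcases lt_trichotomy (φ x - ψ x) 0 with h | h | h
    · simp [sign_neg h]
    · simp [h]
    · simp [sign_pos h])
  rw [← Finset.sum_sub_distrib] at h1
  have h2 : ∑ x, (φ x * (SignType.sign (φ x - ψ x) : ℝ) - ψ x * (SignType.sign (φ x - ψ x) : ℝ)) =
      ∑ x, |φ x - ψ x| :=
    Finset.sum_congr rfl fun x _ => by rw [← sub_mul, self_mul_sign]
  rw [h2] at h1
  rw [tvDist]; linarith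

/-- Times are integers while the estimates are real: rounding up accounts for the extra 1 in the
mixing bounds below. -/
theorem toENNReal_le_ofReal_of_ceil {τ : ℕ∞} {x y : ℝ} (hx : 0 ≤ x)
    (h : τ ≤ (⌈x⌉₊ : ℕ∞)) (hxy : x + 1 ≤ y) : (τ : ENNReal) ≤ ENNReal.ofReal y := by
  have h1 : (τ : ENNReal) ≤ ((⌈x⌉₊ : ℕ) : ENNReal) := by
    have := ENat.toENNReal_le.2 h
    simpa using this
  refine h1.trans ?_
  rw [← ENNReal.ofReal_natCast]
  exact ENNReal.ofReal_le_ofReal ((Nat.ceil_lt_add_one hx).le.trans hxy)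

namespace SpinSystem

open Classical

variable {V S : Type*} [Fintype V] [Fintype S] {w : (V → S) → ℝ} {ι : Type*} [Fintype ι]

theorem sum_dirichlet [Nonempty ι] (hw : ∀ σ, 0 < w σ) (B : ι → Finset V) (f : (V → S) → ℝ) :
    ∑ j, dirichlet w (B j) f =
      Fintype.card ι * (∑ σ, w σ * f σ ^ 2 - ∑ σ, w σ * (f σ * blockAvg w B f σ)) := by
  have hι : (Fintype.card ι : ℝ) ≠ 0 := by exact_mod_cast Fintype.card_ne_zero
  have h : ∑ σ, w σ * (f σ * blockAvg w B f σ) =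
      (∑ j, ∑ σ, w σ * (f σ * condExp w (B j) f σ)) / Fintype.card ι := by
    rw [Finset.sum_comm, Finset.sum_div]
    refine Finset.sum_congr rfl fun σ _ => ?_
    rw [blockAvg, ← Finset.mul_sum, ← Finset.mul_sum]; ring
  rw [h]
  simp only [dirichlet_eq hw]
  rw [Finset.sum_sub_distrib, Finset.sum_const, Finset.card_univ, nsmul_eq_mul, mul_sub,
    mul_div_cancel₀ _ hι]

/-- Convexity together with ‖E f‖² = ⟨f, E f⟩ for each projection. An average of projections is a
positive operator, so no laziness is needed to control negative eigenvalues. -/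
theorem sum_blockAvg_sq_le [Nonempty ι] (hw : ∀ σ, 0 < w σ) (B : ι → Finset V)
    (f : (V → S) → ℝ) :
    ∑ σ, w σ * blockAvg w B f σ ^ 2 ≤ ∑ σ, w σ * (f σ * blockAvg w B f σ) := by
  have hι : (0 : ℝ) < Fintype.card ι := by exact_mod_cast Fintype.card_pos
  have h1 : ∑ σ, w σ * blockAvg w B f σ ^ 2 ≤
      (∑ j, ∑ σ, w σ * condExp w (B j) f σ ^ 2) / Fintype.card ι := by
    rw [Finset.sum_comm, Finset.sum_div]
    refine Finset.sum_le_sum fun σ _ => ?_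
    rw [← Finset.mul_sum, mul_div_assoc]
    refine mul_le_mul_of_nonneg_left ?_ (hw σ).le
    rw [blockAvg, div_pow, div_le_div_iff₀ (by positivity) hι]
    have := sq_sum_le_card_mul_sum_sq (s := (Finset.univ : Finset ι))
      (f := fun j => condExp w (B j) f σ)
    rw [Finset.card_univ] at this
    nlinarith
  refine h1.trans (le_of_eq ?_)
  simp only [sum_condExp_sq hw]
  rw [Finset.sum_comm, Finset.sum_div]
  refine Finset.sum_congr rfl fun σ _ => ?_
  rw [blockAvg, ← Finset.mul_sum, ← Finset.mul_sum]; ring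

/-- The mean of `f`. -/
noncomputable def mean (w f : (V → S) → ℝ) : ℝ := (∑ σ, w σ * f σ) / ∑ σ, w σ

theorem condExp_univ (w f : (V → S) → ℝ) (σ : V → S) : condExp w Finset.univ f σ = mean w f := by
  simp [condExp, cls_univ, mean]

theorem sum_mul_sub_mean [Nonempty S] (hw : ∀ σ, 0 < w σ) (f : (V → S) → ℝ) :
    ∑ σ, w σ * (f σ - mean w f) = 0 := by
  have hW : 0 < ∑ σ, w σ := Finset.sum_pos (fun σ _ => hw σ) Finset.univ_nonempty
  simp only [mul_sub, Finset.sum_sub_distrib, ← Finset.sum_mul, mean]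
  field_simp
  ring

theorem blockAvg_iterate_sub_const [Nonempty ι] (hw : ∀ σ, 0 < w σ) (B : ι → Finset V)
    (f : (V → S) → ℝ) (a : ℝ) (t : ℕ) :
    (blockAvg w B)^[t] (fun σ => f σ - a) = fun σ => (blockAvg w B)^[t] f σ - a := by
  induction t with
  | zero => rfl
  | succ t ih =>
    rw [Function.iterate_succ_apply', ih, blockAvg_sub, blockAvg_const hw,
      Function.iterate_succ_apply']

/-- Exponential decay of the variance. -/
theorem sum_sq_iterate_le [Nonempty ι] (hw : ∀ σ, 0 < w σ) {B : ι → Finset V} {K : ℝ}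
    (hK : 1 ≤ K) (hP : ∀ f, dirichlet w Finset.univ f ≤ K * ∑ j, dirichlet w (B j) f)
    {f : (V → S) → ℝ} (h0 : ∑ σ, w σ * f σ = 0) (t : ℕ) :
    ∑ σ, w σ * (blockAvg w B)^[t] f σ ^ 2 ≤
      (1 - 1 / (Fintype.card ι * K)) ^ t * ∑ σ, w σ * f σ ^ 2 := by
  have hι : (1 : ℝ) ≤ Fintype.card ι := by exact_mod_cast Fintype.card_pos
  have hnn : 0 ≤ 1 - 1 / (Fintype.card ι * K) := by
    rw [sub_nonneg, div_le_one (by positivity)]; nlinarith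
  induction t with
  | zero => simp
  | succ t ih =>
    rw [Function.iterate_succ_apply', pow_succ', mul_assoc]
    set g := (blockAvg w B)^[t] f with hg
    have hg0 : ∑ σ, w σ * g σ = 0 := by rw [hg, sum_blockAvg_iterate hw, h0]
    have hvar : dirichlet w Finset.univ g = ∑ σ, w σ * g σ ^ 2 := by
      simp [dirichlet, condExp_univ, mean, hg0]
    have h1 := hP g
    rw [hvar, sum_dirichlet hw] at h1
    have h2 := sum_blockAvg_sq_le hw B g
    refine h2.trans (le_trans ?_ (mul_le_mul_of_nonneg_left ih hnn))
    have h3 : (∑ σ, w σ * g σ ^ 2) / (Fintype.card ι * K) ≤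
        ∑ σ, w σ * g σ ^ 2 - ∑ σ, w σ * (g σ * blockAvg w B g σ) := by
      rw [div_le_iff₀ (by positivity)]; linarith
    rw [sub_mul, one_div, one_mul, inv_mul_eq_div]
    linarith

end SpinSystem

/-! ### Mixing times from a Poincaré inequality or from contraction. -/

namespace Potts

open Classical SpinSystem

variable {V : Type*} [Fintype V] {q : ℕ}

theorem sum_gibbs_mul (G : SimpleGraph V) (lam : ℝ) (f : (V → Fin q) → ℝ) :
    ∑ σ, gibbs G lam q σ * f σ = mean (weight G lam q) f := by
  simp only [mean, gibbs, weight, partitionFunction, Finset.sum_div]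
  exact Finset.sum_congr rfl fun σ _ => by ring

theorem partitionFunction_eq (G : SimpleGraph V) (lam : ℝ) :
    partitionFunction G lam q = ∑ σ, weight G lam q σ := by
  simp [partitionFunction, weight]

theorem monoEdges_le (G : SimpleGraph V) (σ : V → Fin q) : monoEdges G σ ≤ (edges G).card := by
  rw [monoEdges_eq_card]; exact Finset.card_le_card (mono_subset _ _)

theorem partitionFunction_le (G : SimpleGraph V) {lam : ℝ} (hlam : 1 ≤ lam) :
    partitionFunction G lam q ≤ (q : ℝ) ^ Fintype.card V * lam ^ (edges G).card := by
  rw [partitionFunction_eq]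
  calc ∑ σ, weight G lam q σ ≤ ∑ _σ : V → Fin q, lam ^ (edges G).card :=
        Finset.sum_le_sum fun σ _ => pow_le_pow_right₀ hlam (monoEdges_le G σ)
    _ = _ := by simp

theorem one_le_partitionFunction (G : SimpleGraph V) {lam : ℝ} (hlam : 1 ≤ lam) (hq : 0 < q) :
    1 ≤ partitionFunction G lam q := by
  rw [partitionFunction_eq]
  have σ : V → Fin q := fun _ => ⟨0, hq⟩
  calc (1 : ℝ) ≤ weight G lam q σ := one_le_pow₀ hlam
    _ ≤ _ := Finset.single_le_sum (f := weight G lam q) (fun τ _ => pow_nonneg (by linarith) _)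
        (Finset.mem_univ σ)

/-- The Glauber dynamics mixes in time proportional to the constant of a single-site Poincaré
inequality. -/
theorem glauberMixingTime_le_of_poincare [Nonempty V] (hq : 0 < q) (G : SimpleGraph V) {lam K : ℝ}
    (hlam : 1 ≤ lam) (hK : 1 ≤ K)
    (hP : ∀ f, dirichlet (weight G lam q) Finset.univ f ≤
      K * ∑ v, dirichlet (weight G lam q) {v} f) {ε : ℝ} (hε : 0 < ε) (hε1 : ε ≤ 1) {y : ℝ}
    (hy : Fintype.card V * K * (Real.log (partitionFunction G lam q) + 2 * Real.log ε⁻¹) + 1 ≤ y) :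
    (glauberMixingTime G lam q ε : ENNReal) ≤ ENNReal.ofReal y := by
  have hlam0 : 0 < lam := by linarith
  have hw : ∀ σ, 0 < weight G lam q σ := weight_pos hlam0 G
  have : Nonempty (Fin q) := ⟨⟨0, hq⟩⟩
  have hn : (1 : ℝ) ≤ Fintype.card V := by exact_mod_cast Fintype.card_pos
  set Z := partitionFunction G lam q with hZ
  have hZ1 : 1 ≤ Z := one_le_partitionFunction G hlam hq
  set x := Fintype.card V * K * (Real.log Z + 2 * Real.log ε⁻¹) with hx
  have hlogε : 0 ≤ Real.log ε⁻¹ := Real.log_nonneg ((one_le_inv₀ hε).2 hε1)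
  have hx0 : 0 ≤ x := by
    have := Real.log_nonneg hZ1
    positivity
  refine toENNReal_le_ofReal_of_ceil hx0 ?_ hy
  refine mixingTime_le fun X => tvDist_le fun s hs => ?_
  set t := ⌈x⌉₊ with ht
  rw [sum_gibbs_mul]
  have h1 : ∑ Y, (glauber G lam q ^ t) X Y * s Y =
      (blockAvg (weight G lam q) fun v : V => {v})^[t] s X := by
    rw [← glauber_pow_mulVec G hlam0]; rfl
  rw [h1]
  set m := mean (weight G lam q) s with hm
  have h2 := sum_sq_iterate_le hw hK hP (sum_mul_sub_mean hw s) t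
  rw [blockAvg_iterate_sub_const hw, ← hm] at h2
  set d := (blockAvg (weight G lam q) fun v : V => {v})^[t] s X - m with hd
  -- Since λ ≥ 1, every single weight is at least 1. The pointwise error is thus bounded by the
  -- unnormalized L² error, which starts at most at Z.
  have h3 : d ^ 2 ≤ ∑ σ, weight G lam q σ *
      ((blockAvg (weight G lam q) fun v : V => {v})^[t] s σ - m) ^ 2 := by
    calc d ^ 2 = 1 * d ^ 2 := (one_mul _).symm
      _ ≤ weight G lam q X * d ^ 2 :=
          mul_le_mul_of_nonneg_right (one_le_pow₀ hlam) (sq_nonneg _)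
      _ ≤ _ := Finset.single_le_sum (f := fun σ => weight G lam q σ *
          ((blockAvg (weight G lam q) fun v : V => {v})^[t] s σ - m) ^ 2)
          (fun σ _ => mul_nonneg (hw σ).le (sq_nonneg _)) (Finset.mem_univ X)
  have h4 : ∑ σ, weight G lam q σ * (s σ - m) ^ 2 ≤ Z := by
    have h5 : ∑ σ, weight G lam q σ * (s σ - m) ^ 2 ≤ ∑ σ, weight G lam q σ * (s σ - 0) ^ 2 := by
      have := dirichlet_le hw (B := Finset.univ) s (g := fun _ => 0) (fun _ _ _ => rfl)
      simpa only [dirichlet, condExp_univ] using this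
    refine h5.trans ?_
    rw [hZ, partitionFunction_eq]
    refine Finset.sum_le_sum fun σ _ => mul_le_of_le_one_right (hw σ).le ?_
    rw [sub_zero, sq_le_one_iff_abs_le_one]
    exact hs σ
  have h6 : (1 - 1 / (Fintype.card V * K)) ^ t ≤ Z⁻¹ * ε ^ 2 := by
    have h7 : 1 - 1 / (Fintype.card V * K) ≤ Real.exp (-(1 / (Fintype.card V * K))) := by
      have := Real.add_one_le_exp (-(1 / (Fintype.card V * K)))
      linarith
    have h8 : 0 ≤ 1 - 1 / (Fintype.card V * K) := by
      rw [sub_nonneg, div_le_one (by positivity)]; nlinarith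
    refine (pow_le_pow_left₀ h8 h7 t).trans ?_
    rw [← Real.exp_nat_mul]
    have h9 : Z⁻¹ * ε ^ 2 = Real.exp (-(Real.log Z + 2 * Real.log ε⁻¹)) := by
      rw [neg_add, Real.exp_add, Real.exp_neg, Real.exp_log (by linarith), Real.log_inv,
        show -(2 * -Real.log ε) = Real.log ε + Real.log ε by ring, Real.exp_add,
        Real.exp_log hε, sq]
    rw [h9, Real.exp_le_exp, mul_neg, neg_le_neg_iff, mul_one_div, le_div_iff₀ (by positivity)]
    have := Nat.le_ceil x
    rw [← ht, hx] at this
    linarith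
  have h7 : d ^ 2 ≤ ε ^ 2 := by
    refine h3.trans (h2.trans ?_)
    calc _ ≤ (Z⁻¹ * ε ^ 2) * Z := by
          refine mul_le_mul h6 h4 ?_ (by positivity)
          exact Finset.sum_nonneg fun σ _ => mul_nonneg (hw σ).le (sq_nonneg _)
      _ = ε ^ 2 := by field_simp
  have := (abs_le_of_sq_le_sq' h7 hε.le).2
  linarith

/-- The Glauber dynamics mixes in time `O(n log n)` when the single-site dynamics contracts. -/
theorem glauberMixingTime_le_of_contraction [Nonempty V] (hq : 0 < q) (G : SimpleGraph V)
    {lam : ℝ} (hlam : 1 ≤ lam) {N : ℕ} {δ : ℝ}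
    (hB : GoodBlocks (weight G lam q) (fun v : V => ({v} : Finset V)) 1 N 1 δ) {ε : ℝ}
    (hε : 0 < ε) (hε1 : ε ≤ 1) {y : ℝ}
    (hy : 2 * Fintype.card V * (Real.log (Fintype.card V) + Real.log ε⁻¹) + 1 ≤ y) :
    (glauberMixingTime G lam q ε : ENNReal) ≤ ENNReal.ofReal y := by
  have hlam0 : 0 < lam := by linarith
  have hw : ∀ σ, 0 < weight G lam q σ := weight_pos hlam0 G
  have : Nonempty (Fin q) := ⟨⟨0, hq⟩⟩
  set n : ℝ := (Fintype.card V : ℝ) with hndef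
  have hn : (1 : ℝ) ≤ n := by rw [hndef]; exact_mod_cast Fintype.card_pos
  set x := 2 * n * (Real.log n + Real.log ε⁻¹) with hx
  have hlogε : 0 ≤ Real.log ε⁻¹ := Real.log_nonneg ((one_le_inv₀ hε).2 hε1)
  have hx0 : 0 ≤ x := by
    have := Real.log_nonneg hn
    positivity
  refine toENNReal_le_ofReal_of_ceil hx0 ?_ hy
  refine mixingTime_le fun X => tvDist_le fun s hs => ?_
  set t := ⌈x⌉₊ with ht
  rw [sum_gibbs_mul]
  have h1 : ∑ Y, (glauber G lam q ^ t) X Y * s Y =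
      (blockAvg (weight G lam q) fun v : V => {v})^[t] s X := by
    rw [← glauber_pow_mulVec G hlam0]; rfl
  rw [h1]
  -- Contraction from Lipschitz constant 2 gives a pointwise error of at most 2n(1 - 1/(2n))^t.
  -- Neither Z nor q enters.
  have hlip : Lip s 2 := fun σ v c => by
    have h2 := hs σ
    have h3 := hs (Function.update σ v c)
    rw [abs_le] at *
    constructor <;> linarith
  have h2 := hB.lip_iterate hw (by norm_num) hlip t
  set ρ : ℝ := (1 - (1 : ℕ) / (2 * Fintype.card V)) ^ t with hρ
  have h3 := abs_le_of_sum_eq_zero hw (M := n * (ρ * 2))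
    (f := fun σ => (blockAvg (weight G lam q) fun v : V => {v})^[t] s σ -
      mean (weight G lam q) s) (by
      have hm := sum_mul_sub_mean hw s
      rw [← sum_blockAvg_iterate hw (fun v : V => {v}) _ t, blockAvg_iterate_sub_const hw] at hm
      exact hm)
    (fun σ τ => by
      rw [sub_sub_sub_cancel_right]
      have := h2.osc Finset.univ σ τ (by simp [cls_univ])
      rwa [Finset.card_univ] at this) X
  have h6 : ρ ≤ n⁻¹ * ε := by
    have h7 : 1 - (1 : ℕ) / (2 * n) ≤ Real.exp (-(1 / (2 * n))) := by
      have := Real.add_one_le_exp (-(1 / (2 * n)))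
      push_cast
      linarith
    refine (pow_le_pow_left₀ hB.rate_nonneg h7 t).trans ?_
    rw [← Real.exp_nat_mul]
    have h9 : n⁻¹ * ε = Real.exp (-(Real.log n + Real.log ε⁻¹)) := by
      rw [neg_add, Real.exp_add, Real.exp_neg, Real.exp_log (by linarith), Real.log_inv, neg_neg,
        Real.exp_log hε]
    rw [h9, Real.exp_le_exp, mul_neg, neg_le_neg_iff, mul_one_div, le_div_iff₀ (by positivity)]
    have := Nat.le_ceil x
    rw [← ht, hx] at this
    linarith
  have h7 : n * (ρ * 2) ≤ 2 * ε := by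
    calc n * (ρ * 2) ≤ n * ((n⁻¹ * ε) * 2) := by gcongr
      _ = 2 * ε := by field_simp
  exact (le_abs_self _).trans (h3.trans h7)

/-- The Glauber dynamics on a graph whose number of edges is bounded. -/
theorem poincare_of_card_edges (hq : 0 < q) (G : SimpleGraph V) {lam : ℝ} (hlam : 1 ≤ lam)
    (f : (V → Fin q) → ℝ) :
    dirichlet (weight G lam q) Finset.univ f ≤
      lam ^ (edges G).card * ∑ v, dirichlet (weight G lam q) {v} f := by
  have : Nonempty (Fin q) := ⟨⟨0, hq⟩⟩
  have hw : ∀ σ, 0 < weight G lam q σ := weight_pos (by linarith) G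
  refine dirichlet_le_mul_sum hw Finset.univ (fun σ τ hτ => ?_) f
  refine (weight_le_mul G hlam Finset.univ hτ).trans ?_
  refine mul_le_mul_of_nonneg_right (pow_le_pow_right₀ hlam ?_) (hw σ).le
  exact Finset.card_le_card (Finset.filter_subset _ _)

/-- Blocks with few edges give a contracting block dynamics. -/
noncomputable def goodBlocks {G : SimpleGraph V} {ι : Type*} [Fintype ι] {B : ι → Finset V}
    {κ lam K : ℝ} {a b m M : ℕ} (hlam : 1 ≤ lam) (hK : 1 ≤ K) (hq : K * lam ^ κ ≤ q)
    (hsparse : ∀ j, Sparse (edges G) (B j) κ) (hM : ∀ j, (touching (edges G) (B j)).card ≤ M)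
    (hm : ∀ j, (B j).card ≤ m)
    (ha : ∀ v, a ≤ (Finset.univ.filter fun j => v ∈ B j).card)
    (hb : ∀ v, (Finset.univ.filter fun j => v ∈ B j).card ≤ b)
    (hdeg : ∀ v, (Finset.univ.filter fun u => G.Adj v u).card ≤ 4)
    (hsmall : 4 * (2 ^ M / K) * m * ((4 * b : ℕ) : ℝ) ≤ a / 2) :
    GoodBlocks (weight G lam q) B a (4 * b) m (2 ^ M / K) where
  touch j v := ∃ u ∈ B j, G.Adj v u
  local_of_not_touch j v hv ht σ c τ hτ :=
    weight_update_mul G lam hv (fun u hu hadj => ht ⟨u, hu, hadj⟩) σ c hτ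
  le_card_mem := ha
  card_touch_le v := by
    refine le_trans (Finset.card_le_card (t := (Finset.univ.filter fun u => G.Adj v u).biUnion
      fun u => Finset.univ.filter fun j => u ∈ B j) ?_) ((Finset.card_biUnion_le_card_mul _ _ b
      fun u _ => hb u).trans (Nat.mul_le_mul_right b (hdeg v)))
    intro j hj
    obtain ⟨u, hu, hadj⟩ : ∃ u ∈ B j, G.Adj v u := by simpa using hj
    exact Finset.mem_biUnion.2 ⟨u, by simpa using hadj, by simpa using hu⟩
  card_block_le := hm
  nearlyUniform j σ := by
    obtain ⟨h, h0, h1, h2⟩ := nearlyUniform_weight (hsparse j) hlam hK hq σ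
    refine ⟨h, h0, h1, h2.trans ?_⟩
    have h3 : (2 : ℝ) ^ (touching (edges G) (B j)).card ≤ 2 ^ M :=
      pow_le_pow_right₀ (by norm_num) (hM j)
    gcongr
  nonneg := by positivity
  small := hsmall

/-- The single-site Poincaré inequality from blocks with few edges. -/
theorem poincare_of_blocks {G : SimpleGraph V} [Nonempty V] {ι : Type*} [Fintype ι] [Nonempty ι]
    {B : ι → Finset V} {κ lam K : ℝ} {a b m M : ℕ} (hq0 : 0 < q) (hlam : 1 ≤ lam) (hK : 1 ≤ K)
    (hq : K * lam ^ κ ≤ q)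
    (hsparse : ∀ j, Sparse (edges G) (B j) κ) (hM : ∀ j, (touching (edges G) (B j)).card ≤ M)
    (hm : ∀ j, (B j).card ≤ m)
    (ha0 : 0 < a) (ha : ∀ v, a ≤ (Finset.univ.filter fun j => v ∈ B j).card)
    (hb : ∀ v, (Finset.univ.filter fun j => v ∈ B j).card ≤ b)
    (hdeg : ∀ v, (Finset.univ.filter fun u => G.Adj v u).card ≤ 4)
    (hsmall : 4 * (2 ^ M / K) * m * ((4 * b : ℕ) : ℝ) ≤ a / 2) (f : (V → Fin q) → ℝ) :
    dirichlet (weight G lam q) Finset.univ f ≤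
      2 * lam ^ M * b / a * ∑ v, dirichlet (weight G lam q) {v} f := by
  have : Nonempty (Fin q) := ⟨⟨0, hq0⟩⟩
  have hw : ∀ σ, 0 < weight G lam q σ := weight_pos (by linarith) G
  refine (goodBlocks hlam hK hq hsparse hM hm ha hb hdeg hsmall).poincare_single hw ha0 hb
    (by positivity) (fun j σ τ hτ => ?_) f
  refine (weight_le_mul G hlam (B j) hτ).trans ?_
  exact mul_le_mul_of_nonneg_right (pow_le_pow_right₀ hlam (hM j)) (hw σ).le

end Potts

/-! ## Rapid mixing for connected graphs of maximum degree four -/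

namespace Potts

open Classical SpinSystem

section

variable {V : Type*} [Fintype V] (G : SimpleGraph V)

/-- The number of neighbours of `v`. -/
noncomputable def deg (v : V) : ℕ := (Finset.univ.filter fun u => G.Adj v u).card

variable {G}

theorem card_filter_mem_edges (v : V) : ((edges G).filter fun e => v ∈ e).card = deg G v := by
  symm
  refine Finset.card_bij (fun u _ => s(v, u)) ?_ ?_ ?_
  · intro u hu
    simpa [mem_edges] using hu
  · intro u _ u' _ h
    exact Sym2.congr_right.1 h
  · intro e he
    obtain ⟨h1, u, rfl⟩ := Finset.mem_filter.1 he
    exact ⟨u, by simpa [mem_edges] using h1, rfl⟩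

/-- Handshake: an edge meeting C is counted once, and a second time if both ends are in C. -/
theorem sum_deg (G : SimpleGraph V) (C : Finset V) :
    ∑ v ∈ C, deg G v = (touching (edges G) C).card + (inside (edges G) C).card := by
  have h1 : ∑ v ∈ C, deg G v = ∑ e ∈ edges G, (C.filter fun v => v ∈ e).card := by
    simp only [← card_filter_mem_edges, Finset.card_filter]
    exact Finset.sum_comm
  have h2 : (touching (edges G) C).card = ∑ e ∈ edges G, if ∃ v ∈ C, v ∈ e then 1 else 0 := by
    rw [← Finset.card_filter]
    congr 1
  have h3 : (inside (edges G) C).card = ∑ e ∈ edges G, if ∀ v ∈ e, v ∈ C then 1 else 0 := by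
    rw [← Finset.card_filter]
    congr 1; ext e; simp [mem_inside]
  rw [h1, h2, h3, ← Finset.sum_add_distrib]
  refine Finset.sum_congr rfl fun e he => ?_
  induction e using Sym2.ind with
  | _ x y =>
    have hxy : x ≠ y := ((SimpleGraph.mem_edgeSet _).1 (mem_edges.1 he)).ne
    have h4 : (C.filter fun v => v ∈ s(x, y)) =
        (if x ∈ C then {x} else ∅) ∪ (if y ∈ C then {y} else ∅) := by
      ext v
      simp only [Finset.mem_filter, Sym2.mem_iff, Finset.mem_union]
      split_ifs <;> simp <;> grind
    rw [h4]
    by_cases hx : x ∈ C <;> by_cases hy : y ∈ C <;> simp [hx, hy, hxy] <;> grind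

theorem card_touching_add_inside_le (hdeg : ∀ v, deg G v ≤ 4) (C : Finset V) :
    (touching (edges G) C).card + (inside (edges G) C).card ≤ 4 * C.card := by
  rw [← sum_deg, mul_comm]
  exact Finset.sum_le_card_nsmul _ _ _ fun v _ => hdeg v

theorem inside_subset_touching (C : Finset V) : inside (edges G) C ⊆ touching (edges G) C := by
  intro e he
  rw [mem_inside] at he
  refine mem_touching.2 ⟨he.1, ?_⟩
  induction e using Sym2.ind with
  | _ x y => exact ⟨x, he.2 x (by simp), by simp⟩

/-- The degree bound gives at most 2|C| inner edges, which is enough from |C| = 3 on; a single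
vertex or a pair spans at most 0 or 1 edges. -/
theorem card_inside_le_three_mul (hdeg : ∀ v, deg G v ≤ 4) {C : Finset V} (hC : C.Nonempty) :
    (inside (edges G) C).card + 3 ≤ 3 * C.card := by
  have h1 := card_touching_add_inside_le hdeg C
  have h2 := Finset.card_le_card (inside_subset_touching (G := G) C)
  have hpos := hC.card_pos
  have hadj : ∀ x y, s(x, y) ∈ inside (edges G) C → G.Adj x y ∧ x ∈ C ∧ y ∈ C := by
    intro x y h
    rw [mem_inside, mem_edges] at h
    exact ⟨h.1, h.2 x (by simp), h.2 y (by simp)⟩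
  rcases (by omega : C.card = 1 ∨ C.card = 2 ∨ 3 ≤ C.card) with h | h | h
  · obtain ⟨a, rfl⟩ := Finset.card_eq_one.1 h
    have : inside (edges G) {a} = ∅ := by
      refine Finset.eq_empty_of_forall_notMem fun e he => ?_
      induction e using Sym2.ind with
      | _ x y =>
        obtain ⟨hxy, hx, hy⟩ := hadj x y he
        rw [Finset.mem_singleton] at hx hy
        exact hxy.ne (hx.trans hy.symm)
    rw [this, h]; simp
  · obtain ⟨a, b, hab, rfl⟩ := Finset.card_eq_two.1 h
    have : inside (edges G) {a, b} ⊆ {s(a, b)} := by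
      intro e he
      induction e using Sym2.ind with
      | _ x y =>
        obtain ⟨hxy, hx, hy⟩ := hadj x y he
        have := hxy.ne
        simp only [Finset.mem_insert, Finset.mem_singleton] at hx hy ⊢
        rw [Sym2.eq_iff]
        grind
    have := Finset.card_le_card this
    rw [h]; simp at this; omega
  · omega

/-- There is an edge from every proper part of `B` to the rest of `B`. -/
def Linked (G : SimpleGraph V) (B : Finset V) : Prop :=
  ∀ C ⊆ B, C.Nonempty → C ≠ B → ∃ u ∈ C, ∃ y ∈ B, y ∉ C ∧ G.Adj u y

theorem exists_crossing (hG : G.Connected) {B : Finset V} (hB : B.Nonempty)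
    (hB' : B ≠ Finset.univ) : ∃ u ∈ B, ∃ y, y ∉ B ∧ G.Adj u y := by
  obtain ⟨u, hu⟩ := hB
  obtain ⟨y, hy⟩ : ∃ y, y ∉ B := by
    by_contra! h
    exact hB' (Finset.eq_univ_iff_forall.2 h)
  obtain ⟨p⟩ := hG.preconnected u y
  obtain ⟨d, -, h1, h2⟩ := p.exists_boundary_dart (B : Set V) (by simpa using hu) (by simpa using hy)
  exact ⟨d.fst, by simpa using h1, d.snd, by simpa using h2, d.adj⟩

/-- Grow the block by one adjacent vertex at a time; connectedness supplies an edge leaving any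
proper vertex set. -/
theorem exists_linked (hG : G.Connected) (v : V) {r : ℕ} (hr : 1 ≤ r) (hrn : r ≤ Fintype.card V) :
    ∃ B : Finset V, v ∈ B ∧ B.card = r ∧ Linked G B := by
  induction r, hr using Nat.le_induction with
  | base =>
    refine ⟨{v}, by simp, by simp, fun C hC hne hC' => ?_⟩
    exact absurd (Finset.Nonempty.subset_singleton_iff hne |>.1 hC) hC'
  | succ r hr ih =>
    obtain ⟨B, hv, hcard, hB⟩ := ih (by omega)
    have hBne : B ≠ Finset.univ := by
      rintro rfl
      rw [Finset.card_univ] at hcard; omega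
    obtain ⟨b, hb, y, hy, hby⟩ := exists_crossing hG ⟨v, hv⟩ hBne
    refine ⟨insert y B, by simp [hv], by rw [Finset.card_insert_of_notMem hy, hcard], ?_⟩
    intro C hC hne hC'
    by_cases h1 : (C ∩ B).Nonempty
    · by_cases h2 : C ∩ B = B
      · have hBC : B ⊆ C := by rw [← h2]; exact Finset.inter_subset_left
        have hyC : y ∉ C := fun hyC => hC' (Finset.Subset.antisymm hC
          (Finset.insert_subset hyC hBC))
        exact ⟨b, hBC hb, y, by simp, hyC, hby⟩
      · obtain ⟨u, hu, z, hz, hzC, huz⟩ := hB (C ∩ B) Finset.inter_subset_right h1 h2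
        exact ⟨u, Finset.mem_of_mem_inter_left hu, z, by simp [hz],
          fun h => hzC (Finset.mem_inter.2 ⟨h, hz⟩), huz⟩
    · have hCB : ∀ z ∈ C, z ∉ B := fun z hz hzB => h1 ⟨z, Finset.mem_inter.2 ⟨hz, hzB⟩⟩
      obtain ⟨z, hz⟩ := hne
      have hzy : z = y := by
        rcases Finset.mem_insert.1 (hC hz) with h | h
        · exact h
        · exact absurd h (hCB z hz)
      subst hzy
      exact ⟨z, hz, b, by simp [hb], fun h => hCB b h hb, hby.symm⟩

/-- The vertices at distance at most `k` from `v`. -/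
noncomputable def ball (G : SimpleGraph V) (v : V) : ℕ → Finset V
  | 0 => {v}
  | k + 1 => ball G v k ∪ (ball G v k).biUnion fun u => Finset.univ.filter fun y => G.Adj u y

theorem card_ball_le (hdeg : ∀ v, deg G v ≤ 4) (v : V) (k : ℕ) : (ball G v k).card ≤ 5 ^ k := by
  induction k with
  | zero => simp [ball]
  | succ k ih =>
    have h1 := Finset.card_biUnion_le_card_mul (ball G v k)
      (fun u => Finset.univ.filter fun y => G.Adj u y) 4 fun u _ => hdeg u
    have h2 := Finset.card_union_le (ball G v k)
      ((ball G v k).biUnion fun u => Finset.univ.filter fun y => G.Adj u y)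
    rw [ball, pow_succ]
    omega

/-- Each enlargement of the ball captures a new vertex of B until none is left. This bounds the
number of blocks that contain a given vertex. -/
theorem Linked.subset_ball {B : Finset V} (hB : Linked G B) {v : V} (hv : v ∈ B) :
    B ⊆ ball G v B.card := by
  have h : ∀ k, k + 1 ≤ (B ∩ ball G v k).card ∨ B ⊆ ball G v k := by
    intro k
    induction k with
    | zero =>
      left
      exact Finset.card_pos.2 ⟨v, by simp [ball, hv]⟩
    | succ k ih =>
      have hmono : ball G v k ⊆ ball G v (k + 1) := Finset.subset_union_left
      rcases ih with ih | ih
      · by_cases hsub : B ∩ ball G v k = B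
        · right
          exact (Finset.inter_eq_left.1 hsub).trans hmono
        · left
          have hne : (B ∩ ball G v k).Nonempty := Finset.card_pos.1 (by omega)
          obtain ⟨u, hu, y, hy, hyC, huy⟩ := hB _ Finset.inter_subset_left hne hsub
          have h1 : insert y (B ∩ ball G v k) ⊆ B ∩ ball G v (k + 1) := by
            refine Finset.insert_subset (Finset.mem_inter.2 ⟨hy, ?_⟩)
              (Finset.inter_subset_inter_left hmono)
            refine Finset.mem_union_right _ (Finset.mem_biUnion.2
              ⟨u, (Finset.mem_inter.1 hu).2, by simpa using huy⟩)
          have h2 := Finset.card_le_card h1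
          rw [Finset.card_insert_of_notMem hyC] at h2
          omega
      · right; exact ih.trans hmono
  rcases h B.card with h | h
  · have := Finset.card_le_card (Finset.inter_subset_left (s₁ := B) (s₂ := ball G v B.card))
    omega
  · exact h

/-- Peel off a vertex u of C with a neighbour y in B \ C: the edge uy meets C but not C \ {u}, so
each vertex removed loses at least one edge. -/
theorem Linked.card_le {B : Finset V} (hB : Linked G B) (C : Finset V) (hC : C ⊆ B)
    (hCB : C ≠ B) : C.card ≤ (touching (inside (edges G) B) C).card := by
  induction C using Finset.strongInduction with
  | _ C ih =>
    rcases C.eq_empty_or_nonempty with rfl | hne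
    · simp
    · obtain ⟨u, hu, y, hy, hyC, huy⟩ := hB C hC hne hCB
      have h1 := ih (C.erase u) (Finset.erase_ssubset hu) ((Finset.erase_subset _ _).trans hC)
        (fun h => hyC (Finset.mem_of_mem_erase (h ▸ hy)))
      have h2 : touching (inside (edges G) B) (C.erase u) ⊂ touching (inside (edges G) B) C := by
        refine Finset.ssubset_iff_subset_ne.2 ⟨?_, ?_⟩
        · intro e he
          obtain ⟨he1, v, hv, hve⟩ := mem_touching.1 he
          exact mem_touching.2 ⟨he1, v, Finset.mem_of_mem_erase hv, hve⟩
        · intro heq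
          have h3 : s(u, y) ∈ touching (inside (edges G) B) C := by
            refine mem_touching.2 ⟨mem_inside.2 ⟨mem_edges.2 huy, ?_⟩, u, hu, by simp⟩
            intro v hv
            rcases Sym2.mem_iff.1 hv with rfl | rfl
            · exact hC hu
            · exact hy
          rw [← heq] at h3
          obtain ⟨-, v, hv, hve⟩ := mem_touching.1 h3
          rcases Sym2.mem_iff.1 hve with rfl | rfl
          · simp at hv
          · exact hyC (Finset.mem_of_mem_erase hv)
      have h4 := Finset.card_lt_card h2
      rw [Finset.card_erase_of_mem hu] at h1
      omega

/-- Inclusion–exclusion: edges avoiding B \ C and edges within B are both among those meeting C, and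
an edge of both kinds lies within C. Edges inside B are therefore saved from the budget 4|C|. -/
theorem card_isolating_add_le (B C : Finset V) :
    (isolating (edges G) B C).card + (touching (inside (edges G) B) C).card ≤
      (touching (edges G) C).card + (inside (edges G) C).card := by
  rw [← Finset.card_union_add_card_inter]
  refine add_le_add (Finset.card_le_card ?_) (Finset.card_le_card ?_)
  · intro e he
    rcases Finset.mem_union.1 he with h | h
    · exact mem_touching.2 ⟨(mem_isolating.1 h).1, (mem_isolating.1 h).2.1⟩
    · obtain ⟨h1, h2⟩ := mem_touching.1 h
      exact mem_touching.2 ⟨(mem_inside.1 h1).1, h2⟩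
  · intro e he
    obtain ⟨h1, h2⟩ := Finset.mem_inter.1 he
    obtain ⟨h3, -, h4⟩ := mem_isolating.1 h1
    refine mem_inside.2 ⟨h3, fun v hv => h4 v hv ?_⟩
    exact (mem_inside.1 (mem_touching.1 h2).1).2 v hv

theorem Linked.sparse (hdeg : ∀ v, deg G v ≤ 4) {B : Finset V} (hB : Linked G B)
    (hne : B.Nonempty) : Sparse (edges G) B (3 + 1 / B.card) := by
  have hpos : (0 : ℝ) < B.card := by exact_mod_cast hne.card_pos
  constructor
  · intro C _ hCne
    have h1 : ((inside (edges G) C).card : ℝ) + 3 ≤ 3 * C.card := by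
      exact_mod_cast card_inside_le_three_mul hdeg hCne
    have h2 : (1 : ℝ) ≤ C.card := by exact_mod_cast hCne.card_pos
    have h3 : 0 ≤ 1 / (B.card : ℝ) := by positivity
    nlinarith
  · intro C hC
    have h1 := card_isolating_add_le (G := G) B C
    have h2 := card_touching_add_inside_le hdeg C
    by_cases hCB : C = B
    · obtain ⟨u, hu⟩ := hne
      have h3 := hB.card_le (B.erase u) (Finset.erase_subset _ _)
        (fun h => by rw [Finset.erase_eq_self] at h; exact h hu)
      have h4 : touching (inside (edges G) B) (B.erase u) ⊆ touching (inside (edges G) B) C := by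
        intro e he
        obtain ⟨he1, v, hv, hve⟩ := mem_touching.1 he
        exact mem_touching.2 ⟨he1, v, hCB ▸ Finset.mem_of_mem_erase hv, hve⟩
      have h5 := Finset.card_le_card h4
      rw [Finset.card_erase_of_mem hu] at h3
      -- For C = B a spanning tree accounts for only |B| - 1 saved edges. The missing one is the
      -- 1/|B| in the exponent.
      have h6 : (isolating (edges G) B C).card ≤ 3 * B.card + 1 := by
        have : 1 ≤ B.card := Finset.card_pos.2 ⟨u, hu⟩
        subst hCB
        omega
      have h7 : ((isolating (edges G) B C).card : ℝ) ≤ 3 * B.card + 1 := by exact_mod_cast h6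
      rw [hCB] at h7 ⊢
      refine h7.trans (le_of_eq ?_)
      field_simp
    · have h3 := hB.card_le C hC hCB
      have h6 : (isolating (edges G) B C).card ≤ 3 * C.card := by omega
      have h7 : ((isolating (edges G) B C).card : ℝ) ≤ 3 * C.card := by exact_mod_cast h6
      have h8 : 0 ≤ 1 / (B.card : ℝ) * C.card := by positivity
      linarith

theorem card_edges_le (hdeg : ∀ v, deg G v ≤ 4) : (edges G).card ≤ 4 * Fintype.card V := by
  have h1 := card_touching_add_inside_le hdeg (Finset.univ : Finset V)
  have h2 : edges G ⊆ touching (edges G) Finset.univ := by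
    intro e he
    refine mem_touching.2 ⟨he, ?_⟩
    induction e using Sym2.ind with
    | _ x y => exact ⟨x, by simp, by simp⟩
  have h3 := Finset.card_le_card h2
  rw [Finset.card_univ] at h1
  omega

theorem poincare_connected {q : ℕ} (hq0 : 0 < q) (hG : G.Connected) (hdeg : ∀ v, deg G v ≤ 4)
    {lam : ℝ} (hlam : 1 ≤ lam) {r : ℕ} (hr : 1 ≤ r)
    (hq : 32 * r * 5 ^ r * 2 ^ (4 * r) * lam ^ (3 + 1 / (r : ℝ)) ≤ q) (f : (V → Fin q) → ℝ) :
    dirichlet (weight G lam q) Finset.univ f ≤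
      2 * lam ^ (4 * r) * 5 ^ r * ∑ v, dirichlet (weight G lam q) {v} f := by
  have hlam0 : 0 < lam := by linarith
  have hw : ∀ σ, 0 < weight G lam q σ := weight_pos hlam0 G
  have hnonempty : Nonempty V := hG.nonempty
  -- Graphs too small for a block of r vertices have boundedly many edges, and direct comparison
  -- with the product measure suffices.
  by_cases hn : Fintype.card V ≤ r
  · refine (poincare_of_card_edges hq0 G hlam f).trans ?_
    refine mul_le_mul_of_nonneg_right ?_
      (Finset.sum_nonneg fun v _ => dirichlet_nonneg hw {v} f)
    have h1 : lam ^ (edges G).card ≤ lam ^ (4 * r) :=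
      pow_le_pow_right₀ hlam ((card_edges_le hdeg).trans (by omega))
    have h2 : (1 : ℝ) ≤ 5 ^ r := one_le_pow₀ (by norm_num)
    have h3 : 0 < lam ^ (4 * r) := by positivity
    nlinarith
  · choose B hvB hcard hB using fun v => exists_linked hG v hr (by omega : r ≤ Fintype.card V)
    have hK : (1 : ℝ) ≤ 32 * r * 5 ^ r * 2 ^ (4 * r) := by
      have h1 : (1 : ℝ) ≤ r := by exact_mod_cast hr
      have h2 : (1 : ℝ) ≤ 5 ^ r := one_le_pow₀ (by norm_num)
      have h3 : (1 : ℝ) ≤ 2 ^ (4 * r) := one_le_pow₀ (by norm_num)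
      calc (1 : ℝ) = 1 * 1 * 1 * 1 := by norm_num
        _ ≤ 32 * r * 5 ^ r * 2 ^ (4 * r) := by gcongr; norm_num
    -- One block per vertex j, containing j. The constant 32·r·5^r·2^(4r) makes the smallness
    -- condition 4(2^M/K)·m·4b ≤ a/2 an equality.
    have h := poincare_of_blocks (G := G) (B := B) (κ := 3 + 1 / (r : ℝ)) (a := 1) (b := 5 ^ r)
      (m := r) (M := 4 * r) hq0 hlam hK hq
      (fun j => by
        have := (hB j).sparse hdeg ⟨j, hvB j⟩
        rwa [hcard j] at this)
      (fun j => by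
        have := card_touching_add_inside_le hdeg (B j)
        rw [hcard j] at this
        omega)
      (fun j => (hcard j).le) one_pos
      (fun v => Finset.card_pos.2 ⟨v, by simp [hvB v]⟩)
      (fun v => by
        refine le_trans (Finset.card_le_card ?_) (card_ball_le hdeg v r)
        intro j hj
        have h1 : v ∈ B j := by simpa using hj
        have h2 := (hB j).subset_ball h1
        rw [hcard j] at h2
        exact h2 (hvB j))
      hdeg
      (by
        have h1 : (0 : ℝ) < r := by exact_mod_cast hr
        push_cast
        field_simp
        norm_num) f
    simpa using h

end

/-- With linearly many edges log Z is linear in n; the spectral time nK·log Z is then quadratic,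
hence k = 2. -/
theorem mixesRapidly_of_poincare {𝒢 : Set FinGraph} {lam : ℝ} {q : ℕ} (hq : 1 ≤ q)
    (hlam : 1 ≤ lam) {K : ℝ} (hK : 1 ≤ K) (hne : ∀ G ∈ 𝒢, Nonempty G.V)
    (hedges : ∀ G ∈ 𝒢, (edges G.graph).card ≤ 4 * Fintype.card G.V)
    (hP : ∀ G ∈ 𝒢, ∀ f, dirichlet (weight G.graph lam q) Finset.univ f ≤
      K * ∑ v, dirichlet (weight G.graph lam q) {v} f) :
    MixesRapidly 𝒢 lam q := by
  have hlam0 : 0 < lam := by linarith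
  have hq' : (1 : ℝ) ≤ q := by exact_mod_cast hq
  have hlq : 0 ≤ Real.log q := Real.log_nonneg hq'
  have hll : 0 ≤ Real.log lam := Real.log_nonneg hlam
  refine ⟨K * (Real.log q + 4 * Real.log lam + 2) + 1, 2, by positivity, ?_⟩
  intro G hG ε hε hε1
  have := hne G hG
  refine glauberMixingTime_le_of_poincare hq G.graph hlam hK (hP G hG) hε hε1.le ?_
  set n : ℝ := (Fintype.card G.V : ℝ) with hndef
  have hn : (1 : ℝ) ≤ n := by rw [hndef]; exact_mod_cast Fintype.card_pos
  have hℓ : 0 ≤ Real.log ε⁻¹ := Real.log_nonneg ((one_le_inv₀ hε).2 hε1.le)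
  set ℓ := Real.log ε⁻¹
  have hZ : Real.log (partitionFunction G.graph lam q) ≤ n * (Real.log q + 4 * Real.log lam) := by
    have h1 := partitionFunction_le (q := q) G.graph hlam
    have h2 := one_le_partitionFunction G.graph hlam hq
    refine (Real.log_le_log (by linarith) h1).trans ?_
    rw [Real.log_mul (by positivity) (by positivity), Real.log_pow, Real.log_pow]
    have h3 : ((edges G.graph).card : ℝ) ≤ 4 * n := by
      rw [hndef]; exact_mod_cast hedges G hG
    nlinarith
  set a := Real.log q + 4 * Real.log lam with ha
  have ha0 : 0 ≤ a := by positivity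
  calc n * K * (Real.log (partitionFunction G.graph lam q) + 2 * ℓ) + 1
      ≤ n * K * (n * a + 2 * (n * ℓ)) + 1 := by
        have : ℓ ≤ n * ℓ := le_mul_of_one_le_left hℓ hn
        gcongr
    _ = K * (a + 2 * ℓ) * n ^ 2 + 1 := by ring
    _ ≤ K * ((a + 2) * (1 + ℓ)) * n ^ 2 + n ^ 2 * (1 + ℓ) := by
        have h1 : a + 2 * ℓ ≤ (a + 2) * (1 + ℓ) := by nlinarith
        have h2 : (1 : ℝ) ≤ n ^ 2 := one_le_pow₀ hn
        have h3 : 1 ≤ n ^ 2 * (1 + ℓ) := by nlinarith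
        gcongr
    _ = (K * (a + 2) + 1) * n ^ 2 * (1 + ℓ) := by ring

theorem mixesRapidly_connectedMaxDegreeFour {η : ℝ} (hη : 0 < η) :
    ∃ c : ℝ, 0 < c ∧ ∀ (q : ℕ) (lam : ℝ), 1 ≤ q → 1 < lam → c * lam ^ (3 + η) < (q : ℝ) →
      MixesRapidly connectedMaxDegreeFour lam q := by
  -- The block size is chosen so that the boundary term 1/r in the exponent is at most η.
  obtain ⟨r, hr⟩ := exists_nat_gt (1 / η)
  have hr0 : (0 : ℝ) < r := lt_trans (by positivity) hr
  have hr1 : 1 ≤ r := by exact_mod_cast hr0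
  refine ⟨32 * r * 5 ^ r * 2 ^ (4 * r), by positivity, fun q lam hq hlam hqlam => ?_⟩
  have hdegree : ∀ G ∈ connectedMaxDegreeFour, ∀ v, deg G.graph v ≤ 4 := by
    intro G hG v
    refine le_trans (le_of_eq ?_) (hG.2 v)
    rw [deg, ← SimpleGraph.card_neighborFinset_eq_degree]
    congr 1
    ext u
    simp
  refine mixesRapidly_of_poincare (K := 2 * lam ^ (4 * r) * 5 ^ r) hq hlam.le ?_
    (fun G hG => hG.1.nonempty) (fun G hG => card_edges_le (hdegree G hG)) fun G hG f =>
    poincare_connected hq hG.1 (hdegree G hG) hlam.le hr1 ?_ f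
  · have h1 : 1 ≤ lam ^ (4 * r) := one_le_pow₀ hlam.le
    have h2 : (1 : ℝ) ≤ 5 ^ r := one_le_pow₀ (by norm_num)
    nlinarith
  · refine le_trans ?_ hqlam.le
    have h3 : 1 / (r : ℝ) ≤ η := by
      rw [div_lt_iff₀ hη] at hr
      rw [div_le_iff₀ hr0]; linarith
    have h4 : lam ^ (3 + 1 / (r : ℝ)) ≤ lam ^ (3 + η) :=
      Real.rpow_le_rpow_of_exponent_le hlam.le (by linarith)
    gcongr

end Potts

/-! ## Toroidal grids -/

namespace Potts

open Classical SpinSystem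

section

variable {L : ℕ} [NeZero L]

/-- The cyclic interval of length `r` that starts at `p`. -/
noncomputable def arc (r : ℕ) (p : ZMod L) : Finset (ZMod L) := {u | (u - p).val < r}

theorem mem_arc {r : ℕ} {p u : ZMod L} : u ∈ arc r p ↔ (u - p).val < r := by simp [arc]

theorem val_add_one_eq (a : ZMod L) (h : a.val + 1 < L) : (a + 1).val = a.val + 1 := by
  have h1 : ((a.val + 1 : ℕ) : ZMod L) = a + 1 := by
    push_cast; rw [ZMod.natCast_zmod_val]
  rw [← h1, ZMod.val_natCast_of_lt h]

theorem val_add_one_eq_zero (a : ZMod L) (h : a.val + 1 = L) : a + 1 = 0 := by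
  have h1 : ((a.val + 1 : ℕ) : ZMod L) = a + 1 := by
    push_cast; rw [ZMod.natCast_zmod_val]
  rw [← h1, h, ZMod.natCast_self]

theorem card_arc {r : ℕ} (hr : r ≤ L) (p : ZMod L) : (arc r p).card = r := by
  conv_rhs => rw [← Finset.card_range r]
  refine Finset.card_bij (fun u _ => (u - p).val) ?_ ?_ ?_
  · intro u hu; rw [Finset.mem_range]; exact mem_arc.1 hu
  · intro u _ u' _ h
    have := ZMod.val_injective L h
    simpa using this
  · intro i hi
    rw [Finset.mem_range] at hi
    refine ⟨p + i, ?_, ?_⟩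
    · rw [mem_arc, add_sub_cancel_left, ZMod.val_natCast_of_lt (by omega)]; exact hi
    · rw [add_sub_cancel_left, ZMod.val_natCast_of_lt (by omega)]

theorem card_filter_mem_arc {r : ℕ} (hr : r ≤ L) (u : ZMod L) :
    (Finset.univ.filter fun p => u ∈ arc r p).card = r := by
  conv_rhs => rw [← Finset.card_range r]
  refine Finset.card_bij (fun p _ => (u - p).val) ?_ ?_ ?_
  · intro p hp
    rw [Finset.mem_range]; exact mem_arc.1 (Finset.mem_filter.1 hp).2
  · intro p _ p' _ h
    have := ZMod.val_injective L h
    simpa using this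
  · intro i hi
    rw [Finset.mem_range] at hi
    refine ⟨u - i, ?_, ?_⟩
    · rw [Finset.mem_filter, mem_arc, sub_sub_cancel, ZMod.val_natCast_of_lt (by omega)]
      exact ⟨Finset.mem_univ _, hi⟩
    · rw [sub_sub_cancel, ZMod.val_natCast_of_lt (by omega)]

/-- In a cycle, the edges that meet a part `S` of an arc but not the rest of the arc: an edge is
given by its first end. -/
theorem card_arc_edges_le {r : ℕ} (hr : r ≤ L) (p : ZMod L) {S A : Finset (ZMod L)}
    (hS : S ⊆ arc r p)
    (hA : ∀ u ∈ A, (u ∈ S ∨ u + 1 ∈ S) ∧ (u ∈ arc r p → u ∈ S) ∧ (u + 1 ∈ arc r p → u + 1 ∈ S)) :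
    r * A.card ≤ (r + 1) * S.card := by
  -- An arc is entered in the forward direction only at its starting point.
  have hsucc : ∀ u : ZMod L, u ∉ arc r p → u + 1 ∈ arc r p → u + 1 = p := by
    intro u hu hu1
    rw [mem_arc] at hu hu1
    have hlt := ZMod.val_lt (u - p)
    rcases Nat.lt_or_ge ((u - p).val + 1) L with h | h
    · have h1 := val_add_one_eq (u - p) h
      rw [show u - p + 1 = u + 1 - p by ring] at h1
      omega
    · have h1 := val_add_one_eq_zero (u - p) (by omega)
      rw [show u - p + 1 = u + 1 - p by ring, sub_eq_zero] at h1
      exact h1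
  -- The whole arc meets at most r + 1 edges, the extreme ratio. A proper part meets no more
  -- admissible edges than it has vertices.
  by_cases hSI : S = arc r p
  · have h1 : A ⊆ insert (p - 1) S := by
      intro u hu
      obtain ⟨h2, h3, -⟩ := hA u hu
      by_cases hus : u ∈ S
      · exact Finset.mem_insert_of_mem hus
      · have h4 : u + 1 ∈ S := h2.resolve_left hus
        have h5 := hsucc u (hSI ▸ hus) (hSI ▸ h4)
        rw [← h5, add_sub_cancel_right]
        exact Finset.mem_insert_self _ _
    have h2 := (Finset.card_le_card h1).trans (Finset.card_insert_le _ _)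
    have h3 : S.card = r := by rw [hSI, card_arc hr]
    rw [h3] at h2 ⊢
    nlinarith
  · obtain ⟨t, htI, htS⟩ : ∃ t ∈ arc r p, t ∉ S := by
      by_contra! h
      exact hSI (Finset.Subset.antisymm hS h)
    have htr := mem_arc.1 htI
    set o : ZMod L → ℕ := fun u => (u - p).val with ho
    have hoinj : ∀ u u', o u = o u' → u = u' := fun u u' h => by
      simpa using ZMod.val_injective L h
    have hle : A.card ≤ S.card := by
      have helse : ∀ u ∈ A, ¬ (u + 1 ∈ S ∧ o (u + 1) < o t) → u ∈ S ∧ o t < o u := by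
        intro u hu hn
        obtain ⟨h2, h3, h4⟩ := hA u hu
        by_cases hus : u ∈ S
        · refine ⟨hus, ?_⟩
          by_contra! hlt
          have hne : o u ≠ o t := fun h => htS (hoinj u t h ▸ hus)
          have h5 : o (u + 1) = o u + 1 := by
            have := val_add_one_eq (u - p) (by simp only [ho] at hlt hne; omega)
            simp only [ho]
            rw [← this]; congr 1; ring
          have h6 : u + 1 ∈ S := h4 (mem_arc.2 (by simp only [ho] at *; omega))
          have h7 : o (u + 1) ≠ o t := fun h => htS (hoinj _ t h ▸ h6)
          exact hn ⟨h6, by omega⟩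
        · exfalso
          have h5 : u + 1 ∈ S := h2.resolve_left hus
          have h6 := hsucc u (fun h => hus (h3 h)) (hS h5)
          have h7 : o (u + 1) = 0 := by simp [ho, h6]
          have h8 : o (u + 1) ≠ o t := fun h => htS (hoinj _ t h ▸ h5)
          exact hn ⟨h5, by omega⟩
      -- The gap t in S breaks the arc in two: an edge before t is charged to its forward end, an
      -- edge after t to its first end. The two kinds of images lie on different sides of t.
      refine Finset.card_le_card_of_injOn
        (fun u => if u + 1 ∈ S ∧ o (u + 1) < o t then u + 1 else u) ?_ ?_
      · intro u hu
        by_cases h : u + 1 ∈ S ∧ o (u + 1) < o t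
        · simp only [if_pos h]; exact h.1
        · simp only [if_neg h]; exact (helse u hu h).1
      · intro u hu u' hu' heq
        by_cases h : u + 1 ∈ S ∧ o (u + 1) < o t <;> by_cases h' : u' + 1 ∈ S ∧ o (u' + 1) < o t
        · simp only [if_pos h, if_pos h'] at heq
          exact add_right_cancel heq
        · simp only [if_pos h, if_neg h'] at heq
          have := (helse u' hu' h').2
          rw [← heq] at this; omega
        · simp only [if_neg h, if_pos h'] at heq
          have := (helse u hu h).2
          rw [heq] at this; omega
        · simpa only [if_neg h, if_neg h'] using heq
    nlinarith

/-- The `r × r` block with corner `p`. -/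
noncomputable def block (r : ℕ) (p : ZMod L × ZMod L) : Finset (ZMod L × ZMod L) :=
  arc r p.1 ×ˢ arc r p.2

theorem card_block {r : ℕ} (hr : r ≤ L) (p : ZMod L × ZMod L) : (block r p).card = r ^ 2 := by
  rw [block, Finset.card_product, card_arc hr, card_arc hr, sq]

theorem card_filter_mem_block {r : ℕ} (hr : r ≤ L) (x : ZMod L × ZMod L) :
    (Finset.univ.filter fun p => x ∈ block r p).card = r ^ 2 := by
  have : (Finset.univ.filter fun p => x ∈ block r p) =
      (Finset.univ.filter fun p => x.1 ∈ arc r p) ×ˢ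
        (Finset.univ.filter fun p => x.2 ∈ arc r p) := by
    ext p; simp [block]
  rw [this, Finset.card_product, card_filter_mem_arc hr, card_filter_mem_arc hr, sq]

/-- The horizontal edges that meet a part `C` of a block but not the rest of the block. -/
theorem card_block_edges_le {r : ℕ} (hr : r ≤ L) (p : ZMod L × ZMod L)
    {C A : Finset (ZMod L × ZMod L)} (hC : C ⊆ block r p)
    (hA : ∀ x ∈ A, (x ∈ C ∨ (x.1 + 1, x.2) ∈ C) ∧ (x ∈ block r p → x ∈ C) ∧
      ((x.1 + 1, x.2) ∈ block r p → (x.1 + 1, x.2) ∈ C)) :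
    r * A.card ≤ (r + 1) * C.card := by
  have hrow : ∀ (D : Finset (ZMod L × ZMod L)),
      D.card = ∑ y, (Finset.univ.filter fun u => (u, y) ∈ D).card := by
    intro D
    rw [Finset.card_eq_sum_card_fiberwise (f := Prod.snd) (t := Finset.univ) (by simp)]
    refine Finset.sum_congr rfl fun y _ => ?_
    refine Finset.card_bij (fun x _ => x.1) ?_ ?_ ?_
    · rintro ⟨a, b⟩ h
      obtain ⟨h1, rfl⟩ := Finset.mem_filter.1 h
      simpa using h1
    · rintro ⟨a, b⟩ h ⟨a', b'⟩ h' heq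
      obtain ⟨-, h1⟩ := Finset.mem_filter.1 h
      obtain ⟨-, h2⟩ := Finset.mem_filter.1 h'
      simp only at heq h1 h2
      rw [heq, h1, h2]
    · intro u hu
      exact ⟨(u, y), by simpa using hu, rfl⟩
  rw [hrow A, hrow C, Finset.mul_sum, Finset.mul_sum]
  refine Finset.sum_le_sum fun y _ => ?_
  by_cases hy : y ∈ arc r p.2
  · refine card_arc_edges_le hr p.1 ?_ ?_
    · intro u hu
      have := hC (Finset.mem_filter.1 hu).2
      exact (Finset.mem_product.1 this).1
    · intro u hu
      obtain ⟨h1, h2, h3⟩ := hA _ (Finset.mem_filter.1 hu).2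
      simp only [Finset.mem_filter, Finset.mem_univ, true_and]
      refine ⟨h1, fun h => h2 ?_, fun h => h3 ?_⟩
      · exact Finset.mem_product.2 ⟨h, hy⟩
      · exact Finset.mem_product.2 ⟨h, hy⟩
  · have h1 : ∀ u, (u, y) ∉ C := fun u hu => hy (Finset.mem_product.1 (hC hu)).2
    have h2 : (Finset.univ.filter fun u => (u, y) ∈ A) = ∅ := by
      refine Finset.filter_eq_empty_iff.2 fun u _ hu => ?_
      rcases (hA _ hu).1 with h | h
      · exact h1 _ h
      · exact h1 _ h
    rw [h2]; simp

/-- A vertex of maximal offset in C is not the first end of an inner edge. Since r < L, the step to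
the right does not wrap around. -/
theorem card_block_inside_le {r : ℕ} (hr : r < L) (p : ZMod L × ZMod L)
    {C A : Finset (ZMod L × ZMod L)} (hC : C ⊆ block r p) (hne : C.Nonempty)
    (hA : ∀ x ∈ A, x ∈ C ∧ (x.1 + 1, x.2) ∈ C) : A.card + 1 ≤ C.card := by
  obtain ⟨x, hx, hmax⟩ := C.exists_max_image (fun x => (x.1 - p.1).val) hne
  have hxr : (x.1 - p.1).val < r := mem_arc.1 (Finset.mem_product.1 (hC hx)).1
  have h1 : A ⊆ C.erase x := by
    intro y hy
    refine Finset.mem_erase.2 ⟨?_, (hA y hy).1⟩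
    rintro rfl
    have h2 := hmax _ (hA y hy).2
    have h3 := val_add_one_eq (y.1 - p.1) (by omega)
    rw [show y.1 - p.1 + 1 = y.1 + 1 - p.1 by ring] at h3
    simp only at h2
    omega
  have h2 := Finset.card_le_card h1
  rw [Finset.card_erase_of_mem hx] at h2
  have := hne.card_pos
  omega

theorem torus_edge_cases {e : Sym2 (ZMod L × ZMod L)} (he : e ∈ edges (torusGraph L)) :
    ∃ x : ZMod L × ZMod L, e = s(x, (x.1 + 1, x.2)) ∨ e = s(x, (x.1, x.2 + 1)) := by
  induction e using Sym2.ind with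
  | _ x y =>
    obtain ⟨-, h⟩ := (SimpleGraph.mem_edgeSet _).1 (mem_edges.1 he)
    obtain ⟨a, b⟩ := x
    obtain ⟨c, d⟩ := y
    simp only at h
    rcases h with ⟨h1 | h1, h2⟩ | ⟨h1 | h1, h2⟩
    · refine ⟨(c, d), Or.inl ?_⟩
      rw [Sym2.eq_swap, ← h1, sub_eq_zero.1 h2]; simp
    · refine ⟨(a, b), Or.inl ?_⟩
      rw [sub_eq_zero.1 h2, show c = a + 1 by rw [← neg_neg (1 : ZMod L), ← h1]; ring]
    · refine ⟨(c, d), Or.inr ?_⟩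
      rw [Sym2.eq_swap, ← h1, sub_eq_zero.1 h2]; simp
    · refine ⟨(a, b), Or.inr ?_⟩
      rw [sub_eq_zero.1 h2, show d = b + 1 by rw [← neg_neg (1 : ZMod L), ← h1]; ring]

/-- Only an inequality: when L = 2 the same edge arises from both of its ends. -/
theorem card_torus_edges_le {E : Finset (Sym2 (ZMod L × ZMod L))} (hE : E ⊆ edges (torusGraph L)) :
    E.card ≤ (Finset.univ.filter fun x : ZMod L × ZMod L => s(x, (x.1 + 1, x.2)) ∈ E).card +
      (Finset.univ.filter fun x : ZMod L × ZMod L => s(x, (x.1, x.2 + 1)) ∈ E).card := by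
  have h : E ⊆
      ((Finset.univ.filter fun x : ZMod L × ZMod L => s(x, (x.1 + 1, x.2)) ∈ E).image
        fun x => s(x, (x.1 + 1, x.2))) ∪
      ((Finset.univ.filter fun x : ZMod L × ZMod L => s(x, (x.1, x.2 + 1)) ∈ E).image
        fun x => s(x, (x.1, x.2 + 1))) := by
    intro e he
    obtain ⟨x, rfl | rfl⟩ := torus_edge_cases (hE he)
    · exact Finset.mem_union_left _ (Finset.mem_image.2 ⟨x, by simpa using he, rfl⟩)
    · exact Finset.mem_union_right _ (Finset.mem_image.2 ⟨x, by simpa using he, rfl⟩)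
  exact (Finset.card_le_card h).trans ((Finset.card_union_le _ _).trans
    (add_le_add Finset.card_image_le Finset.card_image_le))

theorem block_map_swap (r : ℕ) (p : ZMod L × ZMod L) (x : ZMod L × ZMod L) :
    x ∈ block r p.swap ↔ x.swap ∈ block r p := by
  simp [block, and_comm]

theorem torus_isolating_le {r : ℕ} (hr : r ≤ L) (p : ZMod L × ZMod L)
    {C : Finset (ZMod L × ZMod L)} (hC : C ⊆ block r p) :
    r * (isolating (edges (torusGraph L)) (block r p) C).card ≤ 2 * (r + 1) * C.card := by
  set E := isolating (edges (torusGraph L)) (block r p) C with hE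
  have h1 := card_torus_edges_le (E := E) fun e he => (mem_isolating.1 he).1
  have h2 := card_block_edges_le hr p hC
    (A := Finset.univ.filter fun x : ZMod L × ZMod L => s(x, (x.1 + 1, x.2)) ∈ E) (by
      intro x hx
      obtain ⟨-, ⟨v, hv, hve⟩, h3⟩ := mem_isolating.1 (Finset.mem_filter.1 hx).2
      refine ⟨?_, fun h => h3 x (by simp) h, fun h => h3 _ (by simp) h⟩
      rcases Sym2.mem_iff.1 hve with rfl | rfl
      · exact Or.inl hv
      · exact Or.inr hv)
  -- Vertical edges become horizontal ones after exchanging the coordinates.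
  have h3 := card_block_edges_le hr p.swap (C := C.map (Equiv.prodComm _ _).toEmbedding)
    (A := (Finset.univ.filter fun x : ZMod L × ZMod L => s(x, (x.1, x.2 + 1)) ∈ E).map
      (Equiv.prodComm _ _).toEmbedding) (by
      intro x hx
      obtain ⟨y, hy, rfl⟩ := Finset.mem_map.1 hx
      exact (block_map_swap r p _).2 (by simpa using hC hy)) (by
      intro x hx
      obtain ⟨y, hy, rfl⟩ := Finset.mem_map.1 hx
      obtain ⟨-, ⟨v, hv, hve⟩, h3⟩ := mem_isolating.1 (Finset.mem_filter.1 hy).2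
      have hmap : ∀ z : ZMod L × ZMod L, z ∈ C.map (Equiv.prodComm _ _).toEmbedding ↔
          z.swap ∈ C := by
        intro z
        simp only [Finset.mem_map_equiv, Equiv.prodComm_symm, Equiv.prodComm_apply]
      rw [hmap, hmap, block_map_swap, block_map_swap]
      simp only [Equiv.coe_toEmbedding, Equiv.prodComm_apply, Prod.swap_swap, Prod.fst_swap,
        Prod.snd_swap, Prod.swap_prod_mk]
      refine ⟨?_, fun h => h3 y (by simp) h, fun h => h3 _ (by simp) h⟩
      rcases Sym2.mem_iff.1 hve with rfl | rfl
      · exact Or.inl hv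
      · exact Or.inr hv)
  rw [Finset.card_map, Finset.card_map] at h3
  nlinarith

theorem torus_inside_le {r : ℕ} (hr : r < L) (p : ZMod L × ZMod L)
    {C : Finset (ZMod L × ZMod L)} (hC : C ⊆ block r p) (hne : C.Nonempty) :
    (inside (edges (torusGraph L)) C).card + 2 ≤ 2 * C.card := by
  set E := inside (edges (torusGraph L)) C with hE
  have h1 := card_torus_edges_le (E := E) fun e he => (mem_inside.1 he).1
  have h2 := card_block_inside_le hr p hC hne
    (A := Finset.univ.filter fun x : ZMod L × ZMod L => s(x, (x.1 + 1, x.2)) ∈ E) (by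
      intro x hx
      obtain ⟨-, h3⟩ := mem_inside.1 (Finset.mem_filter.1 hx).2
      exact ⟨h3 x (by simp), h3 _ (by simp)⟩)
  have h3 := card_block_inside_le hr p.swap (C := C.map (Equiv.prodComm _ _).toEmbedding)
    (A := (Finset.univ.filter fun x : ZMod L × ZMod L => s(x, (x.1, x.2 + 1)) ∈ E).map
      (Equiv.prodComm _ _).toEmbedding) (by
      intro x hx
      obtain ⟨y, hy, rfl⟩ := Finset.mem_map.1 hx
      exact (block_map_swap r p _).2 (by simpa using hC hy)) (hne.map) (by
      intro x hx
      obtain ⟨y, hy, rfl⟩ := Finset.mem_map.1 hx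
      obtain ⟨-, h3⟩ := mem_inside.1 (Finset.mem_filter.1 hy).2
      have hmap : ∀ z : ZMod L × ZMod L, z ∈ C.map (Equiv.prodComm _ _).toEmbedding ↔
          z.swap ∈ C := by
        intro z
        simp only [Finset.mem_map_equiv, Equiv.prodComm_symm, Equiv.prodComm_apply]
      rw [hmap, hmap]
      simp only [Equiv.coe_toEmbedding, Equiv.prodComm_apply, Prod.swap_swap, Prod.fst_swap,
        Prod.snd_swap, Prod.swap_prod_mk]
      exact ⟨h3 y (by simp), h3 _ (by simp)⟩)
  rw [Finset.card_map, Finset.card_map] at h3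
  omega

theorem torus_sparse {r : ℕ} (hr0 : 1 ≤ r) (hr : r < L) (p : ZMod L × ZMod L) :
    Sparse (edges (torusGraph L)) (block r p) (2 + 2 / (r : ℝ)) := by
  have hr' : (0 : ℝ) < r := by exact_mod_cast hr0
  constructor
  · intro C hC hne
    have h1 : ((inside (edges (torusGraph L)) C).card : ℝ) + 2 ≤ 2 * C.card := by
      exact_mod_cast torus_inside_le hr p hC hne
    have h2 : (1 : ℝ) ≤ C.card := by exact_mod_cast hne.card_pos
    have h3 : 0 ≤ 2 / (r : ℝ) := by positivity
    nlinarith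
  · intro C hC
    have h1 : (r : ℝ) * (isolating (edges (torusGraph L)) (block r p) C).card ≤
        2 * (r + 1) * C.card := by
      exact_mod_cast torus_isolating_le hr.le p hC
    have h2 : (2 + 2 / (r : ℝ)) * C.card = 2 * (r + 1) * C.card / r := by
      field_simp
    rw [h2, le_div_iff₀ hr']
    linarith

theorem card_touching_block_le {r : ℕ} (hr0 : 1 ≤ r) (hr : r ≤ L) (p : ZMod L × ZMod L) :
    (touching (edges (torusGraph L)) (block r p)).card ≤ 2 * r ^ 2 + 2 * r := by
  have h1 : touching (edges (torusGraph L)) (block r p) ⊆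
      isolating (edges (torusGraph L)) (block r p) (block r p) := by
    intro e he
    obtain ⟨h1, h2⟩ := mem_touching.1 he
    exact mem_isolating.2 ⟨h1, h2, fun v _ h => h⟩
  have h2 := torus_isolating_le hr p (Finset.Subset.refl (block r p))
  rw [card_block hr] at h2
  have h3 := Finset.card_le_card h1
  refine h3.trans (Nat.le_of_mul_le_mul_left ?_ hr0)
  nlinarith

theorem torus_deg_le (v : ZMod L × ZMod L) : deg (torusGraph L) v ≤ 4 := by
  rw [deg]
  refine le_trans (Finset.card_le_card (t := {(v.1 + 1, v.2), (v.1 - 1, v.2), (v.1, v.2 + 1),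
    (v.1, v.2 - 1)}) ?_) Finset.card_le_four
  intro u hu
  obtain ⟨-, h⟩ := (Finset.mem_filter.1 hu).2
  obtain ⟨a, b⟩ := v
  obtain ⟨c, d⟩ := u
  simp only [Finset.mem_insert, Finset.mem_singleton, Prod.mk.injEq] at h ⊢
  rcases h with ⟨h1 | h1, h2⟩ | ⟨h1 | h1, h2⟩
  · right; left; exact ⟨by rw [← h1]; ring, (sub_eq_zero.1 h2).symm⟩
  · left; exact ⟨by rw [← neg_neg (1 : ZMod L), ← h1]; ring, (sub_eq_zero.1 h2).symm⟩
  · right; right; right; exact ⟨(sub_eq_zero.1 h2).symm, by rw [← h1]; ring⟩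
  · right; right; left; exact ⟨(sub_eq_zero.1 h2).symm, by rw [← neg_neg (1 : ZMod L), ← h1]; ring⟩

theorem torus_poincare {q r : ℕ} (hq0 : 0 < q) {lam : ℝ} (hlam : 1 ≤ lam) (hr : 1 ≤ r)
    (hrL : r < L) (hq : 32 * (r : ℝ) ^ 2 * 2 ^ (2 * r ^ 2 + 2 * r) * lam ^ (2 + 2 / (r : ℝ)) ≤ q)
    (f : (ZMod L × ZMod L → Fin q) → ℝ) :
    dirichlet (weight (torusGraph L) lam q) Finset.univ f ≤ 2 * lam ^ (2 * r ^ 2 + 2 * r) *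
      ∑ v, dirichlet (weight (torusGraph L) lam q) {v} f := by
  have hr' : (1 : ℝ) ≤ r := by exact_mod_cast hr
  have hK : (1 : ℝ) ≤ 32 * (r : ℝ) ^ 2 * 2 ^ (2 * r ^ 2 + 2 * r) := by
    have h1 : (1 : ℝ) ≤ (r : ℝ) ^ 2 := one_le_pow₀ hr'
    have h3 : (1 : ℝ) ≤ 2 ^ (2 * r ^ 2 + 2 * r) := one_le_pow₀ (by norm_num)
    calc (1 : ℝ) = 1 * 1 * 1 := by norm_num
      _ ≤ 32 * (r : ℝ) ^ 2 * 2 ^ (2 * r ^ 2 + 2 * r) := by gcongr; norm_num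
  -- All translates of the block are used, so each vertex is in exactly r² of them and a = b cancels
  -- in the constant. Smallness is again an equality, thanks to the factor 32.
  have h := poincare_of_blocks (G := torusGraph L) (B := block r) (a := r ^ 2) (b := r ^ 2)
    (m := r ^ 2) hq0 hlam hK hq (fun p => torus_sparse hr hrL p)
    (fun p => card_touching_block_le hr hrL.le p) (fun p => (card_block hrL.le p).le)
    (by positivity) (fun v => le_of_eq (by rw [← card_filter_mem_block hrL.le v]; congr!))
    (fun v => le_of_eq (by rw [← card_filter_mem_block hrL.le v]; congr!)) torus_deg_le (by
      push_cast
      field_simp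
      norm_num) f
  refine h.trans (le_of_eq ?_)
  congr 1
  push_cast
  field_simp

end

/-! ### The mixing-time bounds for the torus. -/

theorem sparse_singleton {V : Type*} [Fintype V] {G : SimpleGraph V} (hdeg : ∀ v, deg G v ≤ 4)
    (v : V) : Sparse (edges G) {v} 4 := by
  constructor
  · intro C hC hne
    have h1 : C.card = 1 := by
      rw [Finset.Nonempty.subset_singleton_iff hne |>.1 hC, Finset.card_singleton]
    have h2 := card_inside_le_three_mul hdeg hne
    have h3 : (inside (edges G) C).card = 0 := by omega
    simp [h1, h3]
  · intro C _
    have h1 := card_touching_add_inside_le hdeg C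
    have h2 : isolating (edges G) {v} C ⊆ touching (edges G) C := fun e he =>
      mem_touching.2 ⟨(mem_isolating.1 he).1, (mem_isolating.1 he).2.1⟩
    have h3 := Finset.card_le_card h2
    have h4 : (isolating (edges G) {v} C).card ≤ 4 * C.card := by omega
    exact_mod_cast h4

/-- The single-site dynamics contracts when `q` is at least a large multiple of `λ^4`. -/
noncomputable def goodBlocks_singleton {V : Type*} [Fintype V] {G : SimpleGraph V}
    (hdeg : ∀ v, deg G v ≤ 4) {q : ℕ} {lam : ℝ} (hlam : 1 ≤ lam)
    (hq : 2 ^ 12 * lam ^ (4 : ℝ) ≤ (q : ℝ)) :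
    GoodBlocks (weight G lam q) (fun v : V => ({v} : Finset V)) 1 (4 * 1) 1 (2 ^ 4 / 2 ^ 12) :=
  goodBlocks (κ := 4) hlam (by norm_num) hq (sparse_singleton hdeg)
    (fun v => by
      have := card_touching_add_inside_le hdeg {v}
      rw [Finset.card_singleton] at this
      omega)
    (fun v => by simp)
    (fun v => Finset.card_pos.2 ⟨v, by simp⟩)
    (fun v => by simp [Finset.filter_eq])
    hdeg (by norm_num)

/-- The explicit constant of the detailed bound dominates the one that the block argument needs. For
r ≥ 2, all but two of the powers of r are traded for powers of 2. -/
theorem torus_constant_le {r : ℕ} (hr : 1 ≤ r) :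
    32 * (r : ℝ) ^ 2 * 2 ^ (2 * r ^ 2 + 2 * r) ≤
      2 ^ (r ^ 2 + 8 * r + 3) * (r : ℝ) ^ (2 * r ^ 2 + 4 * r + 1) := by
  have h : 32 * r ^ 2 * 2 ^ (2 * r ^ 2 + 2 * r) ≤
      2 ^ (r ^ 2 + 8 * r + 3) * r ^ (2 * r ^ 2 + 4 * r + 1) := by
    rcases hr.eq_or_lt with rfl | hr
    · norm_num
    · obtain ⟨k, hk⟩ : ∃ k, 2 * r ^ 2 + 4 * r + 1 = k + 2 :=
        ⟨2 * r ^ 2 + 4 * r - 1, by omega⟩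
      rw [hk]
      calc 32 * r ^ 2 * 2 ^ (2 * r ^ 2 + 2 * r) = 2 ^ (2 * r ^ 2 + 2 * r + 5) * r ^ 2 := by ring
        _ ≤ 2 ^ (r ^ 2 + 8 * r + 3 + k) * r ^ 2 := by
            refine Nat.mul_le_mul_right _ (Nat.pow_le_pow_right (by norm_num) ?_)
            nlinarith
        _ = 2 ^ (r ^ 2 + 8 * r + 3) * (2 ^ k * r ^ 2) := by ring
        _ ≤ 2 ^ (r ^ 2 + 8 * r + 3) * (r ^ k * r ^ 2) := by gcongr; omega
        _ = _ := by ring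
  exact_mod_cast h

theorem torus_glauberMixingTime_le (lam : ℝ) (L r q : ℕ) [NeZero L] (hlam : 1 < lam) (hr : 1 ≤ r)
    (hrL : r + 2 ≤ L)
    (hq : (2 : ℝ) ^ (r ^ 2 + 8 * r + 3) * (r : ℝ) ^ (2 * r ^ 2 + 4 * r + 1) *
      lam ^ (2 + 2 / (r : ℝ)) ≤ (q : ℝ)) (ε : ℝ) (hε : 0 < ε) (hε1 : ε ≤ 1) (n : ℝ)
    (hn : n = (L : ℝ) ^ 2) :
    (glauberMixingTime (torusGraph L) lam q ε : ENNReal) ≤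
      ENNReal.ofReal (4 * (4 * lam ^ 8) ^ (r ^ 2 + 1) * n ^ 2 *
        Real.log (2 * Real.exp 1 * n) * (n * Real.log (4 * lam ^ 6) + Real.log ε⁻¹)) := by
  have hlam0 : 0 < lam := by linarith
  have hq1 : (1 : ℝ) ≤ q := by
    refine le_trans ?_ hq
    have h1 : (1 : ℝ) ≤ (2 : ℝ) ^ (r ^ 2 + 8 * r + 3) := one_le_pow₀ (by norm_num)
    have h2 : (1 : ℝ) ≤ (r : ℝ) ^ (2 * r ^ 2 + 4 * r + 1) := one_le_pow₀ (by exact_mod_cast hr)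
    have h3 : (1 : ℝ) ≤ lam ^ (2 + 2 / (r : ℝ)) :=
      Real.one_le_rpow hlam.le (by positivity)
    calc (1 : ℝ) = 1 * 1 * 1 := by norm_num
      _ ≤ _ := by gcongr
  have hq0 : 0 < q := by exact_mod_cast (lt_of_lt_of_le one_pos hq1)
  have hcard : (Fintype.card (ZMod L × ZMod L) : ℝ) = n := by
    rw [Fintype.card_prod, ZMod.card, hn]; push_cast; ring
  have hn9 : 9 ≤ n := by
    have : (3 : ℝ) ≤ L := by exact_mod_cast (by omega : 3 ≤ L)
    rw [hn]; nlinarith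
  set ℓ := Real.log ε⁻¹ with hℓdef
  have hℓ : 0 ≤ ℓ := Real.log_nonneg ((one_le_inv₀ hε).2 hε1)
  have hlog1 : 1 ≤ Real.log (2 * Real.exp 1 * n) := by
    rw [Real.le_log_iff_exp_le (by positivity)]
    have := Real.exp_pos 1
    nlinarith
  set Λ := Real.log (4 * lam ^ 6) with hΛ
  have hlam6 : 1 ≤ lam ^ 6 := one_le_pow₀ hlam.le
  have hΛ1 : 1 ≤ Λ := by
    rw [hΛ, Real.le_log_iff_exp_le (by positivity)]
    have := Real.exp_one_lt_d9
    nlinarith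
  set X := (4 * lam ^ 8) ^ (r ^ 2 + 1) with hX
  have hX1 : 16 ≤ X := by
    have h1 : (4 : ℝ) ≤ 4 * lam ^ 8 := by nlinarith [one_le_pow₀ (n := 8) hlam.le]
    calc (16 : ℝ) = 4 ^ 2 := by norm_num
      _ ≤ 4 ^ (r ^ 2 + 1) := pow_le_pow_right₀ (by norm_num) (by nlinarith)
      _ ≤ X := pow_le_pow_left₀ (by norm_num) h1 _
  have hXY : lam ^ (2 * r ^ 2 + 2 * r) ≤ X := by
    calc lam ^ (2 * r ^ 2 + 2 * r) ≤ lam ^ (8 * (r ^ 2 + 1)) :=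
          pow_le_pow_right₀ hlam.le (by nlinarith)
      _ = (lam ^ 8) ^ (r ^ 2 + 1) := pow_mul _ _ _
      _ ≤ X := pow_le_pow_left₀ (by positivity) (by nlinarith [pow_pos hlam0 8]) _
  set W := n * Λ + ℓ with hW
  have hW0 : 9 ≤ W := by nlinarith
  have htarget : 36 * X * n * W ≤ 4 * X * n ^ 2 * Real.log (2 * Real.exp 1 * n) * W := by
    calc 36 * X * n * W = 4 * X * (9 * n) * 1 * W := by ring
      _ ≤ 4 * X * n ^ 2 * Real.log (2 * Real.exp 1 * n) * W := by
        have : 9 * n ≤ n ^ 2 := by nlinarith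
        gcongr
  -- The target does not involve q, while the spectral bound contains log q. For large q the
  -- single-site dynamics itself contracts, with no dependence on q; otherwise log q is bounded in
  -- terms of λ.
  by_cases hbig : 2 ^ 12 * lam ^ (4 : ℝ) ≤ (q : ℝ)
  · refine glauberMixingTime_le_of_contraction hq0 (torusGraph L) hlam.le
      (goodBlocks_singleton torus_deg_le hlam.le hbig) hε hε1 (le_trans ?_ htarget)
    rw [hcard]
    have h1 : Real.log n ≤ n := (Real.log_le_sub_one_of_pos (by linarith)).trans (by linarith)
    have h2 : Real.log n + ℓ ≤ W := by nlinarith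
    have h3 : 0 < n * W := by positivity
    have h4 : 16 * (n * W) ≤ X * (n * W) := by gcongr
    nlinarith
  · have hP := torus_poincare (L := L) hq0 hlam.le hr (by omega)
      (le_trans (mul_le_mul_of_nonneg_right (torus_constant_le hr) (by positivity)) hq)
    have hY1 : 1 ≤ lam ^ (2 * r ^ 2 + 2 * r) := one_le_pow₀ hlam.le
    refine glauberMixingTime_le_of_poincare hq0 (torusGraph L) hlam.le (by linarith) hP hε hε1
      (le_trans ?_ htarget)
    rw [hcard]
    have hZ : Real.log (partitionFunction (torusGraph L) lam q) ≤ n * (6 * Λ) := by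
      have h1 := partitionFunction_le (q := q) (torusGraph L) hlam.le
      have h2 := one_le_partitionFunction (torusGraph L) hlam.le hq0
      refine (Real.log_le_log (by linarith) h1).trans ?_
      rw [Real.log_mul (by positivity) (by positivity), Real.log_pow, Real.log_pow, hcard]
      have h3 : ((edges (torusGraph L)).card : ℝ) ≤ 4 * n := by
        rw [← hcard]; exact_mod_cast card_edges_le (torus_deg_le (L := L))
      have hll : 0 ≤ Real.log lam := Real.log_nonneg hlam.le
      have h4 : Real.log q + 4 * Real.log lam ≤ 6 * Λ := by
        have h5 : Real.log q ≤ Real.log (2 ^ 12 * lam ^ 4) := by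
          refine Real.log_le_log (by linarith) ?_
          push Not at hbig
          exact_mod_cast hbig.le
        rw [Real.log_mul (by positivity) (by positivity), Real.log_pow, Real.log_pow] at h5
        have h6 : Λ = 2 * Real.log 2 + 6 * Real.log lam := by
          rw [hΛ, show (4 : ℝ) = 2 ^ 2 by norm_num, Real.log_mul (by positivity) (by positivity),
            Real.log_pow, Real.log_pow]
          push_cast; ring
        push_cast at h5
        rw [h6]; linarith
      nlinarith
    have h5 : Real.log (partitionFunction (torusGraph L) lam q) + 2 * ℓ ≤ 6 * W := by
      rw [hW]; linarith
    have h6 : 1 ≤ X * n * W := by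
      have h7 : 16 * (9 * 9) ≤ X * (n * W) := by gcongr
      nlinarith
    calc n * (2 * lam ^ (2 * r ^ 2 + 2 * r)) *
          (Real.log (partitionFunction (torusGraph L) lam q) + 2 * ℓ) + 1
        ≤ n * (2 * X) * (6 * W) + X * n * W := by
          have : 0 ≤ n * (2 * lam ^ (2 * r ^ 2 + 2 * r)) := by positivity
          refine add_le_add ?_ h6
          calc _ ≤ n * (2 * lam ^ (2 * r ^ 2 + 2 * r)) * (6 * W) := by gcongr
            _ ≤ _ := by gcongr
      _ ≤ 36 * X * n * W := by nlinarith

theorem mixesRapidly_toroidalGrids {η : ℝ} (hη : 0 < η) :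
    ∃ c : ℝ, 0 < c ∧ ∀ (q : ℕ) (lam : ℝ), 1 ≤ q → 1 < lam → c * lam ^ (2 + η) < (q : ℝ) →
      MixesRapidly toroidalGrids lam q := by
  obtain ⟨r, hr⟩ := exists_nat_gt (2 / η)
  have hr0 : (0 : ℝ) < r := lt_trans (by positivity) hr
  have hr1 : 1 ≤ r := by exact_mod_cast hr0
  refine ⟨32 * (r : ℝ) ^ 2 * 2 ^ (2 * r ^ 2 + 2 * r), by positivity, fun q lam hq hlam hqlam => ?_⟩
  have hlam0 : 0 < lam := by linarith
  have hlam1 : ∀ k : ℕ, 1 ≤ lam ^ k := fun k => one_le_pow₀ hlam.le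
  refine mixesRapidly_of_poincare (K := 2 * lam ^ (4 * (r + 2) ^ 2)) hq hlam.le
    (by linarith [hlam1 (4 * (r + 2) ^ 2)]) ?_ ?_ ?_
  · rintro G ⟨L, hL, rfl⟩
    exact ⟨(0, 0)⟩
  · rintro G ⟨L, hL, rfl⟩
    exact card_edges_le torus_deg_le
  · rintro G ⟨L, hL, rfl⟩ f
    have hw : ∀ σ, 0 < weight (torusGraph L) lam q σ := weight_pos hlam0 _
    have hnn : 0 ≤ ∑ v, dirichlet (weight (torusGraph L) lam q) {v} f :=
      Finset.sum_nonneg fun v _ => dirichlet_nonneg hw {v} f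
    -- Tori with L ≤ r have boundedly many edges; the exponent 4(r + 2)² covers both cases.
    by_cases hrL : r < L
    · refine (torus_poincare hq hlam.le hr1 hrL (le_trans ?_ hqlam.le) f).trans
        (mul_le_mul_of_nonneg_right ?_ hnn)
      · have h3 : 2 / (r : ℝ) ≤ η := by
          rw [div_lt_iff₀ hη] at hr
          rw [div_le_iff₀ hr0]; linarith
        have h4 : lam ^ (2 + 2 / (r : ℝ)) ≤ lam ^ (2 + η) :=
          Real.rpow_le_rpow_of_exponent_le hlam.le (by linarith)
        gcongr
      · have : lam ^ (2 * r ^ 2 + 2 * r) ≤ lam ^ (4 * (r + 2) ^ 2) :=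
          pow_le_pow_right₀ hlam.le (by nlinarith)
        linarith
    · refine (poincare_of_card_edges hq (torusGraph L) hlam.le f).trans
        (mul_le_mul_of_nonneg_right ?_ hnn)
      have h1 : (edges (torusGraph L)).card ≤ 4 * (r + 2) ^ 2 := by
        refine (card_edges_le (torus_deg_le (L := L))).trans ?_
        rw [Fintype.card_prod, ZMod.card]
        nlinarith
      have h2 : lam ^ (edges (torusGraph L)).card ≤ lam ^ (4 * (r + 2) ^ 2) :=
        pow_le_pow_right₀ hlam.le h1
      linarith [hlam1 (4 * (r + 2) ^ 2)]

end Potts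

/-! ## Random regular graphs -/

namespace Potts

open Classical SpinSystem

/-! ### Switchings and the probability of prescribed edges. -/

section

variable {V : Type*} [Fintype V]

/-- The ends of the edges in `E` at `v`. -/
noncomputable def nbr (E : Finset (Sym2 V)) (v : V) : Finset V := {u | s(v, u) ∈ E}

theorem mem_nbr {E : Finset (Sym2 V)} {u v : V} : u ∈ nbr E v ↔ s(v, u) ∈ E := by simp [nbr]

theorem card_nbr (E : Finset (Sym2 V)) (v : V) :
    (nbr E v).card = (E.filter fun e => v ∈ e).card := by
  refine Finset.card_bij (fun u _ => s(v, u)) ?_ ?_ ?_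
  · intro u hu
    exact Finset.mem_filter.2 ⟨mem_nbr.1 hu, by simp⟩
  · intro u _ u' _ h
    exact Sym2.congr_right.1 h
  · intro e he
    obtain ⟨h1, u, rfl⟩ := Finset.mem_filter.1 he
    exact ⟨u, mem_nbr.2 h1, rfl⟩

variable (V) in
/-- The edge sets of the 4-regular graphs. -/
noncomputable def regularEdges : Finset (Finset (Sym2 V)) :=
  {E | (∀ e ∈ E, ¬ e.IsDiag) ∧ ∀ v, (nbr E v).card = 4}

theorem mem_regularEdges {E : Finset (Sym2 V)} :
    E ∈ regularEdges V ↔ (∀ e ∈ E, ¬ e.IsDiag) ∧ ∀ v, (nbr E v).card = 4 := by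
  simp [regularEdges]

/-- The 4-regular edge sets that contain `F`. -/
noncomputable def containing (F : Finset (Sym2 V)) : Finset (Finset (Sym2 V)) :=
  {E ∈ regularEdges V | F ⊆ E}

theorem mem_containing {E F : Finset (Sym2 V)} :
    E ∈ containing F ↔ E ∈ regularEdges V ∧ F ⊆ E := by
  simp [containing]

/-- The ordered edges `(x, y)` of `E` that can be switched with `(u, v)`. -/
noncomputable def switchable (E F : Finset (Sym2 V)) (u v : V) : Finset (V × V) :=
  {p | s(p.1, p.2) ∈ E ∧ s(p.1, p.2) ∉ F ∧ p.1 ∉ insert u (nbr E u) ∧ p.2 ∉ insert v (nbr E v)}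

/-- Replace the edges `uv` and `xy` by `ux` and `vy`. -/
noncomputable def switch (E : Finset (Sym2 V)) (u v : V) (p : V × V) : Finset (Sym2 V) :=
  insert s(u, p.1) (insert s(v, p.2) ((E.erase s(u, v)).erase s(p.1, p.2)))

theorem card_darts {E : Finset (Sym2 V)} (hE : E ∈ regularEdges V) (T : Finset V) :
    (Finset.univ.filter fun p : V × V => s(p.1, p.2) ∈ E ∧ p.1 ∈ T).card = T.card * 4 := by
  rw [Finset.card_eq_sum_card_fiberwise (f := Prod.fst) (t := T)
    (fun p hp => (Finset.mem_filter.1 (Finset.mem_coe.1 hp)).2.2)]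
  refine Finset.sum_const_nat fun x hx => ?_
  rw [← (mem_regularEdges.1 hE).2 x]
  refine Finset.card_bij (fun p _ => p.2) ?_ ?_ ?_
  · rintro ⟨a, b⟩ h
    simp only [Finset.mem_filter, Finset.mem_univ, true_and] at h
    obtain ⟨⟨h1, -⟩, rfl⟩ := h
    exact mem_nbr.2 h1
  · rintro ⟨a, b⟩ h ⟨a', b'⟩ h' heq
    simp only [Finset.mem_filter, Finset.mem_univ, true_and] at h h'
    simp only at heq
    rw [heq, h.2, h'.2]
  · intro y hy
    exact ⟨(x, y), by simp [mem_nbr.1 hy, hx], rfl⟩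

/-- Of the 4n ordered edges, at most 2|F| are protected by F, and each of the two end conditions
excludes at most 5 vertices, hence 20 ordered edges. -/
theorem card_switchable_ge {E : Finset (Sym2 V)} (hE : E ∈ regularEdges V) (F : Finset (Sym2 V))
    (u v : V) : 4 * Fintype.card V ≤ (switchable E F u v).card + 2 * F.card + 40 := by
  have hT : ∀ u, (insert u (nbr E u)).card ≤ 5 := fun u =>
    (Finset.card_insert_le _ _).trans (by rw [(mem_regularEdges.1 hE).2 u])
  have h0 := card_darts hE Finset.univ
  have h1 : (Finset.univ.filter fun p : V × V => s(p.1, p.2) ∈ F).card ≤ 2 * F.card := by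
    refine Finset.card_le_mul_card_image_of_maps_to (f := fun p : V × V => s(p.1, p.2))
      (fun p hp => (Finset.mem_filter.1 hp).2) 2 fun e _ => ?_
    induction e using Sym2.ind with
    | _ a b =>
      refine (Finset.card_le_card (t := {(a, b), (b, a)}) ?_).trans Finset.card_le_two
      rintro ⟨x, y⟩ h
      have := (Finset.mem_filter.1 h).2
      simp only [Sym2.eq_iff] at this
      simpa using this
  have h2 := card_darts hE (insert u (nbr E u))
  have h3 : (Finset.univ.filter fun p : V × V =>
      s(p.1, p.2) ∈ E ∧ p.2 ∈ insert v (nbr E v)).card = (insert v (nbr E v)).card * 4 := by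
    rw [← card_darts hE]
    refine Finset.card_bij (fun p _ => p.swap) ?_ (fun _ _ _ _ h => Prod.swap_injective h) ?_
    · rintro ⟨a, b⟩ h
      simp only [Finset.mem_filter, Finset.mem_univ, true_and, Prod.swap_prod_mk] at h ⊢
      rw [Sym2.eq_swap]; exact h
    · rintro ⟨a, b⟩ h
      refine ⟨(b, a), ?_, rfl⟩
      simp only [Finset.mem_filter, Finset.mem_univ, true_and] at h ⊢
      rw [Sym2.eq_swap]; exact h
  have hcover : (Finset.univ.filter fun p : V × V => s(p.1, p.2) ∈ E ∧ p.1 ∈ Finset.univ) ⊆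
      switchable E F u v ∪ ((Finset.univ.filter fun p : V × V => s(p.1, p.2) ∈ F) ∪
        ((Finset.univ.filter fun p : V × V => s(p.1, p.2) ∈ E ∧ p.1 ∈ insert u (nbr E u)) ∪
          (Finset.univ.filter fun p : V × V => s(p.1, p.2) ∈ E ∧ p.2 ∈ insert v (nbr E v)))) := by
    intro p hp
    have hpE := (Finset.mem_filter.1 hp).2.1
    simp only [switchable, Finset.mem_union, Finset.mem_filter, Finset.mem_univ, true_and]
    tauto
  have h4 := Finset.card_le_card hcover
  have h5 := h4.trans (Finset.card_union_le _ _)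
  have h6 := Finset.card_union_le (Finset.univ.filter fun p : V × V => s(p.1, p.2) ∈ F)
    ((Finset.univ.filter fun p : V × V => s(p.1, p.2) ∈ E ∧ p.1 ∈ insert u (nbr E u)) ∪
          (Finset.univ.filter fun p : V × V => s(p.1, p.2) ∈ E ∧ p.2 ∈ insert v (nbr E v)))
  have h7 := Finset.card_union_le
    (Finset.univ.filter fun p : V × V => s(p.1, p.2) ∈ E ∧ p.1 ∈ insert u (nbr E u))
    (Finset.univ.filter fun p : V × V => s(p.1, p.2) ∈ E ∧ p.2 ∈ insert v (nbr E v))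
  have h8 := hT u
  have h9 := hT v
  rw [Finset.card_univ] at h0
  omega

/-- The facts about a switch that are used below. -/
theorem switch_spec {E F : Finset (Sym2 V)} {u v : V} (hE : E ∈ containing (insert s(u, v) F))
    (he : s(u, v) ∉ F) {p : V × V} (hp : p ∈ switchable E F u v) :
    switch E u v p ∈ containing F ∧ p ∈ nbr (switch E u v p) u ×ˢ nbr (switch E u v p) v ∧
      E = insert s(u, v) (insert s(p.1, p.2)
        (((switch E u v p).erase s(u, p.1)).erase s(v, p.2))) := by
  obtain ⟨x, y⟩ := p
  obtain ⟨hreg, hsub⟩ := mem_containing.1 hE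
  obtain ⟨hdiag, hcard⟩ := mem_regularEdges.1 hreg
  have huvE : s(u, v) ∈ E := hsub (Finset.mem_insert_self _ _)
  simp only [switchable, Finset.mem_filter, Finset.mem_univ, true_and, Finset.mem_insert,
    mem_nbr, not_or] at hp
  obtain ⟨hxyE, hxyF, ⟨hxu, huxE⟩, hyv, hvyE⟩ := hp
  have huv : u ≠ v := by
    have := hdiag _ huvE; simpa using this
  have hxy : x ≠ y := by
    have := hdiag _ hxyE; simpa using this
  replace hxu : x ≠ u := hxu
  replace hyv : y ≠ v := hyv
  have hxv : x ≠ v := by rintro rfl; exact huxE huvE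
  have hyu : y ≠ u := by rintro rfl; exact hvyE (by rwa [Sym2.eq_swap])
  have he12 : s(x, y) ≠ s(u, v) := by rw [Ne, Sym2.eq_iff]; tauto
  have hf12 : s(u, x) ≠ s(v, y) := by rw [Ne, Sym2.eq_iff]; tauto
  set E₀ := (E.erase s(u, v)).erase s(x, y) with hE₀
  have hE₀E : E₀ ⊆ E := (Finset.erase_subset _ _).trans (Finset.erase_subset _ _)
  have hf1 : s(u, x) ∉ insert s(v, y) E₀ := by
    rw [Finset.mem_insert, not_or]; exact ⟨hf12, fun h => huxE (hE₀E h)⟩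
  have hf2 : s(v, y) ∉ E₀ := fun h => hvyE (hE₀E h)
  have he2 : s(x, y) ∉ E₀ := Finset.notMem_erase _ _
  have he1 : s(u, v) ∉ insert s(x, y) E₀ := by
    rw [Finset.mem_insert, not_or]
    exact ⟨he12.symm, fun h => Finset.notMem_erase _ _ (Finset.mem_of_mem_erase h)⟩
  have hEeq : E = insert s(u, v) (insert s(x, y) E₀) := by
    rw [hE₀, Finset.insert_erase (Finset.mem_erase.2 ⟨he12, hxyE⟩), Finset.insert_erase huvE]
  have hsw : switch E u v (x, y) = insert s(u, x) (insert s(v, y) E₀) := rfl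
  refine ⟨mem_containing.2 ⟨mem_regularEdges.2 ⟨?_, ?_⟩, ?_⟩, ?_, ?_⟩
  · intro e h
    rw [hsw, Finset.mem_insert, Finset.mem_insert] at h
    rcases h with rfl | rfl | h
    · simpa using hxu.symm
    · simpa using hyv.symm
    · exact hdiag e (hE₀E h)
  · intro z
    rw [← hcard z, card_nbr, card_nbr, Finset.card_filter, Finset.card_filter, hsw,
      Finset.sum_insert hf1, Finset.sum_insert hf2]
    conv_rhs => rw [hEeq, Finset.sum_insert he1, Finset.sum_insert he2]
    simp only [Sym2.mem_iff]
    have key : ∀ a b : V, a ≠ b → (if z = a ∨ z = b then 1 else 0 : ℕ) =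
        (if z = a then 1 else 0) + (if z = b then 1 else 0) := by
      intro a b hab
      by_cases h1 : z = a
      · subst h1; simp [hab]
      · simp [h1]
    rw [key u x hxu.symm, key v y hyv.symm, key u v huv, key x y hxy]
    ring
  · intro e h
    rw [hsw]
    refine Finset.mem_insert_of_mem (Finset.mem_insert_of_mem ?_)
    rw [hE₀, Finset.mem_erase, Finset.mem_erase]
    refine ⟨?_, ?_, hsub (Finset.mem_insert_of_mem h)⟩
    · rintro rfl; exact hxyF h
    · rintro rfl; exact he h
  · rw [Finset.mem_product, mem_nbr, mem_nbr, hsw]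
    exact ⟨Finset.mem_insert_self _ _, Finset.mem_insert_of_mem (Finset.mem_insert_self _ _)⟩
  · rw [hsw]
    simp only
    rw [Finset.erase_insert hf1, Finset.erase_insert hf2, ← hEeq]

/-- Double counting of switchings: at least 2n of them remove e = uv from a given graph, and a
resulting graph arises at most 16 times, since x is one of the 4 neighbours of u and y one of the 4
of v. -/
theorem card_containing_insert_le {F : Finset (Sym2 V)} {e : Sym2 V} (he : e ∉ F)
    (hF : F.card + 20 ≤ Fintype.card V) :
    (containing (insert e F)).card * Fintype.card V ≤ 8 * (containing F).card := by
  induction e using Sym2.ind with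
  | _ u v =>
    set P : Finset (Σ _ : Finset (Sym2 V), V × V) :=
      (containing (insert s(u, v) F)).sigma fun E => switchable E F u v with hP
    set Q : Finset (Σ _ : Finset (Sym2 V), V × V) :=
      (containing F).sigma fun E => nbr E u ×ˢ nbr E v with hQ
    have h1 : P.card ≤ Q.card := by
      refine Finset.card_le_card_of_injOn (fun a => ⟨switch a.1 u v a.2, a.2⟩) ?_ ?_
      · rintro ⟨E, p⟩ h
        obtain ⟨hE, hp⟩ := Finset.mem_sigma.1 (Finset.mem_coe.1 h)
        obtain ⟨h2, h3, -⟩ := switch_spec hE he hp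
        exact Finset.mem_coe.2 (Finset.mem_sigma.2 ⟨h2, h3⟩)
      · rintro ⟨E, p⟩ h ⟨E', p'⟩ h' heq
        obtain ⟨hE, hp⟩ := Finset.mem_sigma.1 (Finset.mem_coe.1 h)
        obtain ⟨hE', hp'⟩ := Finset.mem_sigma.1 (Finset.mem_coe.1 h')
        simp only [Sigma.mk.injEq, heq_eq_eq] at heq hE hp hE' hp'
        obtain ⟨heq1, rfl⟩ := heq
        have h2 := (switch_spec hE he hp).2.2
        have h3 := (switch_spec hE' he hp').2.2
        rw [heq1, ← h3] at h2
        rw [h2]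
    have h2 : Q.card = (containing F).card * 16 := by
      rw [hQ, Finset.card_sigma]
      refine Finset.sum_const_nat fun E hE => ?_
      have := (mem_regularEdges.1 (mem_containing.1 hE).1).2
      rw [Finset.card_product, this, this]
    have h3 : (containing (insert s(u, v) F)).card * (2 * Fintype.card V) ≤ P.card := by
      rw [hP, Finset.card_sigma, ← smul_eq_mul]
      refine Finset.card_nsmul_le_sum _ _ _ fun E hE => ?_
      have := card_switchable_ge (mem_containing.1 hE).1 F u v
      omega
    rw [h2] at h1
    nlinarith

theorem card_containing_le (F : Finset (Sym2 V)) (hF : F.card + 20 ≤ Fintype.card V) :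
    (containing F).card * Fintype.card V ^ F.card ≤ 8 ^ F.card * (regularEdges V).card := by
  induction F using Finset.induction_on with
  | empty => simp [containing]
  | insert e F he ih =>
    rw [Finset.card_insert_of_notMem he] at hF ⊢
    have h1 := ih (by omega)
    have h2 := card_containing_insert_le he (by omega)
    calc (containing (insert e F)).card * Fintype.card V ^ (F.card + 1)
        = ((containing (insert e F)).card * Fintype.card V) * Fintype.card V ^ F.card := by ring
      _ ≤ (8 * (containing F).card) * Fintype.card V ^ F.card := Nat.mul_le_mul_right _ h2
      _ = 8 * ((containing F).card * Fintype.card V ^ F.card) := by ring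
      _ ≤ 8 * (8 ^ F.card * (regularEdges V).card) := Nat.mul_le_mul_left _ h1
      _ = _ := by ring

/-- The 4-regular edge sets with a set of `s` vertices that spans at least `f` edges. -/
noncomputable def dense (V : Type*) [Fintype V] (s f : ℕ) : Finset (Finset (Sym2 V)) :=
  {E ∈ regularEdges V | ∃ B : Finset V, B.card = s ∧ f ≤ (inside E B).card}

/-- Union bound over the vertex set and over f of its at most s² pairs. -/
theorem card_dense_le {s f : ℕ} (hs : 1 ≤ s) (hf : f + 20 ≤ Fintype.card V) :
    (dense V s f).card * Fintype.card V ^ f ≤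
      (Fintype.card V).choose s * (s ^ 2).choose f * (8 ^ f * (regularEdges V).card) := by
  have hcover : dense V s f ⊆ (Finset.powersetCard s (Finset.univ : Finset V)).biUnion fun B =>
      (Finset.powersetCard f B.sym2).biUnion containing := by
    intro E hE
    obtain ⟨hE, B, hB, hfB⟩ := (Finset.mem_filter.1 hE)
    obtain ⟨F, hFB, hF⟩ := Finset.exists_subset_card_eq hfB
    refine Finset.mem_biUnion.2 ⟨B, Finset.mem_powersetCard.2 ⟨Finset.subset_univ _, hB⟩, ?_⟩
    refine Finset.mem_biUnion.2 ⟨F, Finset.mem_powersetCard.2 ⟨?_, hF⟩, ?_⟩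
    · intro e he
      exact Finset.mem_sym2_iff.2 (mem_inside.1 (hFB he)).2
    · exact mem_containing.2 ⟨hE, fun e he => (mem_inside.1 (hFB he)).1⟩
  have h1 : ∀ B ∈ Finset.powersetCard s (Finset.univ : Finset V),
      ((Finset.powersetCard f B.sym2).biUnion containing).card * Fintype.card V ^ f ≤
        (s ^ 2).choose f * (8 ^ f * (regularEdges V).card) := by
    intro B hB
    have hBs := (Finset.mem_powersetCard.1 hB).2
    have h2 : B.sym2.card ≤ s ^ 2 := by
      rw [Finset.card_sym2, hBs, Nat.choose_two_right, Nat.add_sub_cancel]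
      refine Nat.div_le_of_le_mul ?_
      nlinarith
    calc ((Finset.powersetCard f B.sym2).biUnion containing).card * Fintype.card V ^ f
        ≤ (∑ F ∈ Finset.powersetCard f B.sym2, (containing F).card) * Fintype.card V ^ f :=
          Nat.mul_le_mul_right _ Finset.card_biUnion_le
      _ = ∑ F ∈ Finset.powersetCard f B.sym2, (containing F).card * Fintype.card V ^ f :=
          Finset.sum_mul _ _ _
      _ ≤ ∑ F ∈ Finset.powersetCard f B.sym2, 8 ^ f * (regularEdges V).card := by
          refine Finset.sum_le_sum fun F hF => ?_
          have h3 := (Finset.mem_powersetCard.1 hF).2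
          have h4 := card_containing_le F (by omega)
          rwa [h3] at h4
      _ = B.sym2.card.choose f * (8 ^ f * (regularEdges V).card) := by
          rw [Finset.sum_const, Finset.card_powersetCard, smul_eq_mul]
      _ ≤ _ := Nat.mul_le_mul_right _ (Nat.choose_le_choose f h2)
  calc (dense V s f).card * Fintype.card V ^ f
      ≤ (∑ B ∈ Finset.powersetCard s (Finset.univ : Finset V),
          ((Finset.powersetCard f B.sym2).biUnion containing).card) * Fintype.card V ^ f :=
        Nat.mul_le_mul_right _ ((Finset.card_le_card hcover).trans Finset.card_biUnion_le)
    _ = ∑ B ∈ Finset.powersetCard s (Finset.univ : Finset V),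
          ((Finset.powersetCard f B.sym2).biUnion containing).card * Fintype.card V ^ f :=
        Finset.sum_mul _ _ _
    _ ≤ ∑ B ∈ Finset.powersetCard s (Finset.univ : Finset V),
          (s ^ 2).choose f * (8 ^ f * (regularEdges V).card) := Finset.sum_le_sum h1
    _ = _ := by
        rw [Finset.sum_const, Finset.card_powersetCard, Finset.card_univ, smul_eq_mul, mul_assoc]

/-- One term of the exponential series gives s^s / s! ≤ e^s, and e < 3. -/
theorem choose_le_exp_pow (n s : ℕ) (hs : 1 ≤ s) : (n.choose s : ℝ) ≤ (3 * n / s) ^ s := by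
  have hs0 : (0 : ℝ) < s := by exact_mod_cast hs
  have h1 : (n.choose s : ℝ) ≤ n ^ s / (s.factorial : ℝ) := Nat.choose_le_pow_div s n
  have h2 := Real.pow_div_factorial_le_exp (s : ℝ) hs0.le s
  have h3 : Real.exp s ≤ 3 ^ s := by
    rw [← mul_one (s : ℝ), Real.exp_nat_mul]
    exact pow_le_pow_left₀ (Real.exp_pos 1).le (by linarith [Real.exp_one_lt_d9]) s
  have hfac : (0 : ℝ) < s.factorial := by exact_mod_cast s.factorial_pos
  refine h1.trans ?_
  rw [div_pow, mul_pow, div_le_div_iff₀ hfac (by positivity)]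
  rw [div_le_iff₀ hfac] at h2
  calc (n : ℝ) ^ s * (s : ℝ) ^ s ≤ n ^ s * (3 ^ s * s.factorial) := by
        refine mul_le_mul_of_nonneg_left (h2.trans ?_) (by positivity)
        gcongr
    _ = _ := by ring

/-- In a random 4-regular graph, it is exponentially unlikely that some set of `s` vertices spans
more than `(1 + δ) s` edges, when `s` is a small proportion of the vertices. -/
theorem card_dense_le_mul {δ : ℝ} (hδ : 0 < δ) {s f : ℕ} (hs : 1 ≤ s)
    (hf : f + 20 ≤ Fintype.card V) (hfs : (1 + δ) * s ≤ f)
    (hsn : (24 * s / Fintype.card V : ℝ) ^ δ ≤ 1 / 144) (hsn1 : 24 * s ≤ Fintype.card V) :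
    ((dense V s f).card : ℝ) ≤ (1 / 2) ^ s * (regularEdges V).card := by
  set n := Fintype.card V with hn
  have hn0 : (0 : ℝ) < n := by exact_mod_cast (by omega : 0 < n)
  have hs0 : (0 : ℝ) < s := by exact_mod_cast hs
  have hsf : s ≤ f := by
    have : (s : ℝ) ≤ f := by nlinarith
    exact_mod_cast this
  have hf0 : (0 : ℝ) < f := by exact_mod_cast (by omega : 0 < f)
  have h1 : ((dense V s f).card : ℝ) * (n : ℝ) ^ f ≤
      (n.choose s : ℝ) * ((s ^ 2).choose f : ℝ) * (8 ^ f * (regularEdges V).card) := by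
    exact_mod_cast card_dense_le hs hf
  have h2 := choose_le_exp_pow n s hs
  have h3 : ((s ^ 2).choose f : ℝ) ≤ (3 * s) ^ f := by
    refine (choose_le_exp_pow (s ^ 2) f (by omega)).trans (pow_le_pow_left₀ (by positivity) ?_ f)
    rw [div_le_iff₀ hf0]
    push_cast
    have : (s : ℝ) ≤ f := by exact_mod_cast hsf
    nlinarith
  set ρ : ℝ := 24 * s / n with hρ
  have hρ0 : 0 < ρ := by positivity
  have hρ1 : ρ ≤ 1 := by
    rw [hρ, div_le_one hn0]; exact_mod_cast hsn1
  -- Choosing the vertices costs 72/ρ per vertex, and 1 + δ edges per vertex repay ρ^(1+δ). The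
  -- surplus ρ^δ ≤ 1/144 leaves 1/2.
  have h4 : (3 * n / s : ℝ) ^ s * ρ ^ f ≤ (1 / 2) ^ s := by
    have h5 : ρ ^ f ≤ (ρ * ρ ^ δ) ^ s := by
      calc ρ ^ f = ρ ^ (f : ℝ) := (Real.rpow_natCast _ _).symm
        _ ≤ ρ ^ ((1 + δ) * s) := Real.rpow_le_rpow_of_exponent_ge hρ0 hρ1 hfs
        _ = (ρ * ρ ^ δ) ^ s := by
            rw [Real.rpow_mul hρ0.le, Real.rpow_natCast, Real.rpow_add hρ0, Real.rpow_one]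
    calc (3 * n / s : ℝ) ^ s * ρ ^ f ≤ (3 * n / s) ^ s * (ρ * ρ ^ δ) ^ s := by gcongr
      _ = (72 * ρ ^ δ) ^ s := by
          rw [← mul_pow]; congr 1; rw [← mul_assoc]; congr 1; rw [hρ]; field_simp; norm_num
      _ ≤ (1 / 2) ^ s := by
          refine pow_le_pow_left₀ (by positivity) ?_ s
          linarith
  have hnf : (0 : ℝ) < (n : ℝ) ^ f := by positivity
  refine le_of_mul_le_mul_right (h1.trans ?_) hnf
  have h6 : (3 * s : ℝ) ^ f * 8 ^ f = ρ ^ f * n ^ f := by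
    rw [← mul_pow, ← mul_pow]; congr 1; rw [hρ]; field_simp; norm_num
  calc (n.choose s : ℝ) * ((s ^ 2).choose f : ℝ) * (8 ^ f * (regularEdges V).card)
      ≤ (3 * n / s) ^ s * (3 * s) ^ f * (8 ^ f * (regularEdges V).card) := by gcongr
    _ = (3 * n / s) ^ s * ((3 * s) ^ f * 8 ^ f) * (regularEdges V).card := by ring
    _ = ((3 * n / s) ^ s * ρ ^ f) * (regularEdges V).card * n ^ f := by rw [h6]; ring
    _ ≤ (1 / 2) ^ s * (regularEdges V).card * n ^ f := by gcongr

end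

/-! ### From edge sets back to graphs, and statements about almost all graphs. -/

theorem nbr_edges {V : Type*} [Fintype V] (G : SimpleGraph V) (v : V) :
    (nbr (edges G) v).card = deg G v := by
  rw [card_nbr, card_filter_mem_edges]

theorem mem_fourRegularGraphs {n : ℕ} {G : SimpleGraph (Fin n)} :
    G ∈ fourRegularGraphs n ↔ ∀ v, deg G v = 4 := by
  have h : ∀ v, deg G v = G.degree v := by
    intro v
    rw [deg, ← SimpleGraph.card_neighborFinset_eq_degree]
    congr 1; ext u; simp
  simp only [h]
  rfl

/-- Counting 4-regular graphs through their edge sets. -/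
theorem ncard_fourRegularGraphs (n : ℕ) (p : Finset (Sym2 (Fin n)) → Prop) :
    {G ∈ fourRegularGraphs n | p (edges G)}.ncard =
      ((regularEdges (Fin n)).filter fun E => p E).card := by
  rw [← Set.ncard_coe_finset]
  refine Set.ncard_congr (fun G _ => edges G) ?_ ?_ ?_
  · rintro G ⟨hG, hp⟩
    refine Finset.mem_coe.2 (Finset.mem_filter.2 ⟨mem_regularEdges.2 ⟨?_, ?_⟩, hp⟩)
    · intro e he; exact G.not_isDiag_of_mem_edgeSet (mem_edges.1 he)
    · intro v; rw [nbr_edges, mem_fourRegularGraphs.1 hG v]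
  · intro G G' _ _ h
    rw [← SimpleGraph.edgeSet_inj]
    ext e
    rw [← mem_edges, h, mem_edges]
  · intro E hE
    obtain ⟨hE, hp⟩ := Finset.mem_filter.1 (Finset.mem_coe.1 hE)
    obtain ⟨h1, h2⟩ := mem_regularEdges.1 hE
    have h3 : edges (SimpleGraph.fromEdgeSet (E : Set (Sym2 (Fin n)))) = E := by
      ext e
      rw [mem_edges, SimpleGraph.edgeSet_fromEdgeSet]
      simp only [Set.mem_sdiff, Finset.mem_coe, Sym2.mem_diagSet]
      exact ⟨fun h => h.1, fun h => ⟨h, h1 e h⟩⟩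
    refine ⟨SimpleGraph.fromEdgeSet E, ⟨mem_fourRegularGraphs.2 fun v => ?_, by rwa [h3]⟩, h3⟩
    rw [← nbr_edges, h3, h2 v]

/-- The circulant graph with steps ±1 and ±2. It makes the denominators of the probabilities
nonzero. -/
theorem exists_fourRegular_zmod {n : ℕ} [NeZero n] (hn : 5 ≤ n) :
    ∃ G : SimpleGraph (ZMod n), ∀ v, deg G v = 4 := by
  have hk : ∀ k : ℕ, 0 < k → k < 5 → (k : ZMod n) ≠ 0 := by
    intro k h0 h5 h
    rw [ZMod.natCast_eq_zero_iff] at h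
    have := Nat.le_of_dvd h0 h
    omega
  have h1 : (1 : ZMod n) ≠ 0 := by simpa using hk 1 (by norm_num) (by norm_num)
  have h2 : (2 : ZMod n) ≠ 0 := by simpa using hk 2 (by norm_num) (by norm_num)
  have h3 : (3 : ZMod n) ≠ 0 := by simpa using hk 3 (by norm_num) (by norm_num)
  have h4 : (4 : ZMod n) ≠ 0 := by simpa using hk 4 (by norm_num) (by norm_num)
  set T : Finset (ZMod n) := {1, -1, 2, -2} with hT
  have hTcard : T.card = 4 := by
    have e1 : (1 : ZMod n) ≠ -1 := fun h => h2 (by linear_combination h)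
    have e2 : (1 : ZMod n) ≠ 2 := fun h => h1 (by linear_combination -h)
    have e3 : (1 : ZMod n) ≠ -2 := fun h => h3 (by linear_combination h)
    have e4 : (-1 : ZMod n) ≠ 2 := fun h => h3 (by linear_combination -h)
    have e5 : (-1 : ZMod n) ≠ -2 := fun h => h1 (by linear_combination h)
    have e6 : (2 : ZMod n) ≠ -2 := fun h => h4 (by linear_combination h)
    rw [hT, Finset.card_insert_of_notMem (by simp [e1, e2, e3]),
      Finset.card_insert_of_notMem (by
        simp only [Finset.mem_insert, Finset.mem_singleton, not_or]
        exact ⟨e4, e5⟩), Finset.card_pair e6]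
  have hTneg : ∀ x, x ∈ T → -x ∈ T := by
    intro x hx
    simp only [hT, Finset.mem_insert, Finset.mem_singleton] at hx ⊢
    rcases hx with rfl | rfl | rfl | rfl <;> simp
  have hT0 : (0 : ZMod n) ∉ T := by
    simp only [hT, Finset.mem_insert, Finset.mem_singleton, not_or]
    exact ⟨h1.symm, fun h => h1 (by linear_combination h), h2.symm,
      fun h => h2 (by linear_combination h)⟩
  refine ⟨{ Adj := fun x y => y - x ∈ T, symm := ⟨fun x y h => ?_⟩, loopless := ⟨fun x h => ?_⟩ },
    fun v => ?_⟩
  · rw [← neg_sub]; exact hTneg _ h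
  · exact hT0 (by simpa using h)
  · rw [deg, ← hTcard]
    refine Finset.card_bij (fun u _ => u - v) ?_ ?_ ?_
    · intro u hu; simpa using hu
    · intro u _ u' _ h; simpa using h
    · intro t ht; exact ⟨v + t, by simpa using ht, by ring⟩

theorem regularEdges_nonempty {n : ℕ} (hn : 5 ≤ n) : (regularEdges (Fin n)).Nonempty := by
  obtain ⟨m, rfl⟩ : ∃ m, n = m + 1 := ⟨n - 1, by omega⟩
  obtain ⟨G, hG⟩ := exists_fourRegular_zmod (n := m + 1) hn
  have h : ∃ G : SimpleGraph (Fin (m + 1)), ∀ v, deg G v = 4 := ⟨G, hG⟩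
  obtain ⟨G, hG⟩ := h
  refine ⟨edges G, mem_regularEdges.2 ⟨?_, fun v => by rw [nbr_edges, hG v]⟩⟩
  intro e he
  exact G.not_isDiag_of_mem_edgeSet (mem_edges.1 he)

/-- A property of the graphs in which all sets of `⌊β n⌋` vertices span few edges holds for
almost all 4-regular graphs. -/
theorem exists_almostAllFourRegular {δ : ℝ} (hδ : 0 < δ) (hδ1 : δ ≤ 1) :
    ∃ β : ℝ, 0 < β ∧ β ≤ 1 / 100 ∧ ∀ A : ∀ n : ℕ, SimpleGraph (Fin n) → Prop,
      (∀ᶠ n in atTop, ∀ G ∈ fourRegularGraphs n,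
        (∀ B : Finset (Fin n), B.card = ⌊β * n⌋₊ →
          ((inside (edges G) B).card : ℝ) ≤ (1 + δ) * ⌊β * n⌋₊) → A n G) →
      AlmostAllFourRegular A := by
  -- Chosen so that s ≤ βn gives (24 s / n)^δ ≤ 1/144.
  set β : ℝ := (1 / 144) ^ (1 / δ) / 24 with hβ
  have hpow0 : (0 : ℝ) < (1 / 144) ^ (1 / δ) := Real.rpow_pos_of_pos (by norm_num) _
  have hpow1 : (1 / 144 : ℝ) ^ (1 / δ) ≤ 1 / 144 := by
    have h1 : 1 ≤ 1 / δ := by rw [le_div_iff₀ hδ]; linarith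
    have := Real.rpow_le_rpow_of_exponent_ge (x := (1 / 144 : ℝ)) (by norm_num) (by norm_num) h1
    rwa [Real.rpow_one] at this
  have hβ0 : 0 < β := by positivity
  have hβ1 : β ≤ 1 / 100 := by rw [hβ, div_le_iff₀ (by norm_num)]; linarith
  refine ⟨β, hβ0, hβ1, fun A hA => ?_⟩
  have hfloor : Tendsto (fun n : ℕ => ⌊β * n⌋₊) atTop atTop :=
    tendsto_nat_floor_atTop.comp (tendsto_natCast_atTop_atTop.const_mul_atTop hβ0)
  have hlim : Tendsto (fun n : ℕ => 1 - (1 / 2 : ℝ) ^ ⌊β * n⌋₊) atTop (𝓝 1) := by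
    have h1 : Tendsto (fun n : ℕ => (1 / 2 : ℝ) ^ ⌊β * n⌋₊) atTop (𝓝 0) :=
      (tendsto_pow_atTop_nhds_zero_of_lt_one (by norm_num) (by norm_num)).comp hfloor
    simpa using h1.const_sub 1
  refine tendsto_of_tendsto_of_tendsto_of_le_of_le' hlim tendsto_const_nhds ?_ ?_
  · filter_upwards [hA, eventually_ge_atTop 100, hfloor.eventually_ge_atTop 1] with n hAn hn hs
    set s := ⌊β * n⌋₊ with hsdef
    set f := ⌈(1 + δ) * s⌉₊ with hf
    have hn0 : (0 : ℝ) < n := by exact_mod_cast (by omega : 0 < n)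
    have hs0 : (1 : ℝ) ≤ s := by exact_mod_cast hs
    have hsβ : (s : ℝ) ≤ β * n := Nat.floor_le (by positivity)
    have hsn : (24 * s / Fintype.card (Fin n) : ℝ) ^ δ ≤ 1 / 144 := by
      have h1 : (24 * s / Fintype.card (Fin n) : ℝ) ≤ (1 / 144) ^ (1 / δ) := by
        rw [Fintype.card_fin, div_le_iff₀ hn0]
        have : (1 / 144 : ℝ) ^ (1 / δ) = 24 * β := by rw [hβ]; ring
        rw [this]; linarith
      calc (24 * s / Fintype.card (Fin n) : ℝ) ^ δ ≤ ((1 / 144) ^ (1 / δ)) ^ δ :=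
            Real.rpow_le_rpow (by positivity) h1 hδ.le
        _ = 1 / 144 := by
            rw [← Real.rpow_mul (by norm_num), one_div_mul_cancel hδ.ne', Real.rpow_one]
    have hsn100 : (s : ℝ) * 100 ≤ n := by nlinarith
    have hsn100' : s * 100 ≤ n := by exact_mod_cast hsn100
    have hfn : f ≤ 2 * s := by
      rw [hf, Nat.ceil_le]; push_cast; nlinarith
    have hdense := card_dense_le_mul (V := Fin n) hδ hs (f := f)
      (by rw [Fintype.card_fin]; omega) (Nat.le_ceil _) hsn (by rw [Fintype.card_fin]; omega)
    have htot : (fourRegularGraphs n).ncard = (regularEdges (Fin n)).card := by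
      have := ncard_fourRegularGraphs n fun _ => True
      simpa using this
    have hpos : (0 : ℝ) < (regularEdges (Fin n)).card := by
      exact_mod_cast (regularEdges_nonempty (by omega)).card_pos
    have hgood : (regularEdges (Fin n)).card ≤
        {G ∈ fourRegularGraphs n | A n G}.ncard + (dense (Fin n) s f).card := by
      have h1 : {G ∈ fourRegularGraphs n | edges G ∉ dense (Fin n) s f}.ncard ≤
          {G ∈ fourRegularGraphs n | A n G}.ncard := by
        refine Set.ncard_le_ncard ?_ (Set.toFinite _)
        rintro G ⟨hG, hd⟩
        refine ⟨hG, hAn G hG fun B hB => ?_⟩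
        have h2 : edges G ∈ regularEdges (Fin n) := by
          refine mem_regularEdges.2 ⟨?_, fun v => by rw [nbr_edges, mem_fourRegularGraphs.1 hG v]⟩
          intro e he
          exact G.not_isDiag_of_mem_edgeSet (mem_edges.1 he)
        have h3 : (inside (edges G) B).card < f := by
          by_contra! hle
          exact hd (Finset.mem_filter.2 ⟨h2, B, hB, hle⟩)
        exact (Nat.lt_ceil.1 h3).le
      have hcount : {G ∈ fourRegularGraphs n | edges G ∉ dense (Fin n) s f}.ncard =
          ((regularEdges (Fin n)).filter fun E => E ∉ dense (Fin n) s f).card := by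
        rw [ncard_fourRegularGraphs n fun E => E ∉ dense (Fin n) s f]
        congr!
      rw [hcount] at h1
      have h4 : (regularEdges (Fin n)).card =
          ((regularEdges (Fin n)).filter fun E => E ∈ dense (Fin n) s f).card +
          ((regularEdges (Fin n)).filter fun E => E ∉ dense (Fin n) s f).card :=
        (Finset.card_filter_add_card_filter_not _).symm
      have h5 : ((regularEdges (Fin n)).filter fun E => E ∈ dense (Fin n) s f).card ≤
          (dense (Fin n) s f).card :=
        Finset.card_le_card fun E hE => (Finset.mem_filter.1 hE).2
      omega
    have hgood' : ((regularEdges (Fin n)).card : ℝ) ≤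
        {G ∈ fourRegularGraphs n | A n G}.ncard + (dense (Fin n) s f).card := by
      exact_mod_cast hgood
    rw [htot, le_div_iff₀ hpos]
    linarith
  · filter_upwards with n
    refine div_le_one_of_le₀ ?_ (by positivity)
    have : {G ∈ fourRegularGraphs n | A n G}.ncard ≤ (fourRegularGraphs n).ncard :=
      Set.ncard_le_ncard (fun G hG => hG.1) (Set.toFinite _)
    exact_mod_cast this

end Potts

/-! ## Lower bounds for mixing times -/

theorem sum_mul_sub_le_two_tvDist {Ω : Type*} [Fintype Ω] (φ ψ : Ω → ℝ) {s : Ω → ℝ}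
    (hs : ∀ x, |s x| ≤ 1) : ∑ x, φ x * s x - ∑ x, ψ x * s x ≤ 2 * tvDist φ ψ := by
  rw [tvDist, ← mul_assoc, mul_one_div_cancel two_ne_zero, one_mul, ← Finset.sum_sub_distrib]
  refine Finset.sum_le_sum fun x _ => ?_
  rw [← sub_mul]
  refine (le_abs_self _).trans ?_
  rw [abs_mul]
  exact mul_le_of_le_one_right (abs_nonneg _) (hs x)

theorem exists_tvDist_le_of_mixingTime_le {Ω : Type*} [Fintype Ω] [DecidableEq Ω]
    {P : Matrix Ω Ω ℝ} {π : Ω → ℝ} {ε : ℝ} {M : ℕ} (h : mixingTime P π ε ≤ M) (x : Ω) :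
    ∃ t ≤ M, tvDist ((P ^ t) x) π ≤ ε := by
  by_contra! hcon
  have h1 : mixingTimeFrom P π x ε ≤ M := (le_iSup (mixingTimeFrom P π · ε) x).trans h
  have h2 : ((M + 1 : ℕ) : ℕ∞) ≤ mixingTimeFrom P π x ε := by
    refine le_iInf₂ fun t ht => ?_
    have : M < t := by
      by_contra! hle
      exact absurd ht (not_le.2 (hcon t hle))
    exact_mod_cast this
  have h3 := h2.trans h1
  have h4 : M + 1 ≤ M := by exact_mod_cast h3
  omega

namespace SpinSystem

open Classical

variable {V S : Type*} [Fintype V] [Fintype S] {w : (V → S) → ℝ} {ι : Type*} [Fintype ι]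

theorem condExp_mono (hw : ∀ σ, 0 < w σ) (B : Finset V) {f g : (V → S) → ℝ}
    (h : ∀ σ, f σ ≤ g σ) (σ : V → S) : condExp w B f σ ≤ condExp w B g σ := by
  refine div_le_div_of_nonneg_right ?_ (sum_cls_pos hw B σ).le
  exact Finset.sum_le_sum fun τ _ => mul_le_mul_of_nonneg_left (h τ) (hw τ).le

theorem blockAvg_mono (hw : ∀ σ, 0 < w σ) (B : ι → Finset V) {f g : (V → S) → ℝ}
    (h : ∀ σ, f σ ≤ g σ) (σ : V → S) : blockAvg w B f σ ≤ blockAvg w B g σ := by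
  refine div_le_div_of_nonneg_right ?_ (by positivity)
  exact Finset.sum_le_sum fun j _ => condExp_mono hw (B j) h σ

theorem blockAvg_iterate_bounds [Nonempty ι] (hw : ∀ σ, 0 < w σ) (B : ι → Finset V) {a b : ℝ}
    {f : (V → S) → ℝ} (ha : ∀ σ, a ≤ f σ) (hb : ∀ σ, f σ ≤ b) (t : ℕ) :
    ∀ σ, a ≤ (blockAvg w B)^[t] f σ ∧ (blockAvg w B)^[t] f σ ≤ b := by
  induction t with
  | zero => exact fun σ => ⟨ha σ, hb σ⟩
  | succ t ih =>
    intro σ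
    rw [Function.iterate_succ_apply']
    have h1 := blockAvg_mono hw B (fun σ => (ih σ).1) σ
    have h2 := blockAvg_mono hw B (fun σ => (ih σ).2) σ
    rw [blockAvg_const hw] at h1 h2
    exact ⟨h1, h2⟩

/-- The bottleneck bound: the mass that leaves `A` in `t` steps of the single-site dynamics is at
most `t` times the mass of the boundary `D` of `A`. -/
theorem sum_escape_le [Nonempty V] (hw : ∀ σ, 0 < w σ) {A D : Finset (V → S)}
    (hD : D ⊆ A) (hstep : ∀ σ ∈ A, σ ∉ D → ∀ v c, Function.update σ v c ∈ A)
    {g : (V → S) → ℝ} (hg0 : ∀ σ ∈ A, g σ = 0) (hg1 : ∀ σ, σ ∉ A → g σ = 1) (t : ℕ) :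
    ∑ σ ∈ A, w σ * (blockAvg w fun v : V => {v})^[t] g σ ≤ t * ∑ σ ∈ D, w σ := by
  set T := blockAvg w fun v : V => ({v} : Finset V) with hT
  have hg01 : ∀ σ, 0 ≤ g σ ∧ g σ ≤ 1 := fun σ => by
    by_cases h : σ ∈ A
    · simp [hg0 σ h]
    · simp [hg1 σ h]
  -- By self-adjointness ⟨k, T g⟩ = ⟨T k, g⟩. This is the one-step flow out of A, and it is carried
  -- by D because T g vanishes on A \ D.
  set k : (V → S) → ℝ := fun τ => if τ ∈ A then 1 else 0 with hk
  have hgb : ∀ t σ, 0 ≤ T^[t] g σ ∧ T^[t] g σ ≤ 1 :=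
    blockAvg_iterate_bounds hw _ (fun σ => (hg01 σ).1) (fun σ => (hg01 σ).2)
  have hkb : ∀ σ, 0 ≤ T k σ ∧ T k σ ≤ 1 :=
    blockAvg_iterate_bounds hw _ (fun σ => by simp only [hk]; split_ifs <;> norm_num)
      (fun σ => by simp only [hk]; split_ifs <;> norm_num) 1
  have hsum : ∀ f : (V → S) → ℝ, ∑ σ ∈ A, w σ * f σ = ∑ σ, w σ * (k σ * f σ) := by
    intro f
    simp only [hk, ite_mul, one_mul, zero_mul, mul_ite, mul_zero]
    rw [← Finset.sum_filter, Finset.filter_mem_eq_inter, Finset.univ_inter]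
  have hflow : ∑ σ, w σ * (T k σ * g σ) ≤ ∑ σ ∈ D, w σ := by
    rw [hT, sum_blockAvg_mul, ← hT, ← hsum]
    have h0 : ∀ σ ∈ A, σ ∉ D → T g σ = 0 := by
      intro σ hσ hσD
      have : ∀ v, condExp w {v} g σ = 0 := by
        intro v
        rw [condExp, sum_cls_singleton]
        have : ∑ c, w (Function.update σ v c) * g (Function.update σ v c) = 0 :=
          Finset.sum_eq_zero fun c _ => by rw [hg0 _ (hstep σ hσ hσD v c), mul_zero]
        rw [this, zero_div]
      simp [hT, blockAvg, this]
    rw [← Finset.sum_subset hD (fun σ h1 h2 => by rw [h0 σ h1 h2, mul_zero])]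
    refine Finset.sum_le_sum fun σ _ => ?_
    exact mul_le_of_le_one_right (hw σ).le (hgb 1 σ).2
  induction t with
  | zero =>
    simp only [Function.iterate_zero, id_eq, Nat.cast_zero, zero_mul]
    refine (Finset.sum_eq_zero fun σ hσ => ?_).le
    rw [hg0 σ hσ, mul_zero]
  | succ t ih =>
    rw [hsum, Function.iterate_succ_apply', hT, ← sum_blockAvg_mul, ← hT]
    -- Pointwise: on A use T k ≤ 1, and off A use T^t g ≤ 1 = g. One further step thus adds at most
    -- one more flow.
    have h1 : ∀ σ, w σ * (T k σ * T^[t] g σ) ≤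
        w σ * (k σ * T^[t] g σ) + w σ * (T k σ * g σ) := by
      intro σ
      rw [← mul_add]
      refine mul_le_mul_of_nonneg_left ?_ (hw σ).le
      have h2 := hgb t σ
      have h3 := hkb σ
      by_cases hσ : σ ∈ A
      · simp only [hk, hg0 σ hσ, hσ, if_true, mul_zero, add_zero, one_mul]
        exact mul_le_of_le_one_left h2.1 h3.2
      · simp only [hk, hg1 σ hσ, hσ, if_false, mul_one, zero_mul, zero_add]
        exact mul_le_of_le_one_right h3.1 h2.2
    refine (Finset.sum_le_sum fun σ _ => h1 σ).trans ?_
    rw [Finset.sum_add_distrib, ← hsum]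
    push_cast
    linarith

end SpinSystem

/-! ### Bottlenecks and slow mixing of the Glauber dynamics. -/

namespace Potts

open Classical SpinSystem

section

variable {V : Type*} [Fintype V] {q : ℕ}

theorem mean_blockAvg [Nonempty V] {w : (V → Fin q) → ℝ} (hw : ∀ σ, 0 < w σ)
    (f : (V → Fin q) → ℝ) : mean w (blockAvg w (fun v : V => {v}) f) = mean w f := by
  rw [mean, mean, sum_blockAvg hw]

/-- The operator keeps test functions within [-1, 1] and preserves their Gibbs mean. The mixing time
from a state is a first hitting time, so monotonicity is needed to compare all starting states at
one common time M. -/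
theorem tvDist_glauber_antitone [Nonempty V] [DecidableEq (V → Fin q)] (G : SimpleGraph V)
    {lam : ℝ} (hlam : 0 < lam) (x : V → Fin q) :
    Antitone fun t => tvDist ((glauber G lam q ^ t) x) (gibbs G lam q) := by
  refine antitone_nat_of_succ_le fun t => tvDist_le fun s hs => ?_
  have hw : ∀ σ, 0 < weight G lam q σ := weight_pos hlam G
  set T := blockAvg (weight G lam q) fun v : V => ({v} : Finset V) with hT
  have hTs : ∀ σ, |T s σ| ≤ 1 := fun σ => abs_le.2
    (blockAvg_iterate_bounds hw _ (fun σ => (abs_le.1 (hs σ)).1) (fun σ => (abs_le.1 (hs σ)).2) 1 σ)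
  have h := sum_mul_sub_le_two_tvDist ((glauber G lam q ^ t) x) (gibbs G lam q) hTs
  have h1 : ∀ (t : ℕ) (f : (V → Fin q) → ℝ),
      ∑ y, (glauber G lam q ^ t) x y * f y = T^[t] f x := by
    intro t f
    rw [hT, ← glauber_pow_mulVec G hlam]; rfl
  rw [h1, sum_gibbs_mul] at h ⊢
  rw [mean_blockAvg hw] at h
  rwa [Function.iterate_succ_apply]

/-- A bottleneck forces slow mixing. -/
theorem half_sub_le_of_glauberMixingTime_le [Nonempty V] (G : SimpleGraph V) {lam : ℝ}
    (hlam : 0 < lam) {A D : Finset (V → Fin q)} (hA : A.Nonempty) (hD : D ⊆ A)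
    (hstep : ∀ σ ∈ A, σ ∉ D → ∀ v c, Function.update σ v c ∈ A)
    (hhalf : ∑ σ ∈ A, weight G lam q σ ≤ ∑ σ ∈ Aᶜ, weight G lam q σ) {φ : ℝ}
    (hφ : ∑ σ ∈ D, weight G lam q σ ≤ φ * ∑ σ ∈ A, weight G lam q σ) {ε : ℝ} {M : ℕ}
    (hM : glauberMixingTime G lam q ε ≤ M) : 1 / 2 - ε ≤ M * φ := by
  have hw : ∀ σ, 0 < weight G lam q σ := weight_pos hlam G
  set T := blockAvg (weight G lam q) fun v : V => ({v} : Finset V) with hT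
  set g : (V → Fin q) → ℝ := fun τ => if τ ∈ A then 0 else 1 with hg
  have hAw : 0 < ∑ σ ∈ A, weight G lam q σ := Finset.sum_pos (fun σ _ => hw σ) hA
  have htot : ∑ σ, weight G lam q σ =
      ∑ σ ∈ A, weight G lam q σ + ∑ σ ∈ Aᶜ, weight G lam q σ :=
    (Finset.sum_add_sum_compl A _).symm
  have hmean : 1 / 2 ≤ mean (weight G lam q) g := by
    have h1 : ∑ σ, weight G lam q σ * g σ = ∑ σ ∈ Aᶜ, weight G lam q σ := by
      rw [← Finset.sum_add_sum_compl A]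
      rw [Finset.sum_eq_zero (s := A) fun σ hσ => by simp [hg, hσ], zero_add]
      refine Finset.sum_congr rfl fun σ hσ => ?_
      simp [hg, Finset.mem_compl.1 hσ]
    rw [mean, h1, htot, le_div_iff₀ (by linarith)]
    linarith
  have hmix : ∀ x, tvDist ((glauber G lam q ^ M) x) (gibbs G lam q) ≤ ε := by
    intro x
    obtain ⟨t, ht, htv⟩ := exists_tvDist_le_of_mixingTime_le hM x
    exact (tvDist_glauber_antitone G hlam x ht).trans htv
  -- The test function 1 - 2g, rather than g, has range ±1; it avoids losing a factor 2 against
  -- total variation.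
  have hlow : ∀ x, 1 / 2 - ε ≤ T^[M] g x := by
    intro x
    have h1 := sum_mul_sub_le_two_tvDist ((glauber G lam q ^ M) x) (gibbs G lam q)
      (s := fun σ => 1 - 2 * g σ) (fun σ => by
        simp only [hg]; split_ifs <;> norm_num)
    have h2 : ∀ f : (V → Fin q) → ℝ,
        ∑ y, (glauber G lam q ^ M) x y * f y = T^[M] f x := by
      intro f
      rw [hT, ← glauber_pow_mulVec G hlam]; rfl
    have h3 : ∑ y, (glauber G lam q ^ M) x y = 1 := by
      have := h2 fun _ => 1
      have hc : ∀ t, T^[t] (fun _ => (1 : ℝ)) = fun _ => 1 := by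
        intro t
        induction t with
        | zero => rfl
        | succ t ih => rw [Function.iterate_succ_apply', ih, hT, blockAvg_const hw]
      rw [hc] at this
      simpa using this
    have h4 : ∑ y, gibbs G lam q y = 1 := by
      have h5 := sum_gibbs_mul G lam fun _ : V → Fin q => (1 : ℝ)
      simp only [mul_one, mean] at h5
      rw [h5, div_self]
      linarith
    have h6 : ∀ ν : (V → Fin q) → ℝ, ∑ y, ν y = 1 →
        ∑ y, ν y * (1 - 2 * g y) = 1 - 2 * ∑ y, ν y * g y := by
      intro ν hν
      have h7 : ∑ y, ν y * (1 - 2 * g y) = ∑ y, ν y - 2 * ∑ y, ν y * g y := by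
        rw [Finset.mul_sum, ← Finset.sum_sub_distrib]
        exact Finset.sum_congr rfl fun y _ => by ring
      rw [h7, hν]
    rw [h6 _ h3, h6 _ h4, h2, sum_gibbs_mul] at h1
    have := hmix x
    linarith
  have h1 := sum_escape_le hw hD hstep (g := g) (fun σ hσ => by simp [hg, hσ])
    (fun σ hσ => by simp [hg, hσ]) M
  have h2 : (1 / 2 - ε) * ∑ σ ∈ A, weight G lam q σ ≤
      (M * φ) * ∑ σ ∈ A, weight G lam q σ := by
    calc (1 / 2 - ε) * ∑ σ ∈ A, weight G lam q σ
        = ∑ σ ∈ A, weight G lam q σ * (1 / 2 - ε) := by rw [← Finset.sum_mul, mul_comm]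
      _ ≤ ∑ σ ∈ A, weight G lam q σ * T^[M] g σ :=
          Finset.sum_le_sum fun σ _ => mul_le_mul_of_nonneg_left (hlow σ) (hw σ).le
      _ ≤ M * ∑ σ ∈ D, weight G lam q σ := h1
      _ ≤ M * (φ * ∑ σ ∈ A, weight G lam q σ) := by gcongr
      _ = _ := by ring
  exact le_of_mul_le_mul_right h2 hAw

/-! ## Slow mixing for random regular graphs -/

/-- The vertices whose colour is not `c₀`. -/
noncomputable def minority (c₀ : Fin q) (σ : V → Fin q) : Finset V := {v | σ v ≠ c₀}

theorem mem_minority {c₀ : Fin q} {σ : V → Fin q} {v : V} :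
    v ∈ minority c₀ σ ↔ σ v ≠ c₀ := by simp [minority]

theorem two_mul_card_edges {G : SimpleGraph V} (hG : ∀ v, deg G v = 4) :
    (edges G).card = 2 * Fintype.card V := by
  have h1 := sum_deg G Finset.univ
  have h2 : inside (edges G) Finset.univ = edges G := by
    ext e; simp [mem_inside]
  have h3 : touching (edges G) Finset.univ = edges G :=
    Finset.Subset.antisymm (Finset.filter_subset _ _)
      (by conv_lhs => rw [← h2]
          exact inside_subset_touching _)
  simp only [hG, h2, h3, Finset.sum_const, Finset.card_univ, smul_eq_mul] at h1
  omega

/-- The crude density 4 is enough here: it makes each inner monochromatic edge cost a quarter of a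
colour choice. -/
theorem sparse_inside {G : SimpleGraph V} (hG : ∀ v, deg G v = 4) (B : Finset V) :
    Sparse (inside (edges G) B) B 4 := by
  have hdeg : ∀ v, deg G v ≤ 4 := fun v => (hG v).le
  constructor
  · intro C _ hne
    have h1 := card_inside_le_three_mul hdeg hne
    have h2 : inside (inside (edges G) B) C ⊆ inside (edges G) C := fun e he =>
      mem_inside.2 ⟨(mem_inside.1 (mem_inside.1 he).1).1, (mem_inside.1 he).2⟩
    have h3 := Finset.card_le_card h2
    have h4 := hne.card_pos
    have h5 : (inside (inside (edges G) B) C).card + 4 ≤ 4 * C.card := by omega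
    have h6 : ((inside (inside (edges G) B) C).card : ℝ) + 4 ≤ 4 * C.card := by
      exact_mod_cast h5
    linarith
  · intro C _
    have h1 := card_touching_add_inside_le hdeg C
    have h2 : isolating (inside (edges G) B) B C ⊆ touching (edges G) C := fun e he =>
      mem_touching.2 ⟨(mem_inside.1 (mem_isolating.1 he).1).1, (mem_isolating.1 he).2.1⟩
    have h3 := Finset.card_le_card h2
    have h5 : (isolating (inside (edges G) B) B C).card ≤ 4 * C.card := by omega
    exact_mod_cast h5

/-- Edges leaving the minority are bichromatic, and 4|B| minus the inner edges is the number of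
edges meeting it. -/
theorem monoEdges_le_of_minority {G : SimpleGraph V} (hG : ∀ v, deg G v = 4) {c₀ : Fin q}
    (σ : V → Fin q) :
    monoEdges G σ + 4 * (minority c₀ σ).card ≤ 2 * Fintype.card V +
      (inside (edges G) (minority c₀ σ)).card +
        (mono (inside (edges G) (minority c₀ σ)) σ).card := by
  set B := minority c₀ σ with hB
  have h1 := sum_deg G B
  simp only [hG, Finset.sum_const, smul_eq_mul] at h1
  have h2 : mono (touching (edges G) B) σ ⊆ mono (inside (edges G) B) σ := by
    intro e he
    obtain ⟨he1, he2⟩ := mem_mono.1 he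
    obtain ⟨he3, v, hv, hve⟩ := mem_touching.1 he1
    refine mem_mono.2 ⟨mem_inside.2 ⟨he3, fun u hu => ?_⟩, he2⟩
    obtain ⟨y, rfl⟩ := hve
    rw [hB, mem_minority] at hv ⊢
    have h3 : σ v = σ y := by simpa using he2
    rcases Sym2.mem_iff.1 hu with rfl | rfl
    · exact hv
    · rwa [← h3]
  have h3 := Finset.card_le_card h2
  have h4 : outer G B σ + (touching (edges G) B).card ≤ (edges G).card := by
    rw [outer, ← Finset.card_filter_add_card_filter_not (s := edges G) (fun e => ∃ v ∈ B, v ∈ e),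
      add_comm]
    exact Nat.add_le_add_left (Finset.card_le_card (mono_subset _ _)) _
  have h5 := two_mul_card_edges hG
  have h6 := monoEdges_eq_add G B σ
  omega

/-- The weight of the configurations with a given set of vertices of minority colours. -/
theorem sum_weight_minority_le {G : SimpleGraph V} (hG : ∀ v, deg G v = 4) {c₀ : Fin q}
    {lam η δ : ℝ} (hlam : 1 ≤ lam) (hη : 0 < η) (hδ : δ = η / 4) (hη1 : η < 1)
    (hq1 : 1 ≤ q) (hq : (q : ℝ) ≤ lam ^ (8 / 3 - η)) {B : Finset V}
    (hB : ((inside (edges G) B).card : ℝ) ≤ (1 + δ) * B.card) :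
    ∑ σ with minority c₀ σ = B, weight G lam q σ ≤
      4 ^ Fintype.card V * lam ^ (2 * Fintype.card V - η / 4 * B.card : ℝ) := by
  have hlam0 : 0 < lam := by linarith
  set n := Fintype.card V with hn
  set I := inside (edges G) B with hI
  have hterm : ∀ F ∈ I.powerset,
      ∑ σ ∈ Finset.univ.filter (fun σ => minority c₀ σ = B) with mono I σ = F, weight G lam q σ ≤
        lam ^ (2 * n - η / 4 * B.card : ℝ) := by
    intro F hF
    have hFI := Finset.mem_powerset.1 hF
    obtain ⟨k, hk, hFk, hcount⟩ := exists_card_mono_le ((sparse_inside hG B).mono hFI)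
      (fun e he => (mem_touching.1 (inside_subset_touching B (hFI he))).2)
      (fun _ : V => c₀)
    have h1 : ∀ σ ∈ (Finset.univ.filter fun σ => minority c₀ σ = B).filter
        (fun σ => mono I σ = F), weight G lam q σ ≤
          lam ^ (2 * n - 4 * B.card + I.card + F.card : ℝ) := by
      intro σ hσ
      obtain ⟨h2, h3⟩ := Finset.mem_filter.1 hσ
      have h4 := monoEdges_le_of_minority hG (c₀ := c₀) σ
      rw [(Finset.mem_filter.1 h2).2, ← hI, h3] at h4
      have h5 : (monoEdges G σ : ℝ) + 4 * B.card ≤ 2 * n + I.card + F.card := by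
        exact_mod_cast h4
      rw [weight, ← Real.rpow_natCast]
      exact Real.rpow_le_rpow_of_exponent_le hlam (by linarith)
    have h2 : ((Finset.univ.filter fun σ => minority c₀ σ = B).filter
        (fun σ => mono I σ = F)).card ≤ q ^ k := by
      refine le_trans (Finset.card_le_card ?_) (hcount.trans (by simp))
      intro σ hσ
      obtain ⟨h2, h3⟩ := Finset.mem_filter.1 hσ
      simp only [Finset.mem_filter]
      refine ⟨mem_cls.2 fun v hv => ?_, fun e he => ?_⟩
      · rw [← (Finset.mem_filter.1 h2).2, mem_minority, not_not] at hv
        exact hv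
      · rw [← h3] at he
        exact (mem_mono.1 he).2
    have hqk : (q : ℝ) ^ k ≤ lam ^ ((8 / 3 - η) * (B.card - F.card / 4)) := by
      calc (q : ℝ) ^ k ≤ (lam ^ (8 / 3 - η)) ^ k := pow_le_pow_left₀ (by positivity) hq k
        _ = lam ^ ((8 / 3 - η) * k) := by rw [Real.rpow_mul hlam0.le, Real.rpow_natCast]
        _ ≤ _ := Real.rpow_le_rpow_of_exponent_le hlam
            (mul_le_mul_of_nonneg_left (by linarith) (by linarith))
    calc _ ≤ ((Finset.univ.filter fun σ => minority c₀ σ = B).filter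
          (fun σ => mono I σ = F)).card • lam ^ (2 * n - 4 * B.card + I.card + F.card : ℝ) :=
          Finset.sum_le_card_nsmul _ _ _ h1
      _ ≤ (q : ℝ) ^ k * lam ^ (2 * n - 4 * B.card + I.card + F.card : ℝ) := by
          rw [nsmul_eq_mul]
          refine mul_le_mul_of_nonneg_right ?_ (by positivity)
          exact_mod_cast h2
      _ ≤ lam ^ ((8 / 3 - η) * (B.card - F.card / 4)) *
            lam ^ (2 * n - 4 * B.card + I.card + F.card : ℝ) := by gcongr
      _ = lam ^ ((8 / 3 - η) * (B.card - F.card / 4) +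
            (2 * n - 4 * B.card + I.card + F.card) : ℝ) := (Real.rpow_add hlam0 _ _).symm
      _ ≤ _ := by
          refine Real.rpow_le_rpow_of_exponent_le hlam ?_
          have hFc : (F.card : ℝ) ≤ (1 + δ) * B.card := by
            have : (F.card : ℝ) ≤ I.card := by exact_mod_cast Finset.card_le_card hFI
            linarith
          have hb : (0 : ℝ) ≤ B.card := by positivity
          -- The coefficient of |F| is positive, so |F| = (1 + δ)|B| is the worst case. There
          -- (3/4)(8/3) = 2 cancels the deficit 4 - 2, which is the origin of 8/3; what remains is
          -- -3η/4 + 2δ = -η/4 per vertex, up to a nonpositive term.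
          have h3 : (F.card : ℝ) * (1 - (8 / 3 - η) / 4) ≤
              (1 + δ) * B.card * (1 - (8 / 3 - η) / 4) :=
            mul_le_mul_of_nonneg_right hFc (by linarith)
          have h4 : 0 ≤ δ * (8 / 3 - η) / 4 * B.card := by
            rw [hδ]
            have : 0 ≤ 8 / 3 - η := by linarith
            positivity
          rw [hδ] at hB h3 h4
          nlinarith
  rw [← Finset.sum_fiberwise_of_maps_to (t := I.powerset) (g := fun σ => mono I σ)
    (fun σ _ => Finset.mem_powerset.2 (mono_subset _ _))]
  refine (Finset.sum_le_card_nsmul _ _ _ hterm).trans ?_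
  rw [nsmul_eq_mul, Finset.card_powerset]
  refine mul_le_mul_of_nonneg_right ?_ (by positivity)
  have h1 : I.card ≤ 2 * n := by
    rw [← two_mul_card_edges hG]
    exact Finset.card_le_card fun e he => (mem_inside.1 he).1
  have h2 : 2 ^ I.card ≤ 4 ^ n := by
    calc 2 ^ I.card ≤ 2 ^ (2 * n) := Nat.pow_le_pow_right (by norm_num) h1
      _ = 4 ^ n := by rw [pow_mul]; norm_num
  exact_mod_cast h2

/-- There are at most 2^n choices of the minority set, on top of the 4^n choices of its
monochromatic edges. -/
theorem sum_weight_card_minority_le {G : SimpleGraph V} (hG : ∀ v, deg G v = 4) {c₀ : Fin q}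
    {lam η δ : ℝ} (hlam : 1 ≤ lam) (hη : 0 < η) (hδ : δ = η / 4) (hη1 : η < 1)
    (hq1 : 1 ≤ q) (hq : (q : ℝ) ≤ lam ^ (8 / 3 - η)) {s : ℕ}
    (hB : ∀ B : Finset V, B.card = s → ((inside (edges G) B).card : ℝ) ≤ (1 + δ) * s) :
    ∑ σ with (minority c₀ σ).card = s, weight G lam q σ ≤
      8 ^ Fintype.card V * lam ^ (2 * Fintype.card V - η / 4 * s : ℝ) := by
  rw [← Finset.sum_fiberwise_of_maps_to (t := Finset.powersetCard s (Finset.univ : Finset V))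
    (g := fun σ => minority c₀ σ) (fun σ hσ => Finset.mem_powersetCard.2
      ⟨Finset.subset_univ _, (Finset.mem_filter.1 hσ).2⟩)]
  have h1 : ∀ B ∈ Finset.powersetCard s (Finset.univ : Finset V),
      ∑ σ ∈ Finset.univ.filter (fun σ => (minority c₀ σ).card = s) with minority c₀ σ = B,
        weight G lam q σ ≤
          4 ^ Fintype.card V * lam ^ (2 * Fintype.card V - η / 4 * s : ℝ) := by
    intro B hBs
    have hBc := (Finset.mem_powersetCard.1 hBs).2
    have h2 := sum_weight_minority_le hG (c₀ := c₀) hlam hη hδ hη1 hq1 hq (B := B)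
      (by rw [hBc]; exact hB B hBc)
    rw [hBc] at h2
    refine le_trans (Finset.sum_le_sum_of_subset_of_nonneg ?_
      fun σ _ _ => (weight_pos (by linarith) G σ).le) h2
    intro σ hσ
    exact Finset.mem_filter.2 ⟨Finset.mem_univ _, (Finset.mem_filter.1 hσ).2⟩
  refine (Finset.sum_le_card_nsmul _ _ _ h1).trans ?_
  rw [nsmul_eq_mul, Finset.card_powersetCard, Finset.card_univ, ← mul_assoc]
  refine mul_le_mul_of_nonneg_right ?_ (Real.rpow_nonneg (by linarith) _)
  have h3 : (Fintype.card V).choose s ≤ 2 ^ Fintype.card V := Nat.choose_le_two_pow _ _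
  have h4 : ((Fintype.card V).choose s : ℝ) ≤ 2 ^ Fintype.card V := by exact_mod_cast h3
  calc ((Fintype.card V).choose s : ℝ) * 4 ^ Fintype.card V
      ≤ 2 ^ Fintype.card V * 4 ^ Fintype.card V := by gcongr
    _ = 8 ^ Fintype.card V := by rw [← mul_pow]; norm_num

theorem weight_swap (G : SimpleGraph V) (lam : ℝ) (π : Equiv.Perm (Fin q)) (σ : V → Fin q) :
    weight G lam q (fun v => π (σ v)) = weight G lam q σ := by
  rw [weight, weight, monoEdges_eq_card, monoEdges_eq_card]
  congr 2
  ext e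
  rw [mem_mono, mem_mono]
  refine and_congr_right fun _ => ?_
  induction e using Sym2.ind with
  | _ x y => simp

theorem card_minority_update_le (c₀ : Fin q) (σ : V → Fin q) (v : V) (c : Fin q) :
    (minority c₀ (Function.update σ v c)).card ≤ (minority c₀ σ).card + 1 := by
  refine le_trans (Finset.card_le_card (t := insert v (minority c₀ σ)) ?_)
    (Finset.card_insert_le _ _)
  intro u hu
  by_cases huv : u = v
  · subst huv; exact Finset.mem_insert_self _ _
  · rw [mem_minority, Function.update_of_ne huv] at hu
    exact Finset.mem_insert_of_mem (mem_minority.2 hu)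

/-- The bottleneck at the configurations in which exactly `s` vertices do not have the majority
colour. -/
theorem half_sub_le_of_sparse [Nonempty V] {G : SimpleGraph V} (hG : ∀ v, deg G v = 4)
    {lam η δ : ℝ} (hlam : 1 ≤ lam) (hη : 0 < η) (hδ : δ = η / 4) (hη1 : η < 1)
    (hq2 : 2 ≤ q) (hq : (q : ℝ) ≤ lam ^ (8 / 3 - η)) {s : ℕ} (hs : 2 * s < Fintype.card V)
    (hB : ∀ B : Finset V, B.card = s → ((inside (edges G) B).card : ℝ) ≤ (1 + δ) * s)
    {ε : ℝ} {M : ℕ} (hM : glauberMixingTime G lam q ε ≤ M) :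
    1 / 2 - ε ≤ M * (8 ^ Fintype.card V * lam ^ (-(η / 4 * s))) := by
  have hlam0 : 0 < lam := by linarith
  set c₀ : Fin q := ⟨0, by omega⟩ with hc₀
  set c₁ : Fin q := ⟨1, by omega⟩ with hc₁
  have hc : c₀ ≠ c₁ := by simp [hc₀, hc₁]
  have hw : ∀ σ, 0 < weight G lam q σ := weight_pos hlam0 G
  set A : Finset (V → Fin q) := {σ | (minority c₀ σ).card ≤ s} with hA
  set D : Finset (V → Fin q) := {σ | (minority c₀ σ).card = s} with hD
  have hconst : (fun _ => c₀) ∈ A := by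
    simp [hA, minority]
  refine half_sub_le_of_glauberMixingTime_le G hlam0 (A := A) (D := D) ⟨_, hconst⟩ ?_ ?_ ?_ ?_ hM
  · intro σ hσ
    exact Finset.mem_filter.2 ⟨Finset.mem_univ _, (Finset.mem_filter.1 hσ).2.le⟩
  · intro σ hσ hσD v c
    have h1 := (Finset.mem_filter.1 hσ).2
    have h2 : (minority c₀ σ).card ≠ s := fun h =>
      hσD (Finset.mem_filter.2 ⟨Finset.mem_univ _, h⟩)
    have h3 := card_minority_update_le c₀ σ v c
    exact Finset.mem_filter.2 ⟨Finset.mem_univ _, by omega⟩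
  · have hswap : ∀ σ ∈ A, (fun v => Equiv.swap c₀ c₁ (σ v)) ∈ Aᶜ := by
      intro σ hσ
      have h1 := (Finset.mem_filter.1 hσ).2
      rw [Finset.mem_compl, hA, Finset.mem_filter, not_and]
      intro _ h2
      have h3 : (Finset.univ : Finset V) ⊆
          minority c₀ σ ∪ minority c₀ (fun v => Equiv.swap c₀ c₁ (σ v)) := by
        intro v _
        rw [Finset.mem_union, mem_minority, mem_minority]
        by_cases h : σ v = c₀
        · right; rw [h, Equiv.swap_apply_left]; exact hc.symm
        · left; exact h
      have h4 := (Finset.card_le_card h3).trans (Finset.card_union_le _ _)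
      rw [Finset.card_univ] at h4
      omega
    have hinj : ∀ σ ∈ A, ∀ τ ∈ A, (fun v => Equiv.swap c₀ c₁ (σ v)) =
        (fun v => Equiv.swap c₀ c₁ (τ v)) → σ = τ := by
      intro σ _ τ _ h
      ext v
      rw [(Equiv.swap c₀ c₁).injective (congrFun h v)]
    calc ∑ σ ∈ A, weight G lam q σ
        = ∑ σ ∈ A, weight G lam q (fun v => Equiv.swap c₀ c₁ (σ v)) :=
          Finset.sum_congr rfl fun σ _ => (weight_swap G lam _ σ).symm
      _ = ∑ τ ∈ A.image fun σ v => Equiv.swap c₀ c₁ (σ v), weight G lam q τ :=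
          (Finset.sum_image hinj).symm
      _ ≤ ∑ τ ∈ Aᶜ, weight G lam q τ := by
          refine Finset.sum_le_sum_of_subset_of_nonneg ?_ fun τ _ _ => (hw τ).le
          intro τ hτ
          obtain ⟨σ, hσ, rfl⟩ := Finset.mem_image.1 hτ
          exact hswap σ hσ
  · have h1 := sum_weight_card_minority_le hG (c₀ := c₀) hlam hη hδ hη1 (by omega) hq hB
    -- The constant colouring alone, with all 2n edges monochromatic, already outweighs the
    -- bottleneck layer.
    have h2 : lam ^ (2 * Fintype.card V : ℝ) ≤ ∑ σ ∈ A, weight G lam q σ := by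
      have h3 : weight G lam q (fun _ => c₀) = lam ^ (2 * Fintype.card V : ℝ) := by
        rw [weight, monoEdges_eq_card]
        have : mono (edges G) (fun _ : V => c₀) = edges G := by
          ext e
          rw [mem_mono]
          refine and_iff_left ?_
          induction e using Sym2.ind with
          | _ x y => simp
        rw [this, two_mul_card_edges hG, ← Real.rpow_natCast]
        push_cast; rfl
      rw [← h3]
      exact Finset.single_le_sum (f := weight G lam q) (fun σ _ => (hw σ).le) hconst
    calc ∑ σ ∈ D, weight G lam q σ
        ≤ 8 ^ Fintype.card V * lam ^ (2 * Fintype.card V - η / 4 * s : ℝ) := h1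
      _ = 8 ^ Fintype.card V * lam ^ (-(η / 4 * s)) * lam ^ (2 * Fintype.card V : ℝ) := by
          rw [mul_assoc, ← Real.rpow_add hlam0]; congr 2; ring
      _ ≤ _ := by gcongr

end

theorem mixesSlowlyAlmostAllFourRegular_of_lt {η : ℝ} (hη : 0 < η) (hη1 : η < 1) :
    ∃ c : ℝ, 0 < c ∧ ∀ (q : ℕ) (lam : ℝ), 1 < lam → 2 ≤ q →
      (q : ℝ) < c * lam ^ (8 / 3 - η) → MixesSlowlyAlmostAllFourRegular lam q := by
  obtain ⟨β, hβ0, hβ1, halmost⟩ := exists_almostAllFourRegular (δ := η / 4) (by linarith)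
    (by linarith)
  -- With s ≥ βn/2 this gives λ^(-ηs/4) ≤ 16^(-n), which beats the entropy factor 8^n.
  set lam₀ : ℝ := 16 ^ (8 / (η * β)) with hlam₀
  have hlam₀1 : 1 ≤ lam₀ := Real.one_le_rpow (by norm_num) (by positivity)
  have hx : 0 < 8 / 3 - η := by linarith
  have hx0 : 0 < lam₀ ^ (8 / 3 - η) := by positivity
  -- The second term turns q ≥ 2 into λ > λ₀, so small activities are excluded by the constant
  -- rather than treated.
  refine ⟨min 1 (2 / lam₀ ^ (8 / 3 - η)), by positivity, fun q lam hlam hq2 hq => ?_⟩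
  have hlam0 : 0 < lam := by linarith
  have hlx : 0 < lam ^ (8 / 3 - η) := by positivity
  have hq' : (q : ℝ) ≤ lam ^ (8 / 3 - η) := by
    refine hq.le.trans ?_
    calc _ ≤ 1 * lam ^ (8 / 3 - η) := by gcongr; exact min_le_left _ _
      _ = _ := one_mul _
  have hbig : lam₀ ≤ lam := by
    have h1 : (2 : ℝ) < 2 / lam₀ ^ (8 / 3 - η) * lam ^ (8 / 3 - η) := by
      have h2 : (2 : ℝ) ≤ q := by exact_mod_cast hq2
      refine h2.trans_lt (hq.trans_le ?_)
      gcongr; exact min_le_right _ _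
    rw [div_mul_eq_mul_div, lt_div_iff₀ hx0] at h1
    have h3 : lam₀ ^ (8 / 3 - η) < lam ^ (8 / 3 - η) := by linarith
    exact ((Real.rpow_lt_rpow_iff (by linarith) hlam0.le hx).1 h3).le
  refine ⟨Real.log (3 / 2), Real.log_pos (by norm_num), halmost _ ?_⟩
  have hβn : Tendsto (fun n : ℕ => β * n) atTop atTop :=
    tendsto_natCast_atTop_atTop.const_mul_atTop hβ0
  filter_upwards [eventually_ge_atTop 7, hβn.eventually_ge_atTop 2] with n hn hβn2 G hG hB ε hε hε1
  have hexp : Real.exp (Real.log (3 / 2) * n) = (3 / 2) ^ n := by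
    rw [mul_comm, Real.exp_nat_mul, Real.exp_log (by norm_num)]
  rw [hexp]
  obtain hτ | ⟨M, hM⟩ : glauberMixingTime G lam q ε = ⊤ ∨
      ∃ M : ℕ, (M : ℕ∞) = glauberMixingTime G lam q ε := by
    rcases h : glauberMixingTime G lam q ε with _ | M
    · exact Or.inl rfl
    · exact Or.inr ⟨M, rfl⟩
  · rw [hτ]; simp
  · have hne : Nonempty (Fin n) := ⟨⟨0, by omega⟩⟩
    set s := ⌊β * n⌋₊ with hs
    have hn0 : (7 : ℝ) ≤ n := by exact_mod_cast hn
    have hsle : (s : ℝ) ≤ β * n := Nat.floor_le (by positivity)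
    have hsge : β * n / 2 ≤ s := by
      have := Nat.lt_floor_add_one (β * n)
      rw [← hs] at this
      linarith
    have h1 := half_sub_le_of_sparse (mem_fourRegularGraphs.1 hG) hlam.le hη rfl hη1 hq2 hq'
      (s := s) (by
        rw [Fintype.card_fin]
        have : (2 * s : ℝ) < n := by nlinarith
        exact_mod_cast this) hB hM.ge
    rw [Fintype.card_fin] at h1
    have h2 : lam ^ (-(η / 4 * s)) ≤ (1 / 16) ^ n := by
      calc lam ^ (-(η / 4 * s)) ≤ lam ^ (-(η * β / 8 * n)) :=
            Real.rpow_le_rpow_of_exponent_le hlam.le (by nlinarith)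
        _ ≤ lam₀ ^ (-(η * β / 8 * n)) :=
            Real.rpow_le_rpow_of_nonpos (by linarith) hbig (by
              have : 0 ≤ η * β / 8 * n := by positivity
              linarith)
        _ = (1 / 16) ^ n := by
            rw [hlam₀, ← Real.rpow_mul (by norm_num)]
            rw [show 8 / (η * β) * -(η * β / 8 * n) = -(n : ℝ) by field_simp,
              Real.rpow_neg (by norm_num), Real.rpow_natCast, one_div, inv_pow]
    have h3 : (8 : ℝ) ^ n * lam ^ (-(η / 4 * s)) ≤ (1 / 2) ^ n := by
      calc (8 : ℝ) ^ n * lam ^ (-(η / 4 * s)) ≤ 8 ^ n * (1 / 16) ^ n := by gcongr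
        _ = (1 / 2) ^ n := by rw [← mul_pow]; norm_num
    have h4 : (3 / 10 : ℝ) ≤ 1 / 2 - ε := by
      have h5 : 1 / (2 * Real.exp 1) ≤ 1 / 5 := by
        refine one_div_le_one_div_of_le (by norm_num) ?_
        linarith [Real.exp_one_gt_d9]
      linarith
    have h6 : (3 / 10 : ℝ) ≤ M * (1 / 2) ^ n :=
      h4.trans (h1.trans (mul_le_mul_of_nonneg_left h3 (by positivity)))
    have h7 : (3 / 2 : ℝ) ^ n ≤ M := by
      -- Lowering the rate from 2 to 3/2 absorbs the factor 3/10. Bernoulli's inequality gives this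
      -- from n = 7 on.
      have h8 : (10 / 3 : ℝ) ≤ (4 / 3) ^ n := by
        have := one_add_mul_le_pow (a := (1 / 3 : ℝ)) (by norm_num) n
        norm_num at this
        linarith
      have h9 : (3 / 2 : ℝ) ^ n * (10 / 3) ≤ 2 ^ n := by
        calc (3 / 2 : ℝ) ^ n * (10 / 3) ≤ (3 / 2) ^ n * (4 / 3) ^ n := by gcongr
          _ = 2 ^ n := by rw [← mul_pow]; norm_num
      have h10 : (3 / 10 : ℝ) * 2 ^ n ≤ M := by
        calc (3 / 10 : ℝ) * 2 ^ n ≤ M * (1 / 2) ^ n * 2 ^ n := by gcongr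
          _ = M := by rw [mul_assoc, ← mul_pow]; norm_num
      linarith
    rw [← hM]
    have h11 : ENNReal.ofReal ((3 / 2) ^ n) ≤ ENNReal.ofReal (M : ℝ) := ENNReal.ofReal_le_ofReal h7
    rw [ENNReal.ofReal_natCast] at h11
    simpa using h11

end Potts

/-- With η = 1/4 the two exponents differ by 1/6. The additive 2 leaves room to round up to an
integer q ≥ 2. -/
theorem Potts.eventually_rpow_gap {c d : ℝ} (hd : 0 < d) :
    ∀ᶠ lam : ℝ in atTop, c * lam ^ (2 + 1 / 4 : ℝ) + 2 < d * lam ^ (8 / 3 - 1 / 4 : ℝ) := by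
  have h1 : Tendsto (fun lam : ℝ => lam ^ (1 / 6 : ℝ)) atTop atTop :=
    tendsto_rpow_atTop (by norm_num)
  filter_upwards [h1.eventually_gt_atTop ((c + 2) / d), eventually_ge_atTop (1 : ℝ)] with lam h hlam
  have h2 : lam ^ (8 / 3 - 1 / 4 : ℝ) = lam ^ (2 + 1 / 4 : ℝ) * lam ^ (1 / 6 : ℝ) := by
    rw [← Real.rpow_add (by linarith)]; norm_num
  have h3 : 1 ≤ lam ^ (2 + 1 / 4 : ℝ) := Real.one_le_rpow hlam (by norm_num)
  rw [div_lt_iff₀ hd] at h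
  rw [h2]
  nlinarith

theorem theorem3 :
    -- the three bounds, with constants depending on `η` only
    (∀ η : ℝ, 0 < η → η < 1 →
      ∃ c₃ c₄ c₅ : ℝ, 0 < c₃ ∧ 0 < c₄ ∧ 0 < c₅ ∧
        ∀ (q : ℕ) (lam : ℝ), 1 ≤ q → 1 < lam →
          (c₃ * lam ^ (3 + η) < (q : ℝ) →
            Potts.MixesRapidly Potts.connectedMaxDegreeFour lam q) ∧
          (c₄ * lam ^ (2 + η) < (q : ℝ) →
            Potts.MixesRapidly Potts.toroidalGrids lam q) ∧
          (2 ≤ q → (q : ℝ) < c₅ * lam ^ (8 / 3 - η) →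
            Potts.MixesSlowlyAlmostAllFourRegular lam q)) ∧
    -- the separation for large activity
    (∃ lam₀ : ℝ, ∀ lam : ℝ, lam₀ ≤ lam →
      ∃ q : ℕ, 1 ≤ q ∧ Potts.MixesRapidly Potts.toroidalGrids lam q ∧
        Potts.MixesSlowlyAlmostAllFourRegular lam q) ∧
    -- the explicit bound for the toroidal grid
    (∀ (lam : ℝ) (L r q : ℕ) [NeZero L], 1 < lam → 1 ≤ r → r + 2 ≤ L →
      (2 : ℝ) ^ (r ^ 2 + 8 * r + 3) * (r : ℝ) ^ (2 * r ^ 2 + 4 * r + 1) *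
          lam ^ (2 + 2 / (r : ℝ)) ≤ (q : ℝ) →
      ∀ ε : ℝ, 0 < ε → ε ≤ 1 → ∀ n : ℝ, n = (L : ℝ) ^ 2 →
        (Potts.glauberMixingTime (Potts.torusGraph L) lam q ε : ENNReal) ≤
          ENNReal.ofReal (4 * (4 * lam ^ 8) ^ (r ^ 2 + 1) * n ^ 2 *
            Real.log (2 * Real.exp 1 * n) *
              (n * Real.log (4 * lam ^ 6) + Real.log ε⁻¹))) := by
  have hA : ∀ η : ℝ, 0 < η → η < 1 →
      ∃ c₃ c₄ c₅ : ℝ, 0 < c₃ ∧ 0 < c₄ ∧ 0 < c₅ ∧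
        ∀ (q : ℕ) (lam : ℝ), 1 ≤ q → 1 < lam →
          (c₃ * lam ^ (3 + η) < (q : ℝ) →
            Potts.MixesRapidly Potts.connectedMaxDegreeFour lam q) ∧
          (c₄ * lam ^ (2 + η) < (q : ℝ) →
            Potts.MixesRapidly Potts.toroidalGrids lam q) ∧
          (2 ≤ q → (q : ℝ) < c₅ * lam ^ (8 / 3 - η) →
            Potts.MixesSlowlyAlmostAllFourRegular lam q) := by
    intro η hη hη1
    obtain ⟨c₃, h3, H3⟩ := Potts.mixesRapidly_connectedMaxDegreeFour hη
    obtain ⟨c₄, h4, H4⟩ := Potts.mixesRapidly_toroidalGrids hη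
    obtain ⟨c₅, h5, H5⟩ := Potts.mixesSlowlyAlmostAllFourRegular_of_lt hη hη1
    exact ⟨c₃, c₄, c₅, h3, h4, h5, fun q lam hq hlam =>
      ⟨H3 q lam hq hlam, H4 q lam hq hlam, H5 q lam hlam⟩⟩
  refine ⟨hA, ?_, Potts.torus_glauberMixingTime_le⟩
  obtain ⟨_, c, d, _, hc, hd, H⟩ := hA (1 / 4) (by norm_num) (by norm_num)
  obtain ⟨lam₀, hlam₀⟩ := eventually_atTop.1
    ((Potts.eventually_rpow_gap (c := c) hd).and (eventually_gt_atTop (1 : ℝ)))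
  refine ⟨lam₀, fun lam hlam => ?_⟩
  obtain ⟨hgap, hlam1⟩ := hlam₀ lam hlam
  have h0 : 0 ≤ c * lam ^ (2 + 1 / 4 : ℝ) := by positivity
  set q := ⌊c * lam ^ (2 + 1 / 4 : ℝ)⌋₊ + 2 with hq
  have h1 : c * lam ^ (2 + 1 / 4 : ℝ) < q := by
    have := Nat.lt_floor_add_one (c * lam ^ (2 + 1 / 4 : ℝ))
    rw [hq]; push_cast; linarith
  have h2 : (q : ℝ) < d * lam ^ (8 / 3 - 1 / 4 : ℝ) := by
    have := Nat.floor_le h0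
    rw [hq]; push_cast; linarith
  obtain ⟨-, hrapid, hslow⟩ := H q lam (by omega) hlam1
  exact ⟨q, by omega, hrapid h1, hslow (by omega) h2⟩
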